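/- **Theorem (massive co-ideal).** Consider a theory of a fermion $\psi$ and a real scalar $\phi$ whose only interaction vertex is $\bar\psi\psi\phi$, with amplitudes $\mathcal R=\{\bar\psi\psi,\ \phi\phi,\ \bar\psi\psi\phi\}$. Let $K$ be a field of characteristic $0$, and let $H$ be the free commutative $K$-algebra on the isomorphism classes of 1PI Feynman graphs with at least one loop and residue (external leg structure) in $\mathcal R$, with counit $\varepsilon$ vanishing on all nonempty graphs and multiplicative coproduct $$\Delta(\Gamma)=\Gamma\otimes\mathbb I+\mathbb I\otimes\Gamma+\sum_{\gamma}\gamma\otimes\Gamma/\gamma ,$$ the sum being over the proper nonempty subgraphs $\gamma$ which are disjoint unions of 1PI graphs with residue in $\mathcal R$ (in $\Gamma/\gamma$ a component with residue $\bar\psi\psi\phi$ becomes a vertex, a component with residue $\bar\psi\psi$ or $\phi\phi$ becomes part of an edge). Let $$c_k^r=\sum_{\mathrm{res}(\Gamma)=r,\ |\Gamma|=k}\frac{1}{\mathrm{Aut}(\Gamma)}\,\Gamma\qquad(r\in\mathcal R,\ k\ge 1)$$ (symmetry factors for graphs with distinguishable external legs), and let $H_{\mathrm{grad}}\subseteq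 H$ be the subalgebra generated by all $c_k^r$. Then: 1. The ideal $I$ of $H$ generated by the elements $c_k^{\bar\psi\psi}+c_k^{\bar\psi\psi\phi}$, $k\ge1$, is a co-ideal: $\Delta(I)\subseteq I\otimes H+H\otimes I$ and $\varepsilon(I)=0$. 2. $\Delta(H_{\mathrm{grad}})\subseteq H_{\mathrm{grad}}\otimes H_{\mathrm{grad}}$, and the ideal $J$ of $H_{\mathrm{grad}}$ generated by the same elements is a co-ideal of $H_{\mathrm{grad}}$: $\Delta(J)\subseteq J\otimes H_{\mathrm{grad}}+H_{\mathrm{grad}}\otimes J$ and $\varepsilon(J)=0$. 3. For every $k$, $c_k^{\bar\psi\psi\phi}=\sum_{\mathrm{res}(\Gamma)=\bar\psi\psi,\,|\Gamma|=k}\frac1{\mathrm{Aut}(\Gamma)}\sum_e\Gamma_e$, where $e$ runs over the internal fermion propagators of $\Gamma$ and $\Gamma_e$ is $\Gamma$ with a vertex with an external scalar leg inserted on $e$. 4. Let the amplitudes $A_\Gamma(m)$, matrices in spinor space, be given by regularized Feynman rules: momenta in a discrete abelian group, internal fermion momenta in a finite cut-off set, free fermion propagator $(D(k)-m)^{-1}$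 with an arbitrary matrix function $D$ for which $D(k)-m$ is invertible on the cut-off set, an arbitrary even scalar propagator, scalar coupling by the unit matrix, a factor $-1$ for each closed fermion loop, fermion legs of momentum $p$, external scalar of momentum zero. Then the Green functions, formal power series in $\alpha$ (the square of the coupling), $$G^{\bar\psi\psi}=D(p)-m-\sum_{k\ge1}\alpha^k\!\!\sum_{\mathrm{res}(\Gamma)=\bar\psi\psi,\ |\Gamma|=k}\frac{A_\Gamma(m)}{\mathrm{Aut}(\Gamma)},\qquad G^{\bar\psi\psi\phi}=-\Bigl(1+\sum_{k\ge1}\alpha^k\!\!\sum_{\mathrm{res}(\Gamma)=\bar\psi\psi\phi,\ |\Gamma|=k}\frac{A_\Gamma(m)}{\mathrm{Aut}(\Gamma)}\Bigr)$$ satisfy the identity $\partial_mG^{\bar\psi\psi}=G^{\bar\psi\psi\phi}$ in every order. 5. (Correspondence.) Let $K=\mathbb C$. For arbitrary spinor-matrix-valued amplitudes $A_\Gamma(m)$, with $A_\Gamma$ differentiable at the mass $m$ for $\mathrm{res}(\Gamma)=\bar\psi\psi$, and an arbitrary matrix in place of $D(p)$, the identity $\partial_mG^{\bar\psi\psi}=G^{\bar\psi\psi\phi}$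 holds at $m$ in every order if and only if, for every linear form $l$ on spinor matrices with $l(1)=1$, the character $\Phi_l:H\to\mathbb C$ with $$\Phi_l(\Gamma)=-\,l(\partial_mA_\Gamma)\ \ (\mathrm{res}(\Gamma)=\bar\psi\psi),\qquad \Phi_l(\Gamma)=l(A_\Gamma)\ \ (\mathrm{res}(\Gamma)=\bar\psi\psi\phi)$$ (and arbitrary fixed values on graphs with residue $\phi\phi$) is well defined on the quotient $H/I$. (Thus $\Phi_l$ sends $1-\sum_k\alpha^kc_k^{\bar\psi\psi}$ to $-l(\partial_mG^{\bar\psi\psi})$ and $1+\sum_k\alpha^kc_k^{\bar\psi\psi\phi}$ to $-l(G^{\bar\psi\psi\phi})$.) -/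

import Mathlib

open scoped TensorProduct

/-!  Feynman graphs of a theory with one fermion coupled to one real scalar through the single
interaction vertex `ψ̄ψφ`, their Hopf algebra structure maps, and Feynman rules. -/

namespace Yukawa

/-- A (raw) diagram with vertex set `V`.  Every vertex is an interaction vertex `ψ̄ψφ`: it carries one
incoming fermion half-edge, one outgoing fermion half-edge and one scalar half-edge.
`ferm u v`: the outgoing fermion half-edge of `u` is joined to the incoming one of `v` by an internal
fermion propagator.  `scal u v`: the scalar half-edges of `u` and `v` are joined by an internal scalar
propagator.  Half-edges that are not joined to anything are the external legs. -/
@[ext] structure Diagram (V : Type) where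
  ferm : V → V → Prop
  scal : V → V → Prop

/-- The three amplitudes `ψ̄ψ`, `φφ`, `ψ̄ψφ` of the theory. -/
inductive Residue : Type
  | psipsi : Residue
  | phiphi : Residue
  | psipsiphi : Residue

namespace Diagram

variable {V W : Type}

/-- Every half-edge takes part in at most one propagator. -/
structure IsFeynman (Γ : Diagram V) : Prop where
  ferm_right : ∀ u v w, Γ.ferm u v → Γ.ferm u w → v = w
  ferm_left : ∀ u v w, Γ.ferm u w → Γ.ferm v w → u = v
  scal_symm : ∀ u v, Γ.scal u v → Γ.scal v u
  scal_irrefl : ∀ v, ¬ Γ.scal v v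
  scal_right : ∀ u v w, Γ.scal u v → Γ.scal u w → v = w

/-- Number of external legs: incoming fermions, outgoing fermions, scalars. -/
noncomputable def nIn (Γ : Diagram V) : ℕ := Nat.card {v : V // ¬ ∃ u, Γ.ferm u v}

noncomputable def nOut (Γ : Diagram V) : ℕ := Nat.card {u : V // ¬ ∃ v, Γ.ferm u v}

noncomputable def nScal (Γ : Diagram V) : ℕ := Nat.card {u : V // ¬ ∃ v, Γ.scal u v}

/-- The external leg structure of a graph. -/
def HasResidue (Γ : Diagram V) : Residue → Prop
  | .psipsi => Γ.nIn = 1 ∧ Γ.nOut = 1 ∧ Γ.nScal = 0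
  | .phiphi => Γ.nIn = 0 ∧ Γ.nOut = 0 ∧ Γ.nScal = 2
  | .psipsiphi => Γ.nIn = 1 ∧ Γ.nOut = 1 ∧ Γ.nScal = 1

/-- Adjacency in the underlying graph. -/
def Adj (Γ : Diagram V) (u v : V) : Prop := Γ.ferm u v ∨ Γ.ferm v u ∨ Γ.scal u v ∨ Γ.scal v u

def Connected (Γ : Diagram V) : Prop :=
  Nonempty V ∧ ∀ u v, Relation.ReflTransGen Γ.Adj u v

/-- Remove the internal fermion propagator from `a` to `b`. -/
def eraseFerm (Γ : Diagram V) (a b : V) : Diagram V where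
  ferm u v := Γ.ferm u v ∧ ¬ (u = a ∧ v = b)
  scal := Γ.scal

/-- Remove the internal scalar propagator between `a` and `b`. -/
def eraseScal (Γ : Diagram V) (a b : V) : Diagram V where
  ferm := Γ.ferm
  scal u v := Γ.scal u v ∧ s(u, v) ≠ s(a, b)

/-- One-particle irreducible: connected, and still connected after removal of any one propagator. -/
def OnePI (Γ : Diagram V) : Prop :=
  Γ.Connected ∧ (∀ a b, Γ.ferm a b → (Γ.eraseFerm a b).Connected) ∧
    (∀ a b, Γ.scal a b → (Γ.eraseScal a b).Connected)

/-- The loop number `|Γ| = #(internal edges) - #(vertices) + 1` of a connected graph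
(`scal` is symmetric, so that each scalar propagator is counted by two ordered pairs). -/
noncomputable def loops (Γ : Diagram V) : ℕ :=
  Nat.card {e : V × V // Γ.ferm e.1 e.2} + Nat.card {e : V × V // Γ.scal e.1 e.2} / 2 + 1
    - Nat.card V

/-- The generators of the Hopf algebra: 1PI graphs with at least one loop whose amplitude needs
renormalization. -/
def IsGenerator (Γ : Diagram V) : Prop :=
  Γ.IsFeynman ∧ Γ.OnePI ∧ 1 ≤ Γ.loops ∧ ∃ r, Γ.HasResidue r

/-- `e` is an isomorphism of diagrams. -/
def IsIso (Γ : Diagram V) (Γ' : Diagram W) (e : V ≃ W) : Prop :=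
  (∀ u v, Γ.ferm u v ↔ Γ'.ferm (e u) (e v)) ∧ (∀ u v, Γ.scal u v ↔ Γ'.scal (e u) (e v))

/-- The order of the automorphism group. -/
noncomputable def autCard (Γ : Diagram V) : ℕ := Nat.card {σ : Equiv.Perm V // Γ.IsIso Γ σ}

/-- Transport to the vertex set `Fin n`. -/
noncomputable def toFin [Finite V] (Γ : Diagram V) : Diagram (Fin (Nat.card V)) where
  ferm u v := Γ.ferm ((Finite.equivFin V).symm u) ((Finite.equivFin V).symm v)
  scal u v := Γ.scal ((Finite.equivFin V).symm u) ((Finite.equivFin V).symm v)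

/-- The subgraph on a set of vertices, with all propagators between them; all other half-edges become
external legs. -/
def induce (Γ : Diagram V) (W : Finset V) : Diagram {v : V // v ∈ W} where
  ferm u v := Γ.ferm u v
  scal u v := Γ.scal u v

/-- `P` describes a subgraph `γ = ∏ γᵢ` of `Γ`, a disjoint union of divergent 1PI graphs `γᵢ`; it is
given by the family of the vertex sets of the `γᵢ`.  (In a 1PI graph with residue `ψ̄ψ`, `φφ` or `ψ̄ψφ`,
a 1PI subgraph with such a residue contains all the propagators between its vertices: joining two of
its two or three legs would leave at most one leg, hence a bridge.  So it is determined by its vertex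
set.) -/
def IsSubgraph (Γ : Diagram V) (P : Finset (Finset V)) : Prop :=
  (∀ W ∈ P, (Γ.induce W).IsGenerator) ∧ (P : Set (Finset V)).PairwiseDisjoint id

/-- The vertices of the contracted graph `Γ/γ`: the components of `γ` with residue `ψ̄ψφ`, each shrunk
to a vertex, and the vertices of `Γ` outside `γ` (as singletons). -/
def IsContractedVertex (Γ : Diagram V) (P : Finset (Finset V)) (A : Finset V) : Prop :=
  (A ∈ P ∧ (Γ.induce A).HasResidue .psipsiphi) ∨ ∃ v, A = {v} ∧ ∀ W ∈ P, v ∉ W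

/-- The components of `γ` with two legs, each shrunk to a point on an edge. -/
def IsContractedEdge (Γ : Diagram V) (P : Finset (Finset V)) (A : Finset V) : Prop :=
  A ∈ P ∧ ¬ (Γ.induce A).HasResidue .psipsiphi

/-- A propagator between two disjoint blocks of vertices. -/
def FermStep (Γ : Diagram V) (A B : Finset V) : Prop := A ≠ B ∧ ∃ a ∈ A, ∃ b ∈ B, Γ.ferm a b

def ScalStep (Γ : Diagram V) (A B : Finset V) : Prop := A ≠ B ∧ ∃ a ∈ A, ∃ b ∈ B, Γ.scal a b

/-- `B` is reached from `A` by steps all of whose intermediate blocks satisfy `S`. -/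
def Line (step : Finset V → Finset V → Prop) (S : Finset V → Prop) (A B : Finset V) : Prop :=
  ∃ C, Relation.ReflTransGen (fun X Y => step X Y ∧ S Y) A C ∧ step C B

/-- The contracted graph `Γ/γ`: components with residue `ψ̄ψφ` become vertices; components with residue
`ψ̄ψ` or `φφ` disappear, and the propagators on their two sides are merged into one. -/
def contract (Γ : Diagram V) (P : Finset (Finset V)) :
    Diagram {A : Finset V // Γ.IsContractedVertex P A} where
  ferm A B := Line Γ.FermStep (Γ.IsContractedEdge P) A B
  scal A B := A ≠ B ∧ Line Γ.ScalStep (Γ.IsContractedEdge P) A B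

/-- Insertion of a new vertex, whose scalar half-edge is an external leg, on the internal fermion
propagator from `a` to `b`. -/
def insertScalar (Γ : Diagram V) (a b : V) : Diagram (Option V) where
  ferm
    | some u, some v => Γ.ferm u v ∧ ¬ (u = a ∧ v = b)
    | some u, none => u = a
    | none, some v => v = b
    | none, none => False
  scal
    | some u, some v => Γ.scal u v
    | _, _ => False

end Diagram

/-- Isomorphism as an equivalence relation on generators with `n` labelled vertices. -/
def genSetoid (n : ℕ) : Setoid {Γ : Diagram (Fin n) // Γ.IsGenerator} where
  r Γ Γ' := ∃ e, Γ.1.IsIso Γ'.1 e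
  iseqv :=
    { refl := fun _ => ⟨Equiv.refl _, fun _ _ => Iff.rfl, fun _ _ => Iff.rfl⟩
      symm := fun ⟨e, h₁, h₂⟩ =>
        ⟨e.symm, fun u v => by simp [h₁], fun u v => by simp [h₂]⟩
      trans := fun ⟨e, h₁, h₂⟩ ⟨f, k₁, k₂⟩ =>
        ⟨e.trans f, fun u v => by simp [h₁, k₁], fun u v => by simp [h₂, k₂]⟩ }

/-- Isomorphism classes of generators with `n` vertices. -/
def GenOn (n : ℕ) : Type := Quotient (genSetoid n)

/-- Isomorphism classes of 1PI Feynman graphs with at least one loop and residue `ψ̄ψ`, `φφ` or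
`ψ̄ψφ`. -/
def Gen : Type := Σ n : ℕ, GenOn n

/-- A representative.  Everything computed from it below is invariant under isomorphisms. -/
noncomputable def Gen.rep (Γ : Gen) : Diagram (Fin Γ.1) := (Quotient.out Γ.2).1

theorem Gen.rep_isGenerator (Γ : Gen) : Γ.rep.IsGenerator := (Quotient.out Γ.2).2

section Finiteness

theorem Diagram.card_ferm {V : Type} [Finite V] {Γ : Diagram V} (h : Γ.IsFeynman) :
    Nat.card {e : V × V // Γ.ferm e.1 e.2} + Γ.nOut = Nat.card V := by
  classical
  have e : {e : V × V // Γ.ferm e.1 e.2} ≃ {u : V // ∃ v, Γ.ferm u v} :=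
    { toFun := fun e => ⟨e.1.1, e.1.2, e.2⟩
      invFun := fun u => ⟨(u.1, u.2.choose), u.2.choose_spec⟩
      left_inv := fun ⟨⟨u, v⟩, huv⟩ => by
        have hex : ∃ w, Γ.ferm u w := ⟨v, huv⟩
        have := h.ferm_right u _ _ hex.choose_spec huv
        simp [this]
      right_inv := fun _ => rfl }
  rw [Nat.card_congr e, Diagram.nOut, ← Nat.card_sum]
  exact Nat.card_congr (Equiv.sumCompl _)

theorem Diagram.card_scal {V : Type} [Finite V] {Γ : Diagram V} (h : Γ.IsFeynman) :
    Nat.card {e : V × V // Γ.scal e.1 e.2} + Γ.nScal = Nat.card V := by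
  classical
  have e : {e : V × V // Γ.scal e.1 e.2} ≃ {u : V // ∃ v, Γ.scal u v} :=
    { toFun := fun e => ⟨e.1.1, e.1.2, e.2⟩
      invFun := fun u => ⟨(u.1, u.2.choose), u.2.choose_spec⟩
      left_inv := fun ⟨⟨u, v⟩, huv⟩ => by
        have hex : ∃ w, Γ.scal u w := ⟨v, huv⟩
        have := h.scal_right u _ _ hex.choose_spec huv
        simp [this]
      right_inv := fun _ => rfl }
  rw [Nat.card_congr e, Diagram.nScal, ← Nat.card_sum]
  exact Nat.card_congr (Equiv.sumCompl _)

instance (n : ℕ) : Finite (GenOn n) := by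
  have : Finite (Diagram (Fin n)) :=
    Finite.of_injective (fun Γ : Diagram (Fin n) => (Γ.ferm, Γ.scal)) (by
      rintro ⟨a, b⟩ ⟨c, d⟩ h
      simpa using h)
  exact inferInstanceAs (Finite (Quotient (genSetoid n)))

/-- There are finitely many graphs with given residue and loop number. -/
theorem finite_gens (r : Residue) (k : ℕ) :
    {Γ : Gen | Γ.rep.HasResidue r ∧ Γ.rep.loops = k}.Finite := by
  refine (Set.finite_range (fun x : (Σ n : Fin (2 * k + 3), GenOn n) =>
    (⟨x.1, x.2⟩ : Gen))).subset ?_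
  rintro Γ ⟨hr, hk⟩
  have h := (Gen.rep_isGenerator Γ).1
  have h₁ := Diagram.card_ferm h
  have h₂ := Diagram.card_scal h
  have h₃ : Nat.card (Fin Γ.1) = Γ.1 := by simp
  unfold Diagram.loops at hk
  have : Γ.1 < 2 * k + 3 := by
    cases r <;> obtain ⟨-, h₄, h₅⟩ := hr <;> omega
  exact ⟨⟨⟨Γ.1, this⟩, Γ.2⟩, rfl⟩

end Finiteness

/-- The graphs with residue `r` and `k` loops. -/
noncomputable def gens (r : Residue) (k : ℕ) : Finset Gen := (finite_gens r k).toFinset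

/-- The commutative algebra freely generated by the 1PI graphs: products are disjoint unions, and the
unit is the empty graph. -/
abbrev H (K : Type*) [Field K] : Type _ := MvPolynomial Gen K

section Algebra

variable (K : Type*) [Field K]

open Classical in
/-- A graph as an element of `H`.  A graph without loops is the unit. -/
noncomputable def graph {V : Type} [Finite V] (Γ : Diagram V) : H K :=
  if h : Γ.toFin.IsGenerator then
    MvPolynomial.X ⟨Nat.card V, Quotient.mk (genSetoid _) ⟨Γ.toFin, h⟩⟩
  else 1

open Classical in
/-- The coproduct of a generator, `Δ(Γ) = Γ ⊗ 𝕀 + 𝕀 ⊗ Γ + ∑_γ γ ⊗ Γ/γ`, the sum being over the proper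
nonempty subgraphs `γ` which are disjoint unions of divergent 1PI graphs. -/
noncomputable def comulGen (Γ : Gen) : H K ⊗[K] H K :=
  (MvPolynomial.X Γ : H K) ⊗ₜ[K] (1 : H K) + (1 : H K) ⊗ₜ[K] (MvPolynomial.X Γ : H K) +
    ∑ P : Finset (Finset (Fin Γ.1)) with
        Γ.rep.IsSubgraph P ∧ P ≠ ∅ ∧ Finset.univ ∉ P,
      (∏ W ∈ P, graph K (Γ.rep.induce W)) ⊗ₜ[K] graph K (Γ.rep.contract P)

/-- The coproduct. -/
noncomputable def comul : H K →ₐ[K] H K ⊗[K] H K := MvPolynomial.aeval (comulGen K)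

/-- The counit, which vanishes on all nonempty graphs. -/
noncomputable def counit : H K →ₐ[K] K := MvPolynomial.aeval fun _ => 0

/-- `1/Aut(Γ)`, for graphs with distinguishable external legs.  As graphs are taken with unlabelled
legs, the `nScal!` ways of labelling the scalar legs have to be summed over (by orbit counting,
`∑ 1/Aut` over the labellings is `nScal!` divided by the order of the full automorphism group). -/
noncomputable def symWeight (Γ : Gen) : K := (Γ.rep.nScal.factorial : K) / (Γ.rep.autCard : K)

/-- `c_k^r`, the sum of all graphs with residue `r` and `k` loops, weighted by symmetry factors. -/
noncomputable def c (r : Residue) (k : ℕ) : H K :=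
  ∑ Γ ∈ gens r k, symWeight K Γ • (MvPolynomial.X Γ : H K)

/-- The algebra `H_grad` generated by the `c_k^r`. -/
noncomputable def Hgrad : Subalgebra K (H K) :=
  Algebra.adjoin K (Set.range fun x : Residue × ℕ => c K x.1 x.2)

/-- The elements `c_k^{ψ̄ψ} + c_k^{ψ̄ψφ}` (zero for `k = 0`). -/
noncomputable def wardElement (k : ℕ) : H K := c K .psipsi k + c K .psipsiphi k

/-- The ideal of `H` generated by the elements `c_k^{ψ̄ψ} + c_k^{ψ̄ψφ}`. -/
noncomputable def wardIdeal : Ideal (H K) := Ideal.span (Set.range (wardElement K))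

/-- The ideal of `H_grad` generated by the elements `c_k^{ψ̄ψ} + c_k^{ψ̄ψφ}`. -/
noncomputable def wardIdealGrad : Ideal (Hgrad K) :=
  Ideal.span {x | ∃ k, (x : H K) = wardElement K k}

/-- The image of `A ⊗ B` in `H ⊗ H`. -/
noncomputable def tensorSub (A B : Submodule K (H K)) : Submodule K (H K ⊗[K] H K) :=
  Submodule.map₂ (TensorProduct.mk K (H K) (H K)) A B

/-- `I` is a co-ideal of `B`: `Δ(I) ⊆ I ⊗ B + B ⊗ I` and `ε(I) = 0`, where `B ⊆ H` is closed under
`Δ` and contains `I`. -/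
structure IsCoidealOf (B I : Submodule K (H K)) : Prop where
  le : I ≤ B
  comul_closed : ∀ x ∈ B, comul K x ∈ tensorSub K B B
  comul_mem : ∀ x ∈ I, comul K x ∈ tensorSub K I B ⊔ tensorSub K B I
  counit_eq : ∀ x ∈ I, counit K x = 0

open Classical in
/-- The sum of all graphs obtained from the `k`-loop graphs of `c_k^{ψ̄ψ}` by inserting a scalar vertex on
one of the internal fermion propagators. -/
noncomputable def insertionSum (k : ℕ) : H K :=
  ∑ Γ ∈ gens .psipsi k, symWeight K Γ •
    ∑ e : Fin Γ.1 × Fin Γ.1 with Γ.rep.ferm e.1 e.2, graph K (Γ.rep.insertScalar e.1 e.2)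

end Algebra

section FeynmanRules

/-! Amplitudes take values in the matrices acting on spinor space (with index set `ι`).
Green functions are formal power series in `α = g²`, given by their coefficients. -/

variable {ι : Type*} [Fintype ι] [DecidableEq ι]

/-- The contribution of order `α^k` of all graphs with residue `r`, for a given assignment of
mass-dependent amplitudes to graphs. -/
noncomputable def loopSum (A : Gen → ℝ → Matrix ι ι ℂ) (r : Residue) (k : ℕ) (m : ℝ) :
    Matrix ι ι ℂ := ∑ Γ ∈ gens r k, symWeight ℂ Γ • A Γ m

/-- `G^{ψ̄ψ} = (d - m) - ∑_k α^k ∑_Γ A_Γ / Aut(Γ)`, the inverse fermion propagator, with tree level part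
`d - m`. -/
noncomputable def greenPsiPsi (A : Gen → ℝ → Matrix ι ι ℂ) (d : Matrix ι ι ℂ) (k : ℕ) (m : ℝ) :
    Matrix ι ι ℂ := (if k = 0 then d - (m : ℂ) • 1 else 0) - loopSum A .psipsi k m

/-- `G^{ψ̄ψφ} = - (1 + ∑_k α^k ∑_Γ A_Γ / Aut(Γ))`, the vertex function; its tree level part is the
coefficient of `φ` in `d - (m + φ)`. -/
noncomputable def greenPsiPsiPhi (A : Gen → ℝ → Matrix ι ι ℂ) (k : ℕ) (m : ℝ) : Matrix ι ι ℂ :=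
  - ((if k = 0 then 1 else 0) + loopSum A .psipsiphi k m)

/-- The identity `∂_m G^{ψ̄ψ} = G^{ψ̄ψφ}` at the mass `m`, for all orders and all spinor components. -/
def MassIdentity (A : Gen → ℝ → Matrix ι ι ℂ) (d : Matrix ι ι ℂ) (m : ℝ) : Prop :=
  ∀ (k : ℕ) (i j : ι),
    HasDerivAt (fun μ : ℝ => greenPsiPsi A d k μ i j) (greenPsiPsiPhi A k m i j) m

open Classical in
/-- The character of `H` of a form factor `l` (with `l 1 = 1`).  Both Green functions are normalized
to have tree level part `1`: a vertex graph is sent to the form factor of its amplitude, and a fermion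
self-energy graph to that of the mass derivative of its amplitude, with the sign such that
`1 - ∑ c_k^{ψ̄ψ} α^k ↦ - l(∂_m G^{ψ̄ψ})` and `1 + ∑ c_k^{ψ̄ψφ} α^k ↦ - l(G^{ψ̄ψφ})`.
The values `t` on the scalar self-energy graphs are arbitrary. -/
noncomputable def massCharacter (A : Gen → ℝ → Matrix ι ι ℂ) (l : Matrix ι ι ℂ →ₗ[ℂ] ℂ)
    (t : Gen → ℂ) (m : ℝ) : H ℂ →ₐ[ℂ] ℂ :=
  MvPolynomial.aeval fun Γ =>
    if Γ.rep.HasResidue .psipsi then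
      - l (Matrix.of fun i j => deriv (fun μ : ℝ => A Γ μ i j) m)
    else if Γ.rep.HasResidue .psipsiphi then l (A Γ m)
    else t Γ

/-- Data for regularized Feynman rules: momenta form a discrete group `G` (finite volume), internal
fermion lines carry momenta in the finite set `cutoff`, the free fermion propagator is
`(dirac k - m)⁻¹`, and the free scalar propagator is an even function. -/
structure Rules (G : Type*) [AddCommGroup G] (ι : Type*) where
  cutoff : Finset G
  dirac : G → Matrix ι ι ℂ
  scalarProp : G → ℂ
  scalarProp_neg : ∀ q, scalarProp (-q) = scalarProp q

variable {G : Type*} [AddCommGroup G]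

/-- The free fermion propagator. -/
noncomputable def Rules.fermionProp (F : Rules G ι) (m : ℝ) (k : G) : Matrix ι ι ℂ :=
  (F.dirac k - (m : ℂ) • (1 : Matrix ι ι ℂ))⁻¹

/-- Momentum conservation: `k v` and `k' v` are the fermion momenta entering and leaving the vertex `v`,
so that `k' v - k v` enters through the scalar line.  The external fermion legs carry the momentum `p`,
and an external scalar leg carries zero momentum. -/
structure Conserved {n : ℕ} (F : Rules G ι) (Γ : Diagram (Fin n)) (p : G) (k k' : Fin n → G) :
    Prop where
  internal : ∀ u v, Γ.ferm u v → k' u = k v ∧ k v ∈ F.cutoff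
  incoming : ∀ v, (¬ ∃ u, Γ.ferm u v) → k v = p
  outgoing : ∀ u, (¬ ∃ v, Γ.ferm u v) → k' u = p
  scalar : ∀ u v, Γ.scal u v → (k' u - k u) + (k' v - k v) = 0
  scalarExt : ∀ u, (¬ ∃ v, Γ.scal u v) → k' u - k u = 0

/-- The number of closed fermion loops: fermion lines, less the open ones. -/
noncomputable def closedLoops {n : ℕ} (Γ : Diagram (Fin n)) : ℕ := Nat.card (Quot Γ.ferm) - Γ.nOut

open Classical in
/-- The product of the propagators for given momenta, contracted over the spinor indices: the scalar
couples by the unit matrix, so that there is one spinor index `s v` for each vertex.  Each scalar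
propagator is counted once, by its ends `u < v`. -/
noncomputable def integrand {n : ℕ} (F : Rules G ι) (Γ : Diagram (Fin n)) (m : ℝ)
    (k k' : Fin n → G) (i j : ι) : ℂ :=
  ∑ s : Fin n → ι with
      (∀ v, (¬ ∃ u, Γ.ferm u v) → s v = j) ∧ (∀ u, (¬ ∃ v, Γ.ferm u v) → s u = i),
    (∏ u, ∏ v, if Γ.ferm u v then F.fermionProp m (k' u) (s v) (s u) else 1) *
      ∏ u, ∏ v, if u < v ∧ Γ.scal u v then F.scalarProp (k' u - k u) else 1

open Classical in
/-- The amputated amplitude of a graph with one open fermion line: the sum over all momenta of the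
internal lines, with a factor `-1` for every closed fermion loop. -/
noncomputable def amplitude {n : ℕ} (F : Rules G ι) (p : G) (Γ : Diagram (Fin n)) (m : ℝ) :
    Matrix ι ι ℂ :=
  Matrix.of fun i j => (-1) ^ closedLoops Γ *
    ∑ q ∈ Fintype.piFinset (fun _ : Fin n => insert p F.cutoff) ×ˢ
        Fintype.piFinset (fun _ : Fin n => insert p F.cutoff) with Conserved F Γ p q.1 q.2,
      integrand F Γ m q.1 q.2 i j

end FeynmanRules

end Yukawa

/-!
The combinatorial statements are proved with labelled graphs. By orbit counting
(`sum_symWeight`, `c_eq_labelledSum`) the sum `c_k^r`, weighted by symmetry factors, is `1 / n!` times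
the sum of all graphs with residue `r` on `n` labelled vertices, up to the permutations of external
scalar legs, where `n = 2k` for self-energies and `n = 2k + 1` for vertex graphs. All symmetry factors
then turn into counts of labellings, and identities between sums of graphs follow from bijections.
One-particle irreducibility is used in the form that every cut contains at least two propagators
(`IsFeynman.onePI_iff`).

The bijections come from two operations: the insertion of a graph with two legs on a propagator
(`insertTwo`) and the replacement of a vertex by a graph with three legs (`insertVertex`). A component
of a subgraph can be removed in exactly one way by undoing such an insertion, and contraction of the
whole subgraph does not notice whether the component was removed before
(`Insertable.contract_isomorphic`, `Substitutable.contract_isomorphic`). Marking one component of a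
subgraph and removing it gives recursions in the numbers of components (`smul_normSplitSum_two`,
`smul_normSplitSum_three`); the factors in them are the numbers of propagators and vertices at which
the component can be put back. Let `V`, `F`, `S` be the generating series, by the number of additional
vertices, of the vertex corrections and of the fermion and scalar self-energies, and `t` the variable.
The recursions are solved by binomial coefficients, and with `C_r(N)` the sum of all graphs with
residue `r` and `N` vertices, `o` external outgoing fermions and `s` external scalars, the result
(`comul_labelledSum_eq`) is
`Δ C_r(n) = C_r(n) ⊗ 1 + ∑_N [t^(n - N)] (1 + V)^N (1 - F)^(o - N) (1 - S)^((s - N) / 2) ⊗ C_r(N)`.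
In particular `H_grad` is closed under `Δ`. The generators of the ideal say that `V = -F`. Modulo the
ideal the series for a vertex graph with `N + 1` vertices, `(1 + V)^(N + 1) (1 - F)^(-N) (1 - S)^(-N / 2)`,
is therefore equal to the series for a fermion self-energy with `N` vertices,
`(1 + V)^N (1 - F)^(1 - N) (1 - S)^(-N / 2)` (`coeff_insertionSeries_sub_mem`), so that the coproduct
of a generator of the ideal is, modulo the ideal in the first factor, a sum of terms with generators
of the ideal in the second factor (`comul_wardSum_mem`).

The sum of the vertex graphs is the special case of an insertion of a single vertex, whose scalar
half-edge becomes the external leg, on a fermion propagator (`c_psipsiphi_eq_insertionSum`). For the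
Feynman rules the derivative of the propagator with respect to the mass is its square, which is what
an external scalar of momentum zero inserts; the number of closed fermion loops is unchanged
(`hasDerivAt_amplitudeOn`). Applying the amplitude linearly to the sum of the vertex graphs gives the
identity of the Green functions (`massIdentity_amplitude`). Finally, the character `Φ_l` sends the
generator of order `k` to the value of `l` on the difference of the two sides of the identity of order
`k`, and the forms with `l(1) = 1` separate matrices (`massIdentity_iff`).
-/

namespace Yukawa

/-! ### Half-edges and legs -/

/-- The three half-edges of an interaction vertex: the outgoing fermion, the incoming fermion, and
the scalar. -/
inductive Leg : Type
  | out | inc | sca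

/-- The kind of half-edge that a half-edge of the given kind can be joined to. -/
def Leg.bar : Leg → Leg
  | .out => .inc
  | .inc => .out
  | .sca => .sca

@[simp] theorem Leg.bar_bar (t : Leg) : t.bar.bar = t := by cases t <;> rfl

/-- The number of external legs of each kind of a graph with residue `r`. -/
def Residue.legs : Residue → Leg → ℕ
  | .psipsi, .out => 1
  | .psipsi, .inc => 1
  | .psipsi, .sca => 0
  | .phiphi, .out => 0
  | .phiphi, .inc => 0
  | .phiphi, .sca => 2
  | .psipsiphi, _ => 1

namespace Diagram

variable {V W : Type}

/-- The half-edge of kind `t` at `u` is joined to a half-edge (of kind `t.bar`) at `v`. -/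
def link (Γ : Diagram V) : Leg → V → V → Prop
  | .out, u, v => Γ.ferm u v
  | .inc, u, v => Γ.ferm v u
  | .sca, u, v => Γ.scal u v

/-- The half-edge of kind `t` at `u` is an external leg. -/
def Pending (Γ : Diagram V) (t : Leg) (u : V) : Prop := ¬ ∃ v, Γ.link t u v

/-- The number of external legs of kind `t`. -/
noncomputable def nLeg (Γ : Diagram V) (t : Leg) : ℕ := Nat.card {u : V // Γ.Pending t u}

/-- The diagram with prescribed joined half-edges. -/
def ofLink (R : Leg → V → V → Prop) : Diagram V := ⟨R .out, R .sca⟩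

theorem link_ofLink {R : Leg → V → V → Prop} (h : ∀ t u v, R t u v → R t.bar v u) (t : Leg)
    (u v : V) : (ofLink R).link t u v ↔ R t u v := by
  cases t
  · exact Iff.rfl
  · exact ⟨fun hr => h .out v u hr, fun hr => h .inc u v hr⟩
  · exact Iff.rfl

theorem ext_link {Γ Γ' : Diagram V} (h : ∀ t u v, Γ.link t u v ↔ Γ'.link t u v) : Γ = Γ' := by
  ext u v
  · exact h .out u v
  · exact h .sca u v

/-- The rules for a Feynman graph, uniformly in the kind of half-edge: every half-edge is joined to at
most one half-edge, which is of the opposite kind and not itself. -/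
theorem isFeynman_iff {Γ : Diagram V} : Γ.IsFeynman ↔
    (∀ t u v w, Γ.link t u v → Γ.link t u w → v = w) ∧
    (∀ t u v, Γ.link t u v → Γ.link t.bar v u) ∧ ∀ v, ¬ Γ.link .sca v v := by
  constructor
  · intro h
    refine ⟨?_, ?_, h.scal_irrefl⟩
    · rintro (_ | _ | _) u v w h₁ h₂
      · exact h.ferm_right u v w h₁ h₂
      · exact h.ferm_left v w u h₁ h₂
      · exact h.scal_right u v w h₁ h₂
    · rintro (_ | _ | _) u v h₁
      · exact h₁
      · exact h₁
      · exact h.scal_symm u v h₁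
  · rintro ⟨h₁, h₂, h₃⟩
    exact ⟨h₁ .out, fun u v w hu hv => h₁ .inc w u v hu hv, h₂ .sca, h₃, h₁ .sca⟩

theorem IsFeynman.link_unique {Γ : Diagram V} (h : Γ.IsFeynman) {t : Leg} {u v w : V}
    (h₁ : Γ.link t u v) (h₂ : Γ.link t u w) : v = w := (isFeynman_iff.1 h).1 t u v w h₁ h₂

theorem IsFeynman.link_symm {Γ : Diagram V} (h : Γ.IsFeynman) {t : Leg} {u v : V}
    (h₁ : Γ.link t u v) : Γ.link t.bar v u := (isFeynman_iff.1 h).2.1 t u v h₁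

theorem IsFeynman.link_comm {Γ : Diagram V} (h : Γ.IsFeynman) {t : Leg} {u v : V} :
    Γ.link t u v ↔ Γ.link t.bar v u :=
  ⟨h.link_symm, fun h' => by simpa using h.link_symm h'⟩

theorem hasResidue_iff {Γ : Diagram V} {r : Residue} :
    Γ.HasResidue r ↔ ∀ t, Γ.nLeg t = r.legs t := by
  have h₁ : Γ.nLeg .inc = Γ.nIn := rfl
  have h₂ : Γ.nLeg .out = Γ.nOut := rfl
  have h₃ : Γ.nLeg .sca = Γ.nScal := rfl
  constructor
  · cases r <;> rintro ⟨a, b, c⟩ (_ | _ | _) <;> simp_all [Residue.legs]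
  · intro h
    have a := h .inc
    have b := h .out
    have c := h .sca
    cases r <;> exact ⟨h₁ ▸ a, h₂ ▸ b, h₃ ▸ c⟩

theorem HasResidue.unique {Γ : Diagram V} {r r' : Residue} (h : Γ.HasResidue r)
    (h' : Γ.HasResidue r') : r = r' := by
  cases r <;> cases r' <;> first | rfl | (simp only [HasResidue] at h h'; omega)

/-! ### One-particle irreducibility in terms of cuts -/

/-- The half-edge `p` starts in `S` and is joined to a half-edge outside of `S`. -/
def Cross (Γ : Diagram V) (S : Set V) (p : Leg × V) : Prop :=
  p.2 ∈ S ∧ ∃ v, v ∉ S ∧ Γ.link p.1 p.2 v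

/-- At least two propagators leave `S`. -/
def TwoCross (Γ : Diagram V) (S : Set V) : Prop :=
  ∃ p q : Leg × V, p ≠ q ∧ Γ.Cross S p ∧ Γ.Cross S q

/-- Every cut of the graph contains at least two propagators. -/
def Solid (Γ : Diagram V) : Prop :=
  Nonempty V ∧ ∀ S : Set V, S.Nonempty → S ≠ Set.univ → Γ.TwoCross S

theorem connected_iff {Γ : Diagram V} : Γ.Connected ↔ Nonempty V ∧
    ∀ S : Set V, S.Nonempty → S ≠ Set.univ → ∃ u ∈ S, ∃ v ∉ S, Γ.Adj u v := by
  refine and_congr_right fun _ => ⟨fun h S ⟨u, hu⟩ hS => ?_, fun h u v => ?_⟩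
  · obtain ⟨v, hv⟩ := (Set.ne_univ_iff_exists_notMem S).1 hS
    by_contra hc
    push Not at hc
    refine hv ?_
    induction h u v with
    | refl => exact hu
    | tail _ hab ih =>
      by_contra hn
      exact hc _ (not_not.1 fun hb => hb (by by_contra h'; exact hb (ih h'))) _ hn hab
  · by_contra hn
    obtain ⟨a, ha, b, hb, hab⟩ := h {w | Relation.ReflTransGen Γ.Adj u w} ⟨u, .refl⟩
      ((Set.ne_univ_iff_exists_notMem _).2 ⟨v, hn⟩)
    exact hb (Relation.ReflTransGen.tail ha hab)

theorem IsFeynman.adj_iff {Γ : Diagram V} (h : Γ.IsFeynman) {u v : V} :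
    Γ.Adj u v ↔ ∃ t, Γ.link t u v := by
  constructor
  · rintro (h₁ | h₁ | h₁ | h₁)
    · exact ⟨.out, h₁⟩
    · exact ⟨.inc, h₁⟩
    · exact ⟨.sca, h₁⟩
    · exact ⟨.sca, h.scal_symm _ _ h₁⟩
  · rintro ⟨_ | _ | _, h₁⟩
    · exact .inl h₁
    · exact .inr (.inl h₁)
    · exact .inr (.inr (.inl h₁))

/-- The removal of one propagator disconnects a connected graph exactly if some cut consists of that
propagator alone. -/
theorem IsFeynman.onePI_iff {Γ : Diagram V} (h : Γ.IsFeynman) : Γ.OnePI ↔ Γ.Solid := by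
  constructor
  · rintro ⟨hc, hf, hs⟩
    refine ⟨hc.1, fun S hS hS' => ?_⟩
    obtain ⟨u, hu, v, hv, huv⟩ := (connected_iff.1 hc).2 S hS hS'
    obtain ⟨t, ht⟩ := h.adj_iff.1 huv
    by_contra hn
    have key : ∀ t' u' v', u' ∈ S → v' ∉ S → Γ.link t' u' v' → t' = t ∧ u' = u ∧ v' = v := by
      intro t' u' v' hu' hv' h'
      have : (t', u') = (t, u) := by
        by_contra hne
        exact hn ⟨_, _, hne, ⟨hu', v', hv', h'⟩, ⟨hu, v, hv, ht⟩⟩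
      obtain ⟨rfl, rfl⟩ := Prod.mk.inj this
      exact ⟨rfl, rfl, h.link_unique h' ht⟩
    cases t
    · obtain ⟨a, ha, b, hb, hab⟩ := (connected_iff.1 (hf u v ht)).2 S hS hS'
      rcases hab with ⟨h₁, h₂⟩ | ⟨h₁, h₂⟩ | h₁ | h₁
      · exact h₂ (key .out a b ha hb h₁).2
      · exact Leg.noConfusion (key .inc a b ha hb h₁).1
      · exact Leg.noConfusion (key .sca a b ha hb h₁).1
      · exact Leg.noConfusion (key .sca a b ha hb (h.scal_symm _ _ h₁)).1
    · obtain ⟨a, ha, b, hb, hab⟩ := (connected_iff.1 (hf v u ht)).2 S hS hS'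
      rcases hab with ⟨h₁, h₂⟩ | ⟨h₁, h₂⟩ | h₁ | h₁
      · exact Leg.noConfusion (key .out a b ha hb h₁).1
      · exact h₂ (key .inc a b ha hb h₁).2.symm
      · exact Leg.noConfusion (key .sca a b ha hb h₁).1
      · exact Leg.noConfusion (key .sca a b ha hb (h.scal_symm _ _ h₁)).1
    · obtain ⟨a, ha, b, hb, hab⟩ := (connected_iff.1 (hs u v ht)).2 S hS hS'
      rcases hab with h₁ | h₁ | ⟨h₁, h₂⟩ | ⟨h₁, h₂⟩
      · exact Leg.noConfusion (key .out a b ha hb h₁).1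
      · exact Leg.noConfusion (key .inc a b ha hb h₁).1
      · obtain ⟨-, rfl, rfl⟩ := key .sca a b ha hb h₁
        exact h₂ rfl
      · obtain ⟨-, rfl, rfl⟩ := key .sca a b ha hb (h.scal_symm _ _ h₁)
        exact h₂ Sym2.eq_swap
  · rintro ⟨hV, hS⟩
    refine ⟨connected_iff.2 ⟨hV, fun S h₁ h₂ => ?_⟩, fun a b hab => connected_iff.2
      ⟨hV, fun S h₁ h₂ => ?_⟩, fun a b hab => connected_iff.2 ⟨hV, fun S h₁ h₂ => ?_⟩⟩
    · obtain ⟨p, -, -, ⟨hp, v, hv, hl⟩, -⟩ := hS S h₁ h₂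
      exact ⟨p.2, hp, v, hv, h.adj_iff.2 ⟨_, hl⟩⟩
    · obtain ⟨⟨t, u⟩, ⟨t', u'⟩, hne, ⟨hp, v, hv, hl⟩, ⟨hp', v', hv', hl'⟩⟩ := hS S h₁ h₂
      by_contra hc
      push Not at hc
      have n₁ := hc _ hp v hv
      have n₂ := hc _ hp' v' hv'
      simp only [Adj, eraseFerm, not_or, not_and] at n₁ n₂
      cases t <;> cases t' <;> simp only [link] at hl hl' hp hp' n₁ n₂ <;> grind
    · obtain ⟨⟨t, u⟩, ⟨t', u'⟩, hne, ⟨hp, v, hv, hl⟩, ⟨hp', v', hv', hl'⟩⟩ := hS S h₁ h₂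
      by_contra hc
      push Not at hc
      have n₁ := hc _ hp v hv
      have n₂ := hc _ hp' v' hv'
      simp only [Adj, eraseScal, not_or, not_and, not_not] at n₁ n₂
      cases t <;> cases t' <;> simp only [link] at hl hl' hp hp' n₁ n₂ <;> grind

/-! ### Vertex counts and generators with given residue -/

theorem even_card_scal [Finite V] {Γ : Diagram V} (h : Γ.IsFeynman) :
    Even (Nat.card {e : V × V // Γ.scal e.1 e.2}) := by
  classical
  have := Fintype.ofFinite V
  rw [Nat.card_eq_fintype_card]
  let f : {e : V × V // Γ.scal e.1 e.2} → {e : V × V // Γ.scal e.1 e.2} :=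
    fun e => ⟨e.1.swap, h.scal_symm _ _ e.2⟩
  have hf : Function.Involutive f := fun e => rfl
  have h2 := Equiv.Perm.card_fixedPoints_modEq (f := f) (p := 2) (n := 1)
    (funext fun e => rfl)
  have : IsEmpty (Function.fixedPoints f) := ⟨fun ⟨e, he⟩ => by
    have : e.1.swap = e.1 := congrArg Subtype.val he
    have h1 : e.1.2 = e.1.1 := congrArg Prod.fst this
    exact h.scal_irrefl e.1.1 (by have := e.2; rwa [h1] at this)⟩
  rw [Fintype.card_eq_zero (α := Function.fixedPoints f)] at h2
  exact even_iff_two_dvd.2 (Nat.modEq_zero_iff_dvd.1 h2)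

end Diagram

/-- The number of vertices of a graph with residue `r` and `k` loops. -/
def Residue.size : Residue → ℕ → ℕ
  | .psipsi, k => 2 * k
  | .phiphi, k => 2 * k
  | .psipsiphi, k => 2 * k + 1

namespace Diagram

variable {V W : Type}

/-- The vertex count of a graph with residue `r`: twice the loop number, plus one for a vertex
graph. -/
theorem card_of_hasResidue [Finite V] {Γ : Diagram V} (h : Γ.IsFeynman) {r : Residue}
    (hr : Γ.HasResidue r) : Nat.card V = r.size Γ.loops := by
  have h₁ := card_ferm h
  have h₂ := card_scal h
  obtain ⟨m, h₃⟩ := even_card_scal h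
  unfold loops
  cases r <;> obtain ⟨a, b, c⟩ := hr <;> simp only [Residue.size] <;> omega

/-- `Γ` is a generator with residue `r`. -/
def IsGeneratorOf (r : Residue) (Γ : Diagram V) : Prop := Γ.IsGenerator ∧ Γ.HasResidue r

/-- The condition of at least one loop only excludes the single vertex. -/
theorem isGeneratorOf_iff [Finite V] {r : Residue} {Γ : Diagram V} :
    Γ.IsGeneratorOf r ↔ Γ.IsFeynman ∧ Γ.Solid ∧ Γ.HasResidue r ∧
      (r = .psipsiphi → Nat.card V ≠ 1) := by
  constructor
  · rintro ⟨⟨hF, h1, hl, -⟩, hr⟩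
    refine ⟨hF, hF.onePI_iff.1 h1, hr, ?_⟩
    have := card_of_hasResidue hF hr
    rintro rfl
    simp only [Residue.size] at this
    omega
  · rintro ⟨hF, h1, hr, hc⟩
    refine ⟨⟨hF, hF.onePI_iff.2 h1, ?_, r, hr⟩, hr⟩
    have h := card_of_hasResidue hF hr
    have : 0 < Nat.card V := by
      have := h1.1
      exact Nat.card_pos
    cases r <;> simp only [Residue.size] at h <;> simp at hc <;> omega

theorem IsGenerator.exists_isGeneratorOf {Γ : Diagram V} (h : Γ.IsGenerator) :
    ∃ r, Γ.IsGeneratorOf r := let ⟨r, hr⟩ := h.2.2.2; ⟨r, h, hr⟩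

theorem IsGeneratorOf.isFeynman {r : Residue} {Γ : Diagram V} (h : Γ.IsGeneratorOf r) :
    Γ.IsFeynman := h.1.1

theorem IsGeneratorOf.solid {r : Residue} {Γ : Diagram V} (h : Γ.IsGeneratorOf r) :
    Γ.Solid := h.1.1.onePI_iff.1 h.1.2.1

theorem IsGeneratorOf.nLeg {r : Residue} {Γ : Diagram V} (h : Γ.IsGeneratorOf r) (t : Leg) :
    Γ.nLeg t = r.legs t := hasResidue_iff.1 h.2 t

theorem exists_pending_of_nLeg_pos {Γ : Diagram V} {t : Leg} (h : 0 < Γ.nLeg t) :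
    ∃ u, Γ.Pending t u := by
  by_contra hc
  push Not at hc
  have : IsEmpty {u : V // Γ.Pending t u} := ⟨fun u => hc u.1 u.2⟩
  simp [Diagram.nLeg, Nat.card_of_isEmpty] at h

theorem nLeg_eq_one {Γ : Diagram V} {t : Leg} (h : Γ.nLeg t = 1) :
    ∃ x, ∀ u, Γ.Pending t u ↔ u = x := by
  obtain ⟨h₁, ⟨x⟩⟩ := Nat.card_eq_one_iff_unique.1 h
  exact ⟨x.1, fun u => ⟨fun hu => congrArg Subtype.val (h₁.elim ⟨u, hu⟩ x), fun hu => hu ▸ x.2⟩⟩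

theorem nLeg_eq_two {Γ : Diagram V} {t : Leg} (h : Γ.nLeg t = 2) :
    ∃ x y, x ≠ y ∧ ∀ u, Γ.Pending t u ↔ u = x ∨ u = y := by
  obtain ⟨x, y, hxy, h'⟩ := Nat.card_eq_two_iff.1 h
  refine ⟨x.1, y.1, fun he => hxy (Subtype.ext he), fun u => ⟨fun hu => ?_, ?_⟩⟩
  · have : (⟨u, hu⟩ : {u : V // Γ.Pending t u}) ∈ ({x, y} : Set _) := h' ▸ Set.mem_univ _
    rcases this with h | h
    · exact .inl (congrArg Subtype.val h)
    · exact .inr (congrArg Subtype.val h)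
  · rintro (rfl | rfl)
    · exact x.2
    · exact y.2

theorem nLeg_eq_zero [Finite V] {Γ : Diagram V} {t : Leg} (h : Γ.nLeg t = 0) (u : V) :
    ¬ Γ.Pending t u := fun hu => by
  have : Nonempty {u : V // Γ.Pending t u} := ⟨⟨u, hu⟩⟩
  exact absurd h Nat.card_pos.ne'

/-- A nonempty set of vertices of a generator has at least two legs, internal or external. -/
theorem IsGeneratorOf.two_legs {r : Residue} {Γ : Diagram V} (h : Γ.IsGeneratorOf r) {S : Set V}
    (hS : S.Nonempty) : ∃ p q : Leg × V, p ≠ q ∧ (p.2 ∈ S ∧ ∀ v ∈ S, ¬ Γ.link p.1 p.2 v) ∧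
      (q.2 ∈ S ∧ ∀ v ∈ S, ¬ Γ.link q.1 q.2 v) := by
  by_cases hu : S = Set.univ
  · subst hu
    suffices ∃ p q : Leg × V, p ≠ q ∧ Γ.Pending p.1 p.2 ∧ Γ.Pending q.1 q.2 by
      obtain ⟨p, q, hpq, hp, hq⟩ := this
      exact ⟨p, q, hpq, ⟨trivial, fun v _ hv => hp ⟨v, hv⟩⟩, trivial, fun v _ hv => hq ⟨v, hv⟩⟩
    have h₁ := h.nLeg
    have hfermi : Γ.nLeg .out = 1 → Γ.nLeg .inc = 1 →
        ∃ p q : Leg × V, p ≠ q ∧ Γ.Pending p.1 p.2 ∧ Γ.Pending q.1 q.2 := fun ho hi => by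
      obtain ⟨x, hx⟩ := nLeg_eq_one ho
      obtain ⟨y, hy⟩ := nLeg_eq_one hi
      exact ⟨(.out, x), (.inc, y), by simp, (hx x).2 rfl, (hy y).2 rfl⟩
    cases r
    · exact hfermi (h₁ .out) (h₁ .inc)
    · obtain ⟨x, y, hxy, h'⟩ := nLeg_eq_two (h₁ .sca)
      exact ⟨(.sca, x), (.sca, y), by simpa using hxy, (h' x).2 (.inl rfl), (h' y).2 (.inr rfl)⟩
    · exact hfermi (h₁ .out) (h₁ .inc)
  · obtain ⟨p, q, hpq, ⟨hp, v, hv, hv'⟩, ⟨hq, w, hw, hw'⟩⟩ := h.solid.2 S hS hu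
    exact ⟨p, q, hpq, ⟨hp, fun u hu hl => hv (h.isFeynman.link_unique hv' hl ▸ hu)⟩,
      ⟨hq, fun u hu hl => hw (h.isFeynman.link_unique hw' hl ▸ hu)⟩⟩

/-- A generator has no tadpoles. -/
theorem IsGeneratorOf.not_link_self {r : Residue} {Γ : Diagram V} (h : Γ.IsGeneratorOf r) (t : Leg)
    (u : V) : ¬ Γ.link t u u := by
  intro hl
  obtain ⟨⟨s, a⟩, ⟨s', b⟩, hpq, ⟨rfl, hp⟩, ⟨rfl, hq⟩⟩ := h.two_legs (Set.singleton_nonempty u)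
  have h₁ := hp _ rfl
  have h₂ := hq _ rfl
  have h₃ := h.isFeynman.scal_irrefl
  cases t <;> cases s <;> cases s' <;> simp_all [link]

/-! ### Isomorphisms -/

/-- Two diagrams are isomorphic. -/
def Isomorphic (Γ : Diagram V) (Γ' : Diagram W) : Prop := ∃ e, Γ.IsIso Γ' e

theorem isIso_iff {Γ : Diagram V} {Γ' : Diagram W} {e : V ≃ W} :
    Γ.IsIso Γ' e ↔ ∀ t u v, Γ.link t u v ↔ Γ'.link t (e u) (e v) := by
  constructor
  · rintro ⟨h₁, h₂⟩ (_ | _ | _) u v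
    · exact h₁ u v
    · exact h₁ v u
    · exact h₂ u v
  · exact fun h => ⟨h .out, h .sca⟩

theorem Isomorphic.symm {Γ : Diagram V} {Γ' : Diagram W} (h : Γ.Isomorphic Γ') :
    Γ'.Isomorphic Γ := by
  obtain ⟨e, h₁, h₂⟩ := h
  exact ⟨e.symm, fun u v => by simp [h₁], fun u v => by simp [h₂]⟩

theorem Isomorphic.trans {X : Type} {Γ : Diagram V} {Γ' : Diagram W} {Γ'' : Diagram X}
    (h : Γ.Isomorphic Γ') (h' : Γ'.Isomorphic Γ'') : Γ.Isomorphic Γ'' := by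
  obtain ⟨e, h₁, h₂⟩ := h
  obtain ⟨f, k₁, k₂⟩ := h'
  exact ⟨e.trans f, fun u v => by simp [h₁, k₁], fun u v => by simp [h₂, k₂]⟩

theorem IsIso.pending {Γ : Diagram V} {Γ' : Diagram W} {e : V ≃ W} (h : Γ.IsIso Γ' e) (t : Leg)
    (u : V) : Γ.Pending t u ↔ Γ'.Pending t (e u) := by
  refine not_congr ⟨fun ⟨v, hv⟩ => ⟨e v, (isIso_iff.1 h t u v).1 hv⟩, fun ⟨v, hv⟩ => ⟨e.symm v, ?_⟩⟩
  rw [isIso_iff.1 h]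
  simpa using hv

theorem Isomorphic.nLeg {Γ : Diagram V} {Γ' : Diagram W} (h : Γ.Isomorphic Γ') (t : Leg) :
    Γ.nLeg t = Γ'.nLeg t := by
  obtain ⟨e, h⟩ := h
  exact Nat.card_congr (e.subtypeEquiv fun u => h.pending t u)

theorem Isomorphic.hasResidue {Γ : Diagram V} {Γ' : Diagram W} (h : Γ.Isomorphic Γ')
    (r : Residue) : Γ.HasResidue r ↔ Γ'.HasResidue r := by
  simp only [hasResidue_iff, h.nLeg]

theorem Isomorphic.isFeynman {Γ : Diagram V} {Γ' : Diagram W} (h : Γ.Isomorphic Γ')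
    (hF : Γ.IsFeynman) : Γ'.IsFeynman := by
  obtain ⟨e, h⟩ := h.symm
  rw [isFeynman_iff] at hF ⊢
  simp only [isIso_iff.1 h]
  exact ⟨fun t u v w h₁ h₂ => e.injective (hF.1 t _ _ _ h₁ h₂), fun t u v => hF.2.1 t _ _,
    fun v => hF.2.2 _⟩

theorem Isomorphic.solid {Γ : Diagram V} {Γ' : Diagram W} (h : Γ.Isomorphic Γ')
    (hS : Γ.Solid) : Γ'.Solid := by
  obtain ⟨e, h⟩ := h
  obtain ⟨hV, hS⟩ := hS
  refine ⟨hV.map e, fun S h₁ h₂ => ?_⟩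
  obtain ⟨⟨t, u⟩, ⟨t', u'⟩, hne, ⟨hp, v, hv, hl⟩, ⟨hp', v', hv', hl'⟩⟩ := hS (e ⁻¹' S)
    (h₁.preimage e.surjective) (fun hu => h₂ (by
      rw [← Set.image_preimage_eq S e.surjective, hu, Set.image_univ, e.range_eq_univ]))
  refine ⟨(t, e u), (t', e u'), fun he => hne ?_, ⟨hp, e v, hv, (isIso_iff.1 h _ _ _).1 hl⟩,
    ⟨hp', e v', hv', (isIso_iff.1 h _ _ _).1 hl'⟩⟩
  simpa using he

theorem Isomorphic.isGeneratorOf [Finite V] {Γ : Diagram V} {Γ' : Diagram W}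
    (h : Γ.Isomorphic Γ') (r : Residue) : Γ.IsGeneratorOf r ↔ Γ'.IsGeneratorOf r := by
  obtain ⟨e, -⟩ := id h
  have := Finite.of_equiv V e
  rw [isGeneratorOf_iff, isGeneratorOf_iff, h.hasResidue, Nat.card_congr e]
  exact and_congr ⟨h.isFeynman, h.symm.isFeynman⟩
    (and_congr ⟨h.solid, h.symm.solid⟩ Iff.rfl)

theorem Isomorphic.isGenerator [Finite V] {Γ : Diagram V} {Γ' : Diagram W}
    (h : Γ.Isomorphic Γ') : Γ.IsGenerator ↔ Γ'.IsGenerator :=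
  ⟨fun hg => let ⟨r, hr⟩ := hg.exists_isGeneratorOf; ((h.isGeneratorOf r).1 hr).1,
    fun hg => let ⟨r, hr⟩ := hg.exists_isGeneratorOf; ((h.isGeneratorOf r).2 hr).1⟩

theorem isomorphic_toFin [Finite V] (Γ : Diagram V) : Γ.Isomorphic Γ.toFin :=
  ⟨Finite.equivFin V, fun u v => by simp [toFin], fun u v => by simp [toFin]⟩

/-- Transport of a diagram along a bijection of the vertex sets. -/
def relabel (e : V ≃ W) (Γ : Diagram V) : Diagram W where
  ferm u v := Γ.ferm (e.symm u) (e.symm v)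
  scal u v := Γ.scal (e.symm u) (e.symm v)

theorem isIso_relabel (e : V ≃ W) (Γ : Diagram V) : Γ.IsIso (Γ.relabel e) e :=
  ⟨fun u v => by simp [relabel], fun u v => by simp [relabel]⟩

theorem isomorphic_relabel (e : V ≃ W) (Γ : Diagram V) : Γ.Isomorphic (Γ.relabel e) :=
  ⟨e, isIso_relabel e Γ⟩

theorem isIso_iff_relabel {e : V ≃ W} {Γ : Diagram V} {Γ' : Diagram W} :
    Γ.IsIso Γ' e ↔ Γ.relabel e = Γ' := by
  constructor
  · intro h
    refine ext_link fun t u v => ?_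
    rw [← e.apply_symm_apply u, ← e.apply_symm_apply v, ← isIso_iff.1 (isIso_relabel e Γ),
      ← isIso_iff.1 h]
  · rintro rfl
    exact isIso_relabel e Γ

/-- Transport along a bijection, as an equivalence. -/
def relabelEquiv (e : V ≃ W) : Diagram V ≃ Diagram W where
  toFun := relabel e
  invFun := relabel e.symm
  left_inv Γ := by ext <;> simp [relabel]
  right_inv Γ := by ext <;> simp [relabel]

end Diagram

open Diagram

/-- The isomorphism class of a generator. -/
noncomputable def toGen {V : Type} [Finite V] (Γ : Diagram V) (h : Γ.IsGenerator) : Gen :=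
  ⟨Nat.card V, Quotient.mk (genSetoid _) ⟨Γ.toFin, Γ.isomorphic_toFin.isGenerator.1 h⟩⟩

theorem rep_toGen {V : Type} [Finite V] (Γ : Diagram V) (h : Γ.IsGenerator) :
    (toGen Γ h).rep.Isomorphic Γ := by
  have h₁ := Quotient.mk_out (s := genSetoid (Nat.card V))
    ⟨Γ.toFin, Γ.isomorphic_toFin.isGenerator.1 h⟩
  exact Isomorphic.trans h₁ Γ.isomorphic_toFin.symm

theorem gen_mk_eq {n m : ℕ} (hnm : n = m) (Δ : {Γ : Diagram (Fin n) // Γ.IsGenerator})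
    (Δ' : {Γ : Diagram (Fin m) // Γ.IsGenerator}) (hΔ : Δ.1.Isomorphic Δ'.1) :
    (⟨n, Quotient.mk (genSetoid _) Δ⟩ : Gen) = ⟨m, Quotient.mk (genSetoid _) Δ'⟩ := by
  subst hnm
  congr 1
  exact Quotient.sound hΔ

theorem toGen_eq {V W : Type} [Finite V] [Finite W] {Γ : Diagram V} {Γ' : Diagram W}
    (h : Γ.IsGenerator) (h' : Γ'.IsGenerator) (hi : Γ.Isomorphic Γ') : toGen Γ h = toGen Γ' h' := by
  have hc : Nat.card V = Nat.card W := let ⟨e, _⟩ := hi; Nat.card_congr e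
  exact gen_mk_eq hc _ _ ((Γ.isomorphic_toFin.symm.trans hi).trans Γ'.isomorphic_toFin)

theorem toGen_rep (Γ : Gen) : toGen Γ.rep Γ.rep_isGenerator = Γ := by
  obtain ⟨n, q⟩ := Γ
  refine (gen_mk_eq (by simp) _ (Quotient.out q) (Gen.rep ⟨n, q⟩).isomorphic_toFin.symm).trans ?_
  exact congrArg (Sigma.mk n) (Quotient.out_eq q)

section Graph

variable (K : Type*) [Field K]

theorem graph_of_isGenerator {V : Type} [Finite V] {Γ : Diagram V} (h : Γ.IsGenerator) :
    graph K Γ = MvPolynomial.X (toGen Γ h) := by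
  unfold graph
  rw [dif_pos (Γ.isomorphic_toFin.isGenerator.1 h)]
  rfl

theorem graph_of_not_isGenerator {V : Type} [Finite V] {Γ : Diagram V} (h : ¬ Γ.IsGenerator) :
    graph K Γ = 1 := by
  unfold graph
  rw [dif_neg (fun h' => h (Γ.isomorphic_toFin.isGenerator.2 h'))]

theorem Diagram.Isomorphic.graph_eq {V W : Type} [Finite V] [Finite W] {Γ : Diagram V}
    {Γ' : Diagram W} (h : Γ.Isomorphic Γ') : graph K Γ = graph K Γ' := by
  by_cases hg : Γ.IsGenerator
  · rw [graph_of_isGenerator K hg, graph_of_isGenerator K (h.isGenerator.1 hg), toGen_eq _ _ h]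
  · rw [graph_of_not_isGenerator K hg, graph_of_not_isGenerator K fun h' => hg (h.isGenerator.2 h')]

end Graph

/-! ### Sums over labelled graphs -/

instance {V : Type} [Finite V] : Finite (Diagram V) :=
  Finite.of_injective (fun Γ : Diagram V => (Γ.ferm, Γ.scal)) (by
    rintro ⟨a, b⟩ ⟨c, d⟩ h
    simpa using h)

noncomputable instance {V : Type} [Finite V] (p : Diagram V → Prop) :
    Fintype {Γ : Diagram V // p Γ} := Fintype.ofFinite _

/-- A bijection of vertex sets is determined by the labelled diagram it leads to, up to an
automorphism. -/
noncomputable def equivLabellings {V W : Type} (Γ₀ : Diagram V) :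
    (V ≃ W) ≃ {Γ : Diagram W // Γ₀.Isomorphic Γ} × {σ : Equiv.Perm V // Γ₀.IsIso Γ₀ σ} where
  toFun τ := ⟨⟨Γ₀.relabel τ, isomorphic_relabel τ Γ₀⟩,
    ⟨τ.trans (isomorphic_relabel τ Γ₀).choose.symm, by
      have h := isIso_iff.1 (isomorphic_relabel τ Γ₀).choose_spec
      refine isIso_iff.2 fun t u v => ?_
      rw [h t ((τ.trans _) u), isIso_iff.1 (isIso_relabel τ Γ₀) t u v]
      simp⟩⟩
  invFun x := x.2.1.trans x.1.2.choose
  left_inv τ := by ext; simp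
  right_inv := by
    rintro ⟨⟨Γ, hΓ⟩, σ, hσ⟩
    have h : Γ₀.relabel (σ.trans hΓ.choose) = Γ := by
      rw [← isIso_iff_relabel]
      refine isIso_iff.2 fun t u v => ?_
      rw [isIso_iff.1 hσ, isIso_iff.1 hΓ.choose_spec]
      rfl
    have key : ∀ (Γ' : Diagram W) (hΓ' : Γ₀.Isomorphic Γ'), Γ' = Γ → hΓ'.choose = hΓ.choose := by
      rintro _ _ rfl
      rfl
    refine Prod.ext (Subtype.ext h) (Subtype.ext ?_)
    dsimp only
    rw [key _ _ h]
    ext; simp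

theorem card_labellings_mul {V W : Type} [Finite V] (Γ₀ : Diagram V) (e : V ≃ W) :
    Nat.card {Γ : Diagram W // Γ₀.Isomorphic Γ} * Γ₀.autCard = (Nat.card V).factorial := by
  classical
  have := Fintype.ofFinite V
  have := Fintype.ofEquiv V e
  rw [Diagram.autCard, ← Nat.card_prod, ← Nat.card_congr (equivLabellings Γ₀),
    Nat.card_eq_fintype_card, Fintype.card_equiv e, Nat.card_eq_fintype_card]

theorem mem_gens {r : Residue} {k : ℕ} {Γ : Gen} :
    Γ ∈ gens r k ↔ Γ.rep.HasResidue r ∧ Γ.1 = r.size k := by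
  rw [gens, Set.Finite.mem_toFinset]
  refine and_congr_right fun h => ?_
  have h₁ := card_of_hasResidue Γ.rep_isGenerator.1 h
  have h₂ := Γ.rep_isGenerator.2.2.1
  have h₃ : Nat.card (Fin Γ.1) = Γ.1 := Nat.card_fin _
  cases r <;> simp only [Residue.size] at h₁ ⊢ <;> omega

section

variable (K : Type*) [Field K]

/-- Orbit counting: the sum over isomorphism classes weighted by symmetry factors is the normalized
sum over all labelled graphs. -/
theorem sum_symWeight [CharZero K] {M : Type*} [AddCommGroup M] [Module K M] (r : Residue) (k : ℕ)
    (g : Gen → M) :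
    ∑ Γ ∈ gens r k, symWeight K Γ • g Γ =
      (((r.legs .sca).factorial : K) / ((r.size k).factorial : K)) •
        ∑ Γ : {Γ : Diagram (Fin (r.size k)) // Γ.IsGeneratorOf r}, g (toGen Γ.1 Γ.2.1) := by
  classical
  have hmaps : ∀ Γ : {Γ : Diagram (Fin (r.size k)) // Γ.IsGeneratorOf r},
      toGen Γ.1 Γ.2.1 ∈ gens r k := fun Γ =>
    mem_gens.2 ⟨((rep_toGen Γ.1 Γ.2.1).hasResidue r).2 Γ.2.2, by simp [toGen]⟩
  rw [← Finset.sum_fiberwise_of_maps_to (t := gens r k) (g := fun Γ : {Γ : Diagram _ // _} =>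
    toGen Γ.1 Γ.2.1) (fun Γ _ => hmaps Γ), Finset.smul_sum]
  refine Finset.sum_congr rfl fun Γ hΓ => ?_
  obtain ⟨hr, hn⟩ := mem_gens.1 hΓ
  rw [Finset.sum_congr rfl fun Γ' hΓ' => by rw [(Finset.mem_filter.1 hΓ').2], Finset.sum_const,
    ← Nat.cast_smul_eq_nsmul K, smul_smul]
  congr 1
  have h₁ := card_labellings_mul Γ.rep (finCongr hn)
  have hn' : Nat.card (Fin Γ.1) = r.size k := (Nat.card_fin _).trans hn
  rw [hn'] at h₁
  have h₂ : (Finset.univ.filter fun Γ' : {Γ' : Diagram (Fin (r.size k)) // Γ'.IsGeneratorOf r} =>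
      toGen Γ'.1 Γ'.2.1 = Γ).card = Nat.card {Γ' : Diagram (Fin (r.size k)) //
        Γ.rep.Isomorphic Γ'} := by
    rw [← Fintype.card_subtype, ← Nat.card_eq_fintype_card]
    refine Nat.card_congr ⟨fun Γ' => ⟨Γ'.1.1, ?_⟩, fun Γ' => ⟨⟨Γ'.1, ?_⟩, ?_⟩, fun _ => rfl,
      fun _ => rfl⟩
    · have := rep_toGen Γ'.1.1 Γ'.1.2.1
      rwa [Γ'.2] at this
    · exact (Γ'.2.isGeneratorOf r).1 ⟨Γ.rep_isGenerator, hr⟩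
    · rw [← toGen_eq Γ.rep_isGenerator _ Γ'.2, toGen_rep]
  have h₃ : ((r.size k).factorial : K) ≠ 0 := Nat.cast_ne_zero.2 (Nat.factorial_ne_zero _)
  have h₄ : Γ.rep.nScal = r.legs .sca := hasResidue_iff.1 hr .sca
  rw [h₂, symWeight, h₄]
  have h₅ : (Γ.rep.autCard : K) ≠ 0 := by
    intro h
    rw [Nat.cast_eq_zero] at h
    rw [h, mul_zero] at h₁
    exact Nat.factorial_ne_zero _ h₁.symm
  rw [← h₁] at h₃ ⊢
  push_cast at h₃ ⊢
  have h₆ := left_ne_zero_of_mul h₃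
  field_simp

/-- The normalized sum of all graphs with residue `r` on `n` labelled vertices. -/
noncomputable def labelledSum (r : Residue) (n : ℕ) : H K :=
  (((r.legs .sca).factorial : K) / (n.factorial : K)) •
    ∑ Γ : {Γ : Diagram (Fin n) // Γ.IsGeneratorOf r}, graph K Γ.1

theorem c_eq_labelledSum [CharZero K] (r : Residue) (k : ℕ) : c K r k = labelledSum K r (r.size k) := by
  rw [c, sum_symWeight K r k, labelledSum]
  congr 1
  exact Finset.sum_congr rfl fun Γ _ => (graph_of_isGenerator K Γ.2.1).symm

theorem labelledSum_eq_zero {r : Residue} {n : ℕ} (h : ∀ k, n ≠ r.size k) :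
    labelledSum K r n = 0 := by
  have : IsEmpty {Γ : Diagram (Fin n) // Γ.IsGeneratorOf r} := ⟨fun Γ => h _ (by
    rw [← card_of_hasResidue Γ.2.isFeynman Γ.2.2, Nat.card_fin])⟩
  simp [labelledSum]

theorem sum_graph_congr {V W : Type} [Finite V] [Finite W] (e : V ≃ W) (r : Residue) :
    ∑ Γ : {Γ : Diagram V // Γ.IsGeneratorOf r}, graph K Γ.1 =
      ∑ Γ : {Γ : Diagram W // Γ.IsGeneratorOf r}, graph K Γ.1 :=
  Fintype.sum_equiv ((relabelEquiv e).subtypeEquiv fun Γ =>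
    (isomorphic_relabel e Γ).isGeneratorOf r) _ _ fun Γ => (isomorphic_relabel e Γ.1).graph_eq K

end

/-! ### Insertion on a propagator -/

namespace Diagram

variable {A B : Type}

/-- The diagram induced along a map of vertex sets. -/
def comap {V W : Type} (f : W → V) (Γ : Diagram V) : Diagram W where
  ferm u v := Γ.ferm (f u) (f v)
  scal u v := Γ.scal (f u) (f v)

theorem link_comap {V W : Type} {f : W → V} {Γ : Diagram V} {t : Leg} {u v : W} :
    (Γ.comap f).link t u v ↔ Γ.link t (f u) (f v) := by cases t <;> rfl

theorem IsFeynman.comap {V W : Type} {f : W → V} (hf : Function.Injective f) {Γ : Diagram V}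
    (h : Γ.IsFeynman) : (Γ.comap f).IsFeynman := by
  rw [isFeynman_iff] at h ⊢
  simp only [link_comap]
  exact ⟨fun t u v w h₁ h₂ => hf (h.1 t _ _ _ h₁ h₂), fun t u v => h.2.1 t _ _, fun v => h.2.2 _⟩

/-- The half-edges that are joined after `γ` has been inserted in the propagator of `Γ` that starts
at `a` with a half-edge of kind `t` and ends at `b`. -/
def insertTwoLink (Γ : Diagram A) (γ : Diagram B) (t : Leg) (a b : A) (x y : B) :
    Leg → A ⊕ B → A ⊕ B → Prop
  | s, .inl u, .inl v => Γ.link s u v ∧ ¬ (s = t ∧ u = a ∧ v = b) ∧ ¬ (s = t.bar ∧ u = b ∧ v = a)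
  | s, .inl u, .inr z => (s = t ∧ u = a ∧ z = x) ∨ (s = t.bar ∧ u = b ∧ z = y)
  | s, .inr z, .inl u => (s = t.bar ∧ u = a ∧ z = x) ∨ (s = t ∧ u = b ∧ z = y)
  | s, .inr z, .inr z' => γ.link s z z'

/-- Insertion of `γ` in the propagator of `Γ` that starts at `a` with a half-edge of kind `t` and ends
at `b`: this propagator is cut, its first half is joined to the leg of kind `t.bar` at the vertex `x`
of `γ`, and its second half to the leg of kind `t` at `y`. -/
def insertTwo (Γ : Diagram A) (γ : Diagram B) (t : Leg) (a b : A) (x y : B) : Diagram (A ⊕ B) :=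
  ofLink (insertTwoLink Γ γ t a b x y)

/-- The insertion described by `insertTwo` is meaningful. -/
structure Insertable (Γ : Diagram A) (γ : Diagram B) (t : Leg) (a b : A) (x y : B) : Prop where
  left : Γ.IsFeynman
  right : γ.IsFeynman
  link : Γ.link t a b
  first : γ.Pending t.bar x
  last : γ.Pending t y
  ne : (t.bar, x) ≠ (t, y)

variable {Γ : Diagram A} {γ : Diagram B} {t : Leg} {a b : A} {x y : B}

theorem insertTwoLink_symm (hΓ : Γ.IsFeynman) (hγ : γ.IsFeynman) {s : Leg} {u v : A ⊕ B}
    (h : insertTwoLink Γ γ t a b x y s u v) : insertTwoLink Γ γ t a b x y s.bar v u := by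
  rcases u with u | u <;> rcases v with v | v
  · refine ⟨hΓ.link_symm h.1, ?_, ?_⟩
    · rintro ⟨h₁, rfl, rfl⟩
      exact h.2.2 ⟨by rw [← h₁, Leg.bar_bar], rfl, rfl⟩
    · rintro ⟨h₁, rfl, rfl⟩
      exact h.2.1 ⟨by rw [← s.bar_bar, h₁, Leg.bar_bar], rfl, rfl⟩
  · rcases h with ⟨rfl, rfl, rfl⟩ | ⟨rfl, rfl, rfl⟩
    · exact .inl ⟨rfl, rfl, rfl⟩
    · exact .inr ⟨Leg.bar_bar _, rfl, rfl⟩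
  · rcases h with ⟨rfl, rfl, rfl⟩ | ⟨rfl, rfl, rfl⟩
    · exact .inl ⟨Leg.bar_bar _, rfl, rfl⟩
    · exact .inr ⟨rfl, rfl, rfl⟩
  · exact hγ.link_symm h

theorem link_insertTwo (hΓ : Γ.IsFeynman) (hγ : γ.IsFeynman) {s : Leg} {u v : A ⊕ B} :
    (insertTwo Γ γ t a b x y).link s u v ↔ insertTwoLink Γ γ t a b x y s u v := by
  refine link_ofLink (fun _ _ _ => insertTwoLink_symm hΓ hγ) s u v

theorem Insertable.ends_ne (h : Insertable Γ γ t a b x y) : (t, a) ≠ (t.bar, b) := by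
  intro he
  obtain ⟨h₁, rfl⟩ := Prod.mk.inj he
  have h₂ := h.link
  have h₃ := h.left.scal_irrefl a
  cases t <;> simp_all [Leg.bar, Diagram.link]

theorem Insertable.isFeynman (h : Insertable Γ γ t a b x y) :
    (insertTwo Γ γ t a b x y).IsFeynman := by
  have hne := h.ne
  have hae := h.ends_ne
  have hl := h.link
  have hl' := h.left.link_symm hl
  have hx := fun v hv => h.first ⟨v, hv⟩
  have hy := fun v hv => h.last ⟨v, hv⟩
  simp only [ne_eq, Prod.mk.injEq, not_and] at hne hae
  rw [isFeynman_iff]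
  have hlink := fun s u v => link_insertTwo (t := t) (a := a) (b := b) (x := x) (y := y) h.left
    h.right (s := s) (u := u) (v := v)
  refine ⟨?_, fun s u v hs => ?_, ?_⟩
  · have hu := fun s u v w => h.left.link_unique (t := s) (u := u) (v := v) (w := w)
    have hu' := fun s u v w => h.right.link_unique (t := s) (u := u) (v := v) (w := w)
    rintro s (u | u) (v | v) (w | w) h₁ h₂ <;> rw [hlink] at h₁ h₂ <;>
      simp only [insertTwoLink] at h₁ h₂ <;> grind
  · rw [hlink] at hs ⊢
    exact insertTwoLink_symm h.left h.right hs
  · rintro (u | u) h₁ <;> rw [hlink] at h₁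
    · exact h.left.scal_irrefl _ h₁.1
    · exact h.right.scal_irrefl _ h₁

theorem Insertable.pending_inl (h : Insertable Γ γ t a b x y) (s : Leg) (u : A) :
    (insertTwo Γ γ t a b x y).Pending s (.inl u) ↔ Γ.Pending s u := by
  refine not_congr ⟨?_, ?_⟩
  · rintro ⟨v | v, hv⟩ <;> rw [link_insertTwo h.left h.right] at hv
    · exact ⟨v, hv.1⟩
    · rcases hv with ⟨rfl, rfl, rfl⟩ | ⟨rfl, rfl, rfl⟩
      · exact ⟨b, h.link⟩
      · exact ⟨a, h.left.link_symm h.link⟩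
  · rintro ⟨v, hv⟩
    by_cases h₁ : s = t ∧ u = a ∧ v = b
    · exact ⟨.inr x, (link_insertTwo h.left h.right).2 (.inl ⟨h₁.1, h₁.2.1, rfl⟩)⟩
    by_cases h₂ : s = t.bar ∧ u = b ∧ v = a
    · exact ⟨.inr y, (link_insertTwo h.left h.right).2 (.inr ⟨h₂.1, h₂.2.1, rfl⟩)⟩
    exact ⟨.inl v, (link_insertTwo h.left h.right).2 ⟨hv, h₁, h₂⟩⟩

theorem Insertable.pending_inr (h : Insertable Γ γ t a b x y) (s : Leg) (z : B) :
    (insertTwo Γ γ t a b x y).Pending s (.inr z) ↔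
      γ.Pending s z ∧ (s, z) ≠ (t.bar, x) ∧ (s, z) ≠ (t, y) := by
  constructor
  · intro hp
    refine ⟨fun ⟨v, hv⟩ => hp ⟨.inr v, (link_insertTwo h.left h.right).2 hv⟩, ?_, ?_⟩
    · rintro ⟨⟩
      exact hp ⟨.inl a, (link_insertTwo h.left h.right).2 (.inl ⟨rfl, rfl, rfl⟩)⟩
    · rintro ⟨⟩
      exact hp ⟨.inl b, (link_insertTwo h.left h.right).2 (.inr ⟨rfl, rfl, rfl⟩)⟩
  · rintro ⟨h₁, h₂, h₃⟩ ⟨v | v, hv⟩ <;> rw [link_insertTwo h.left h.right] at hv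
    · rcases hv with ⟨rfl, rfl, rfl⟩ | ⟨rfl, rfl, rfl⟩
      · exact h₂ rfl
      · exact h₃ rfl
    · exact h₁ ⟨v, hv⟩

/-- A one-particle irreducible graph stays so when a one-particle irreducible graph is inserted on a
propagator. -/
theorem Insertable.solid (h : Insertable Γ γ t a b x y) (hγ : γ.Solid) (hs : Γ.Solid) :
    (insertTwo Γ γ t a b x y).Solid := by
  have hlink := fun s u v => link_insertTwo (t := t) (a := a) (b := b) (x := x) (y := y) h.left
    h.right (s := s) (u := u) (v := v)
  refine ⟨⟨.inl a⟩, fun S hS hS' => ?_⟩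
  by_cases hB : (Sum.inr ⁻¹' S).Nonempty ∧ Sum.inr ⁻¹' S ≠ (Set.univ : Set B)
  · obtain ⟨⟨s, u⟩, ⟨s', u'⟩, hne, ⟨hp, v, hv, hl⟩, ⟨hp', v', hv', hl'⟩⟩ := hγ.2 _ hB.1 hB.2
    exact ⟨(s, .inr u), (s', .inr u'), by simpa using hne, ⟨hp, .inr v, hv, (hlink _ _ _).2 hl⟩,
      ⟨hp', .inr v', hv', (hlink _ _ _).2 hl'⟩⟩
  have hax : (insertTwo Γ γ t a b x y).link t (.inl a) (.inr x) :=
    (hlink _ _ _).2 (.inl ⟨rfl, rfl, rfl⟩)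
  have hby : (insertTwo Γ γ t a b x y).link t.bar (.inl b) (.inr y) :=
    (hlink _ _ _).2 (.inr ⟨rfl, rfl, rfl⟩)
  have hxa : (insertTwo Γ γ t a b x y).link t.bar (.inr x) (.inl a) :=
    (hlink _ _ _).2 (.inl ⟨rfl, rfl, rfl⟩)
  have hyb : (insertTwo Γ γ t a b x y).link t (.inr y) (.inl b) :=
    (hlink _ _ _).2 (.inr ⟨rfl, rfl, rfl⟩)
  have hae := h.ends_ne
  have hxy := h.ne
  rw [not_and_or, Set.not_nonempty_iff_eq_empty, not_not] at hB
  rcases hB with hB | hB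
  · have hn : ∀ z, Sum.inr z ∉ S := fun z hz => Set.notMem_empty z (hB ▸ hz)
    by_cases hA : Sum.inl ⁻¹' S = (Set.univ : Set A)
    · have hA' : ∀ u, Sum.inl u ∈ S := fun u => (hA ▸ Set.mem_univ u : u ∈ Sum.inl ⁻¹' S)
      exact ⟨(t, .inl a), (t.bar, .inl b), by simpa using hae, ⟨hA' a, _, hn x, hax⟩,
        ⟨hA' b, _, hn y, hby⟩⟩
    · have hne : (Sum.inl ⁻¹' S).Nonempty := by
        obtain ⟨u | u, hu⟩ := hS
        · exact ⟨u, hu⟩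
        · exact absurd hu (hn u)
      have key : ∀ p, Γ.Cross (Sum.inl ⁻¹' S) p →
          (insertTwo Γ γ t a b x y).Cross S (p.1, .inl p.2) := by
        rintro ⟨s, u⟩ ⟨hu, v, hv, hl⟩
        by_cases h₁ : s = t ∧ u = a ∧ v = b
        · obtain ⟨rfl, rfl, rfl⟩ := h₁
          exact ⟨hu, _, hn x, hax⟩
        by_cases h₂ : s = t.bar ∧ u = b ∧ v = a
        · obtain ⟨rfl, rfl, rfl⟩ := h₂
          exact ⟨hu, _, hn y, hby⟩
        exact ⟨hu, .inl v, hv, (hlink _ _ _).2 ⟨hl, h₁, h₂⟩⟩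
      obtain ⟨p, q, hpq, hp, hq⟩ := hs.2 _ hne hA
      exact ⟨_, _, fun he => hpq (by simpa [Prod.ext_iff] using he), key p hp, key q hq⟩
  · have hn : ∀ z, Sum.inr z ∈ S := fun z => (hB ▸ Set.mem_univ z : z ∈ Sum.inr ⁻¹' S)
    by_cases hA : (Sum.inl ⁻¹' S).Nonempty
    · have hne : Sum.inl ⁻¹' S ≠ (Set.univ : Set A) := fun hu => hS' (by
        ext (u | u)
        · exact ⟨fun _ => trivial, fun _ => (hu ▸ Set.mem_univ u : u ∈ Sum.inl ⁻¹' S)⟩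
        · exact ⟨fun _ => trivial, fun _ => hn u⟩)
      -- the half-edge that plays the role of `p` after the insertion
      let f : Leg × A → Leg × (A ⊕ B) := fun p => open Classical in
        if p = (t, a) ∧ b ∉ Sum.inl ⁻¹' S then (t, .inr y)
        else if p = (t.bar, b) ∧ a ∉ Sum.inl ⁻¹' S then (t.bar, .inr x) else (p.1, .inl p.2)
      have key : ∀ p, Γ.Cross (Sum.inl ⁻¹' S) p → (insertTwo Γ γ t a b x y).Cross S (f p) := by
        rintro ⟨s, u⟩ ⟨hu, v, hv, hl⟩
        simp only [f]
        split_ifs with h₁ h₂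
        · exact ⟨hn y, _, h₁.2, hyb⟩
        · exact ⟨hn x, _, h₂.2, hxa⟩
        · refine ⟨hu, .inl v, hv, (hlink _ _ _).2 ⟨hl, ?_, ?_⟩⟩
          · rintro ⟨rfl, rfl, rfl⟩
            exact h₁ ⟨rfl, hv⟩
          · rintro ⟨rfl, rfl, rfl⟩
            exact h₂ ⟨rfl, hv⟩
      obtain ⟨p, q, hpq, hp, hq⟩ := hs.2 _ hA hne
      refine ⟨f p, f q, fun he => ?_, key p hp, key q hq⟩
      simp only [f] at he
      split_ifs at he <;> grind
    · have hA' : ∀ u, Sum.inl u ∉ S := fun u hu => hA ⟨u, hu⟩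
      exact ⟨(t.bar, .inr x), (t, .inr y), by simpa using hxy, ⟨hn x, _, hA' a, hxa⟩,
        ⟨hn y, _, hA' b, hyb⟩⟩

/-- The removal of a component with two legs preserves one-particle irreducibility. -/
theorem Insertable.solid_left (h : Insertable Γ γ t a b x y)
    (hs : (insertTwo Γ γ t a b x y).Solid) : Γ.Solid := by
  have hlink := fun s u v => link_insertTwo (t := t) (a := a) (b := b) (x := x) (y := y) h.left
    h.right (s := s) (u := u) (v := v)
  refine ⟨⟨a⟩, fun S hS hS' => ?_⟩
  -- a cut of `Γ` is a cut of the insertion, with all of `γ` on the side of `a`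
  let f : A ⊕ B → A := Sum.elim id fun _ => a
  have hf : Function.Surjective f := fun u => ⟨.inl u, rfl⟩
  obtain ⟨p, q, hpq, hp, hq⟩ := hs.2 (f ⁻¹' S) (hS.preimage hf) (fun hu => hS' (by
    rw [← Set.image_preimage_eq S hf, hu, Set.image_univ, hf.range_eq]))
  have hfey := h.isFeynman
  have key : ∀ p, (insertTwo Γ γ t a b x y).Cross (f ⁻¹' S) p →
      Γ.Cross S (p.1, f p.2) ∧ p ≠ (t, .inl a) ∧ ∀ z, p.2 = .inr z → p = (t, .inr y) := by
    rintro ⟨s, u⟩ ⟨hu, v, hv, hl⟩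
    refine ⟨?_, ?_, ?_⟩
    · rw [hlink] at hl
      rcases u with u | u <;> rcases v with v | v
      · exact ⟨hu, v, hv, hl.1⟩
      · rcases hl with ⟨rfl, rfl, rfl⟩ | ⟨rfl, rfl, rfl⟩
        · exact absurd hu hv
        · exact ⟨hu, a, hv, h.left.link_symm h.link⟩
      · rcases hl with ⟨rfl, rfl, rfl⟩ | ⟨rfl, rfl, rfl⟩
        · exact absurd hu hv
        · exact ⟨hu, _, hv, h.link⟩
      · exact absurd hu hv
    · rintro ⟨⟩
      have hl' := (hlink t (.inl a) (.inr x)).2 (.inl ⟨rfl, rfl, rfl⟩)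
      have := hfey.link_unique hl hl'
      subst this
      exact hv hu
    · rintro z ⟨⟩
      rw [hlink] at hl
      rcases v with v | v
      · rcases hl with ⟨rfl, rfl, rfl⟩ | ⟨rfl, rfl, rfl⟩
        · exact absurd hu hv
        · rfl
      · exact absurd hu hv
  obtain ⟨hp₁, hp₂, hp₃⟩ := key p hp
  obtain ⟨hq₁, hq₂, hq₃⟩ := key q hq
  refine ⟨_, _, fun he => hpq ?_, hp₁, hq₁⟩
  obtain ⟨s, u | u⟩ := p <;> obtain ⟨s', u' | u'⟩ := q <;>
    simp only [f, Sum.elim_inl, Sum.elim_inr, Prod.mk.injEq, id] at * <;> grind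

theorem Insertable.nLeg_add [Finite A] [Finite B] (h : Insertable Γ γ t a b x y) (s : Leg) :
    (insertTwo Γ γ t a b x y).nLeg s = Γ.nLeg s +
      Nat.card {z : B // γ.Pending s z ∧ (s, z) ≠ (t.bar, x) ∧ (s, z) ≠ (t, y)} := by
  rw [nLeg, nLeg, ← Nat.card_sum]
  exact Nat.card_congr (Equiv.subtypeSum.trans (Equiv.sumCongr
    (Equiv.subtypeEquivRight fun u => h.pending_inl s u)
    (Equiv.subtypeEquivRight fun z => h.pending_inr s z)))

theorem Insertable.nLeg_eq [Finite A] [Finite B] (h : Insertable Γ γ t a b x y) (s : Leg)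
    (hγ : ∀ z, γ.Pending s z → (s, z) = (t.bar, x) ∨ (s, z) = (t, y)) :
    (insertTwo Γ γ t a b x y).nLeg s = Γ.nLeg s := by
  have : IsEmpty {z : B // γ.Pending s z ∧ (s, z) ≠ (t.bar, x) ∧ (s, z) ≠ (t, y)} :=
    ⟨fun z => by have := hγ z.1 z.2.1; have := z.2.2; tauto⟩
  rw [h.nLeg_add, Nat.card_of_isEmpty, add_zero]

theorem Insertable.comap_inr (h : Insertable Γ γ t a b x y) :
    (insertTwo Γ γ t a b x y).comap .inr = γ :=
  ext_link fun s u v => by rw [link_comap, link_insertTwo h.left h.right]; rfl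

/-- A diagram on `A ⊕ B` in which exactly two half-edges of `B` are joined to `A` is an insertion. -/
theorem exists_insertTwo {Δ : Diagram (A ⊕ B)} (hΔ : Δ.IsFeynman)
    (hx : Δ.link t.bar (.inr x) (.inl a)) (hy : Δ.link t (.inr y) (.inl b))
    (hne : (t.bar, x) ≠ (t, y)) (hab : (t, a) ≠ (t.bar, b))
    (hcross : ∀ s z u, Δ.link s (.inr z) (.inl u) → (s, z) = (t.bar, x) ∨ (s, z) = (t, y)) :
    ∃ Γ : Diagram A, Insertable Γ (Δ.comap .inr) t a b x y ∧
      insertTwo Γ (Δ.comap .inr) t a b x y = Δ := by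
  let R : Leg → A → A → Prop := fun s u v => Δ.link s (.inl u) (.inl v) ∨
    (s = t ∧ u = a ∧ v = b) ∨ (s = t.bar ∧ u = b ∧ v = a)
  have hx' : Δ.link t (.inl a) (.inr x) := by simpa using hΔ.link_symm hx
  have hy' := hΔ.link_symm hy
  have hR : ∀ s u v, R s u v → R s.bar v u := by
    rintro s u v (h | ⟨rfl, rfl, rfl⟩ | ⟨rfl, rfl, rfl⟩)
    · exact .inl (hΔ.link_symm h)
    · exact .inr (.inr ⟨rfl, rfl, rfl⟩)
    · exact .inr (.inl ⟨Leg.bar_bar _, rfl, rfl⟩)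
  have hl : ∀ s u v, (ofLink R).link s u v ↔ R s u v := link_ofLink hR
  have hu := fun s u v w => hΔ.link_unique (t := s) (u := u) (v := v) (w := w)
  have hF : (ofLink R).IsFeynman := by
    refine isFeynman_iff.2 ⟨fun s u v w h₁ h₂ => ?_, fun s u v h => ?_, fun v h => ?_⟩
    · rw [hl] at h₁ h₂
      simp only [ne_eq, Prod.mk.injEq] at hab
      rcases h₁ with h₁ | ⟨rfl, rfl, rfl⟩ | ⟨rfl, rfl, rfl⟩ <;>
        rcases h₂ with h₂ | ⟨h₂, h₃, h₄⟩ | ⟨h₂, h₃, h₄⟩ <;> grind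
    · rw [hl] at h ⊢
      exact hR _ _ _ h
    · rw [hl] at h
      simp only [ne_eq, Prod.mk.injEq] at hab
      rcases h with h | ⟨rfl, rfl, h⟩ | ⟨h, rfl, h'⟩
      · exact hΔ.scal_irrefl _ h
      · exact hab ⟨rfl, h⟩
      · exact hab ⟨by rw [← t.bar_bar, ← h]; rfl, h'.symm⟩
  have hI : Insertable (ofLink R) (Δ.comap .inr) t a b x y := by
    refine ⟨hF, hΔ.comap Sum.inr_injective, (hl _ _ _).2 (.inr (.inl ⟨rfl, rfl, rfl⟩)), ?_, ?_, hne⟩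
    · rintro ⟨v, hv⟩
      exact Sum.inl_ne_inr (hΔ.link_unique hx (link_comap.1 hv))
    · rintro ⟨v, hv⟩
      exact Sum.inl_ne_inr (hΔ.link_unique hy (link_comap.1 hv))
  refine ⟨_, hI, ext_link fun s u v => ?_⟩
  rw [link_insertTwo hI.left hI.right]
  have hc : ∀ s z u, Δ.link s (.inr z) (.inl u) ↔
      (s = t.bar ∧ u = a ∧ z = x) ∨ (s = t ∧ u = b ∧ z = y) := by
    refine fun s z u => ⟨fun h => ?_, ?_⟩
    · rcases hcross s z u h with h' | h' <;> obtain ⟨rfl, rfl⟩ := Prod.mk.inj h'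
      · exact .inl ⟨rfl, Sum.inl_injective (hu _ _ _ _ h hx), rfl⟩
      · exact .inr ⟨rfl, Sum.inl_injective (hu _ _ _ _ h hy), rfl⟩
    · rintro (⟨rfl, rfl, rfl⟩ | ⟨rfl, rfl, rfl⟩)
      · exact hx
      · exact hy
  rcases u with u | u <;> rcases v with v | v <;> simp only [insertTwoLink]
  · rw [hl]
    simp only [R]
    refine ⟨fun h => by tauto, fun h => ⟨.inl h, ?_, ?_⟩⟩
    · rintro ⟨rfl, rfl, rfl⟩
      exact Sum.inl_ne_inr (hu _ _ _ _ h hx')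
    · rintro ⟨rfl, rfl, rfl⟩
      exact Sum.inl_ne_inr (hu _ _ _ _ h hy')
  · rw [hΔ.link_comm, hc]
    constructor
    · rintro (⟨rfl, h⟩ | ⟨rfl, h⟩)
      · exact .inl ⟨rfl, h⟩
      · exact .inr ⟨Leg.bar_bar _, h⟩
    · rintro (⟨h, h'⟩ | ⟨h, h'⟩)
      · exact .inl ⟨by rw [← s.bar_bar, h, Leg.bar_bar], h'⟩
      · exact .inr ⟨by rw [← h, Leg.bar_bar], h'⟩
  · rw [hc]
  · rw [link_comap]

/-- The diagram and the place of the insertion can be recovered from the result. -/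
theorem Insertable.inj {Γ' : Diagram A} {a' b' : A} (h : Insertable Γ γ t a b x y)
    (h' : Insertable Γ' γ t a' b' x y)
    (he : insertTwo Γ γ t a b x y = insertTwo Γ' γ t a' b' x y) : Γ = Γ' ∧ a = a' ∧ b = b' := by
  have hl : ∀ s u v, insertTwoLink Γ γ t a b x y s u v ↔ insertTwoLink Γ' γ t a' b' x y s u v :=
    fun s u v => by rw [← link_insertTwo h.left h.right, ← link_insertTwo h'.left h'.right, he]
  have hF := h'.isFeynman
  have ha : a = a' := Sum.inl_injective (hF.link_unique
    ((link_insertTwo h'.left h'.right).2 ((hl t.bar (.inr x) (.inl a)).1 (.inl ⟨rfl, rfl, rfl⟩)))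
    ((link_insertTwo h'.left h'.right).2 (.inl ⟨rfl, rfl, rfl⟩)))
  have hb : b = b' := Sum.inl_injective (hF.link_unique
    ((link_insertTwo h'.left h'.right).2 ((hl t (.inr y) (.inl b)).1 (.inr ⟨rfl, rfl, rfl⟩)))
    ((link_insertTwo h'.left h'.right).2 (.inr ⟨rfl, rfl, rfl⟩)))
  subst ha hb
  refine ⟨ext_link fun s u v => ?_, rfl, rfl⟩
  by_cases h₁ : s = t ∧ u = a ∧ v = b
  · obtain ⟨rfl, rfl, rfl⟩ := h₁
    exact iff_of_true h.link h'.link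
  by_cases h₂ : s = t.bar ∧ u = b ∧ v = a
  · obtain ⟨rfl, rfl, rfl⟩ := h₂
    exact iff_of_true (h.left.link_symm h.link) (h'.left.link_symm h'.link)
  simpa [insertTwoLink, h₁, h₂] using hl s (.inl u) (.inl v)

end Diagram

/-! ### Vertex graphs by insertion of a scalar leg -/

namespace Diagram

/-- A single interaction vertex. -/
def point : Diagram Unit := ⟨fun _ _ => False, fun _ _ => False⟩

theorem pending_point (t : Leg) (u : Unit) : point.Pending t u := by
  rintro ⟨v, hv⟩
  cases t <;> exact hv

theorem isFeynman_point : point.IsFeynman :=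
  ⟨fun _ _ _ h => h.elim, fun _ _ _ h => h.elim, fun _ _ h => h.elim, fun _ h => h.elim,
    fun _ _ _ h => h.elim⟩

theorem solid_point : point.Solid := by
  refine ⟨⟨()⟩, fun S ⟨x, hx⟩ hS => absurd ?_ hS⟩
  ext y
  exact ⟨fun _ => trivial, fun _ => hx⟩

theorem isomorphic_insertScalar {A : Type} (Γ : Diagram A) (a b : A) :
    (Γ.insertScalar a b).Isomorphic (insertTwo Γ point .out a b () ()) := by
  refine ⟨Equiv.optionEquivSumPUnit A, ?_, ?_⟩
  · rintro (_ | u) (_ | v) <;>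
      simp [insertScalar, insertTwo, ofLink, insertTwoLink, Leg.bar, Diagram.link, point]
  · rintro (_ | u) (_ | v) <;>
      simp [insertScalar, insertTwo, ofLink, insertTwoLink, Leg.bar, Diagram.link, point]

theorem insertable_point {A : Type} {Γ : Diagram A} (h : Γ.IsFeynman) {a b : A}
    (hab : Γ.ferm a b) : Insertable Γ point .out a b () () :=
  ⟨h, isFeynman_point, hab, pending_point _ _, pending_point _ _, by simp [Leg.bar]⟩

theorem nLeg_insertTwo_point {A : Type} [Finite A] {Γ : Diagram A} (h : Γ.IsFeynman) {a b : A}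
    (hab : Γ.ferm a b) (s : Leg) : (insertTwo Γ point .out a b () ()).nLeg s =
      Γ.nLeg s + Residue.legs .psipsiphi s - Residue.legs .psipsi s := by
  have hI := insertable_point h hab
  rcases s with _ | _ | _
  · rw [hI.nLeg_eq .out (fun _ _ => .inr rfl)]
    simp [Residue.legs]
  · rw [hI.nLeg_eq .inc (fun _ _ => .inl rfl)]
    simp [Residue.legs]
  · rw [hI.nLeg_add]
    simp [Residue.legs, Leg.bar, pending_point]

theorem isGeneratorOf_insertTwo_point {A : Type} [Finite A] {Γ : Diagram A}
    (h : Γ.IsGeneratorOf .psipsi) {a b : A} (hab : Γ.ferm a b) :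
    (insertTwo Γ point .out a b () ()).IsGeneratorOf .psipsiphi := by
  have hI := insertable_point h.isFeynman hab
  refine isGeneratorOf_iff.2 ⟨hI.isFeynman, hI.solid solid_point h.solid, ?_, fun _ hc => ?_⟩
  · rw [hasResidue_iff]
    intro s
    rw [nLeg_insertTwo_point h.isFeynman hab, h.nLeg, Nat.add_sub_cancel_left]
  · have : Nonempty A := ⟨a⟩
    have := Nat.card_pos (α := A)
    rw [Nat.card_sum] at hc
    simp at hc
    omega

/-- Every vertex graph, of which the vertex with the external scalar leg is singled out, is
obtained by inserting this vertex on a fermion propagator. -/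
theorem exists_insertTwo_point {A : Type} [Finite A] {Δ : Diagram (A ⊕ Unit)}
    (h : Δ.IsGeneratorOf .psipsiphi) (hp : Δ.Pending .sca (.inr ())) :
    ∃ (Γ : Diagram A) (a b : A), Γ.IsGeneratorOf .psipsi ∧ Γ.ferm a b ∧
      insertTwo Γ point .out a b () () = Δ := by
  have hF := h.isFeynman
  have hS : ({.inr ()} : Set (A ⊕ Unit)) ≠ Set.univ := by
    intro hu
    refine (isGeneratorOf_iff.1 h).2.2.2 rfl ?_
    rw [← Nat.card_univ, ← hu]
    simp
  obtain ⟨p, q, hpq, hcp, hcq⟩ := h.solid.2 _ (Set.singleton_nonempty _) hS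
  have key : ∀ p, Δ.Cross {.inr ()} p → p.1 ≠ .sca ∧ p.2 = .inr () ∧
      ∃ u, Δ.link p.1 (.inr ()) (.inl u) := by
    rintro ⟨s, u⟩ ⟨hu, v | v, hv, hl⟩
    · obtain rfl : u = .inr () := hu
      refine ⟨?_, rfl, v, hl⟩
      rintro rfl
      exact hp ⟨_, hl⟩
    · exact absurd rfl hv
  have hio : ∃ a b, Δ.link .inc (.inr ()) (.inl a) ∧ Δ.link .out (.inr ()) (.inl b) := by
    obtain ⟨s, u⟩ := p
    obtain ⟨s', u'⟩ := q
    obtain ⟨h₁, rfl, v, hv⟩ := key _ hcp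
    obtain ⟨h₂, rfl, v', hv'⟩ := key _ hcq
    cases s <;> cases s' <;>
      first
      | exact absurd rfl hpq
      | exact absurd rfl h₁
      | exact absurd rfl h₂
      | exact ⟨_, _, hv, hv'⟩
      | exact ⟨_, _, hv', hv⟩
  obtain ⟨a, b, ha, hb⟩ := hio
  obtain ⟨Γ, hI, hΔ⟩ := exists_insertTwo (t := .out) hF ha hb (by simp [Leg.bar])
    (by simp [Leg.bar]) (fun s z u hl => by
      cases s
      · exact .inr rfl
      · exact .inl rfl
      · exact absurd ⟨_, hl⟩ hp)
  have hpt : Δ.comap .inr = point := ext_link fun s u v => by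
    rw [link_comap]
    refine iff_of_false (fun hl => ?_) (fun hl => pending_point s u ⟨v, hl⟩)
    cases s
    · exact Sum.inl_ne_inr (hF.link_unique hb hl)
    · exact Sum.inl_ne_inr (hF.link_unique ha hl)
    · exact hp ⟨_, hl⟩
  rw [hpt] at hI hΔ
  subst hΔ
  refine ⟨Γ, a, b, isGeneratorOf_iff.2 ⟨hI.left, hI.solid_left h.solid, ?_, by simp⟩, hI.link, rfl⟩
  rw [hasResidue_iff]
  intro s
  have h₁ := nLeg_insertTwo_point hI.left hI.link s
  rw [h.nLeg] at h₁
  cases s <;> simp only [Residue.legs] at h₁ ⊢ <;> omega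

end Diagram

section

variable (K : Type*) [Field K]

theorem sum_insertScalar_congr {V W : Type} [Fintype V] [Fintype W] {Γ : Diagram V}
    {Γ' : Diagram W} (h : Γ.Isomorphic Γ') [DecidablePred fun e : V × V => Γ.ferm e.1 e.2]
    [DecidablePred fun e : W × W => Γ'.ferm e.1 e.2] :
    ∑ e : V × V with Γ.ferm e.1 e.2, graph K (Γ.insertScalar e.1 e.2) =
      ∑ e : W × W with Γ'.ferm e.1 e.2, graph K (Γ'.insertScalar e.1 e.2) := by
  obtain ⟨e, h₁, h₂⟩ := h
  refine Finset.sum_equiv (e.prodCongr e) (fun x => by simp [h₁]) fun x _ => ?_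
  refine Isomorphic.graph_eq K ⟨e.optionCongr, ?_, ?_⟩
  · rintro (_ | u) (_ | v) <;> simp [insertScalar, h₁]
  · rintro (_ | u) (_ | v) <;> simp [insertScalar, h₂]

open Classical in
/-- A vertex graph is determined by its self-energy graph, obtained by removal of the vertex of the
scalar leg, and the propagator on which that vertex was inserted. -/
theorem sum_graph_pending_sca (n : ℕ) :
    ∑ Γ : {Γ : Diagram (Fin n ⊕ Unit) // Γ.IsGeneratorOf .psipsiphi ∧ Γ.Pending .sca (.inr ())},
        graph K Γ.1 =
      ∑ Γ : {Γ : Diagram (Fin n) // Γ.IsGeneratorOf .psipsi},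
        ∑ e : Fin n × Fin n with Γ.1.ferm e.1 e.2, graph K (Γ.1.insertScalar e.1 e.2) := by
  rw [Finset.sum_sigma']
  symm
  refine Finset.sum_bij (fun x hx => ⟨insertTwo x.1.1 point .out x.2.1 x.2.2 () (),
    isGeneratorOf_insertTwo_point x.1.2 (by simpa using hx), ?_⟩) (fun _ _ => Finset.mem_univ _)
    ?_ ?_ ?_
  · have hI := insertable_point x.1.2.isFeynman (a := x.2.1) (b := x.2.2) (by simpa using hx)
    exact (hI.pending_inr _ _).2 ⟨pending_point _ _, by simp [Leg.bar], by simp⟩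
  · rintro ⟨Γ, a, b⟩ hx ⟨Γ', a', b'⟩ hx' he
    have hI := insertable_point Γ.2.isFeynman (a := a) (b := b) (by simpa using hx)
    have hI' := insertable_point Γ'.2.isFeynman (a := a') (b := b') (by simpa using hx')
    obtain ⟨h₁, rfl, rfl⟩ := hI.inj hI' (congrArg Subtype.val he)
    obtain rfl := Subtype.ext h₁
    rfl
  · rintro ⟨Δ, h, hp⟩ -
    obtain ⟨Γ, a, b, hg, hab, rfl⟩ := exists_insertTwo_point h hp
    exact ⟨⟨⟨Γ, hg⟩, a, b⟩, by simpa using hab, rfl⟩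
  · rintro ⟨Γ, a, b⟩ hx
    exact (isomorphic_insertScalar Γ.1 a b).graph_eq K

open Classical in
/-- The vertex of the scalar leg may be any of the `n + 1` labelled vertices. -/
theorem sum_graph_psipsiphi (n : ℕ) :
    ∑ Γ : {Γ : Diagram (Fin (n + 1)) // Γ.IsGeneratorOf .psipsiphi}, graph K Γ.1 =
      ((n + 1 : ℕ) : K) • ∑ Γ : {Γ : Diagram (Fin n) // Γ.IsGeneratorOf .psipsi},
        ∑ e : Fin n × Fin n with Γ.1.ferm e.1 e.2, graph K (Γ.1.insertScalar e.1 e.2) := by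
  have h₁ : ∀ Γ : {Γ : Diagram (Fin (n + 1)) // Γ.IsGeneratorOf .psipsiphi},
      graph K Γ.1 = ∑ w, if Γ.1.Pending .sca w then graph K Γ.1 else 0 := by
    intro Γ
    obtain ⟨x, hx⟩ := nLeg_eq_one (Γ.2.nLeg .sca)
    simp [hx]
  rw [Finset.sum_congr rfl fun Γ _ => h₁ Γ, Finset.sum_comm]
  have h₂ : ∀ w : Fin (n + 1), ∑ Γ : {Γ : Diagram (Fin (n + 1)) // Γ.IsGeneratorOf .psipsiphi},
      (if Γ.1.Pending .sca w then graph K Γ.1 else 0) =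
      ∑ Γ : {Γ : Diagram (Fin n) // Γ.IsGeneratorOf .psipsi},
        ∑ e : Fin n × Fin n with Γ.1.ferm e.1 e.2, graph K (Γ.1.insertScalar e.1 e.2) := by
    intro w
    rw [← sum_graph_pending_sca, ← Finset.sum_filter]
    let f : Fin (n + 1) ≃ Fin n ⊕ Unit := (finSuccEquiv' w).trans (Equiv.optionEquivSumPUnit _)
    have hf : f w = .inr () := by simp [f]
    refine Finset.sum_bij (fun Γ hΓ => ⟨Γ.1.relabel f,
      ((isomorphic_relabel f Γ.1).isGeneratorOf _).1 Γ.2, ?_⟩) (fun _ _ => Finset.mem_univ _)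
      ?_ ?_ ?_
    · rw [← hf, ← (isIso_relabel f Γ.1).pending]
      simpa using hΓ
    · intro Γ _ Γ' _ he
      exact Subtype.ext ((relabelEquiv f).injective (congrArg Subtype.val he))
    · rintro ⟨Δ, h, hp⟩ -
      obtain ⟨Γ, rfl⟩ := (relabelEquiv f).surjective Δ
      refine ⟨⟨Γ, ((isomorphic_relabel f Γ).isGeneratorOf _).2 h⟩, ?_, rfl⟩
      simp only [Finset.mem_filter, Finset.mem_univ, true_and]
      rwa [(isIso_relabel f Γ).pending, hf]
    · intro Γ _
      exact (isomorphic_relabel f Γ.1).graph_eq K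
  rw [Finset.sum_congr rfl fun w _ => h₂ w, Finset.sum_const, Finset.card_univ, Fintype.card_fin,
    ← Nat.cast_smul_eq_nsmul K]

/-- The vertex graphs are obtained by insertion of a scalar leg on all fermion propagators. -/
theorem c_psipsiphi_eq_insertionSum [CharZero K] (k : ℕ) :
    c K .psipsiphi k = insertionSum K k := by
  classical
  rw [c_eq_labelledSum, labelledSum, insertionSum, sum_symWeight K .psipsi k
    fun Γ => ∑ e : Fin Γ.1 × Fin Γ.1 with Γ.rep.ferm e.1 e.2,
      graph K (Γ.rep.insertScalar e.1 e.2)]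
  rw [show Residue.size .psipsiphi k = Residue.size .psipsi k + 1 from rfl, sum_graph_psipsiphi,
    smul_smul]
  congr 1
  · have h₁ : ((Residue.size .psipsi k + 1 : ℕ) : K) ≠ 0 := Nat.cast_ne_zero.2 (Nat.succ_ne_zero _)
    have h₂ : ((Residue.size .psipsi k).factorial : K) ≠ 0 :=
      Nat.cast_ne_zero.2 (Nat.factorial_ne_zero _)
    rw [Nat.factorial_succ]
    push_cast at h₁ ⊢
    simp only [Residue.legs]
    field_simp
    simp
  · refine Finset.sum_congr rfl fun Γ _ => ?_
    exact sum_insertScalar_congr K (rep_toGen Γ.1 Γ.2.1).symm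

end

/-! ### Insertion at a vertex -/

namespace Diagram

variable {A B : Type}

/-- The half-edges that are joined after the vertex `none` of `Γ` has been replaced by `γ`, whose leg
of kind `t` is at the vertex `l t`. -/
def insertVertexLink (Γ : Diagram (Option A)) (γ : Diagram B) (l : Leg → B) :
    Leg → A ⊕ B → A ⊕ B → Prop
  | s, .inl u, .inl v => Γ.link s (some u) (some v)
  | s, .inl u, .inr z => Γ.link s (some u) none ∧ z = l s.bar
  | s, .inr z, .inl u => Γ.link s none (some u) ∧ z = l s
  | s, .inr z, .inr z' => γ.link s z z'

/-- Insertion of `γ` at the vertex `none` of `Γ`, the leg of kind `t` of `γ` being at `l t`. -/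
def insertVertex (Γ : Diagram (Option A)) (γ : Diagram B) (l : Leg → B) : Diagram (A ⊕ B) :=
  ofLink (insertVertexLink Γ γ l)

/-- The insertion described by `insertVertex` is meaningful. -/
structure Substitutable (Γ : Diagram (Option A)) (γ : Diagram B) (l : Leg → B) : Prop where
  left : Γ.IsFeynman
  right : γ.IsFeynman
  not_link : ∀ s, ¬ Γ.link s none none
  legs : ∀ s z, γ.Pending s z ↔ z = l s

variable {Γ : Diagram (Option A)} {γ : Diagram B} {l : Leg → B}

theorem insertVertexLink_symm (hΓ : Γ.IsFeynman) (hγ : γ.IsFeynman) {s : Leg} {u v : A ⊕ B}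
    (h : insertVertexLink Γ γ l s u v) : insertVertexLink Γ γ l s.bar v u := by
  rcases u with u | u <;> rcases v with v | v
  · exact hΓ.link_symm h
  · exact ⟨hΓ.link_symm h.1, h.2⟩
  · exact ⟨hΓ.link_symm h.1, by rw [Leg.bar_bar]; exact h.2⟩
  · exact hγ.link_symm h

theorem link_insertVertex (hΓ : Γ.IsFeynman) (hγ : γ.IsFeynman) {s : Leg} {u v : A ⊕ B} :
    (insertVertex Γ γ l).link s u v ↔ insertVertexLink Γ γ l s u v := by
  exact link_ofLink (fun _ _ _ => insertVertexLink_symm hΓ hγ) s u v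

/-- Contraction of all of `B` to one vertex. -/
def collapse : A ⊕ B → Option A := Sum.elim some fun _ => none

theorem Substitutable.collapse_link (h : Substitutable Γ γ l) {s : Leg} {u v : A ⊕ B}
    (hl : (insertVertex Γ γ l).link s u v) : Γ.link s (collapse u) (collapse v) ∨
      collapse u = none ∧ collapse v = none := by
  rw [link_insertVertex h.left h.right] at hl
  rcases u with u | u <;> rcases v with v | v
  · exact .inl hl
  · exact .inl hl.1
  · exact .inl hl.1
  · exact .inr ⟨rfl, rfl⟩

theorem Substitutable.isFeynman (h : Substitutable Γ γ l) : (insertVertex Γ γ l).IsFeynman := by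
  have hlink := fun s u v => link_insertVertex (l := l) h.left h.right (s := s) (u := u) (v := v)
  rw [isFeynman_iff]
  refine ⟨fun s u v w h₁ h₂ => ?_, fun s u v h₁ => ?_, ?_⟩
  · have hu := fun u v w => h.left.link_unique (t := s) (u := u) (v := v) (w := w)
    have hp : ∀ z, ¬ γ.link s (l s) z := fun z hz => (h.legs s (l s)).2 rfl ⟨z, hz⟩
    rw [hlink] at h₁ h₂
    rcases u with u | u <;> rcases v with v | v <;> rcases w with w | w
    · exact congrArg _ (Option.some_injective _ (hu _ _ _ h₁ h₂))
    · exact absurd (hu _ _ _ h₁ h₂.1) (by simp)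
    · exact absurd (hu _ _ _ h₁.1 h₂) (by simp)
    · rw [h₁.2, h₂.2]
    · exact congrArg _ (Option.some_injective _ (hu _ _ _ h₁.1 h₂.1))
    · obtain ⟨-, rfl⟩ := h₁
      exact absurd h₂ (hp _)
    · obtain ⟨-, rfl⟩ := h₂
      exact absurd h₁ (hp _)
    · exact congrArg _ (h.right.link_unique h₁ h₂)
  · rw [hlink] at h₁ ⊢
    exact insertVertexLink_symm h.left h.right h₁
  · rintro (u | u) h₁ <;> rw [hlink] at h₁
    · exact h.left.scal_irrefl _ h₁
    · exact h.right.scal_irrefl _ h₁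

theorem Substitutable.pending_inl (h : Substitutable Γ γ l) (s : Leg) (u : A) :
    (insertVertex Γ γ l).Pending s (.inl u) ↔ Γ.Pending s (some u) := by
  refine not_congr ⟨?_, ?_⟩
  · rintro ⟨v, hv⟩
    rcases h.collapse_link hv with hl | hl
    · exact ⟨_, hl⟩
    · exact absurd hl.1 (by simp [collapse])
  · rintro ⟨_ | v, hv⟩
    · exact ⟨.inr (l s.bar), (link_insertVertex h.left h.right).2 ⟨hv, rfl⟩⟩
    · exact ⟨.inl v, (link_insertVertex h.left h.right).2 hv⟩

theorem Substitutable.pending_inr (h : Substitutable Γ γ l) (s : Leg) (z : B) :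
    (insertVertex Γ γ l).Pending s (.inr z) ↔ z = l s ∧ Γ.Pending s none := by
  have hlink := fun s u v => link_insertVertex (l := l) h.left h.right (s := s) (u := u) (v := v)
  constructor
  · intro hp
    have hz : z = l s := (h.legs s z).1 fun ⟨v, hv⟩ => hp ⟨.inr v, (hlink _ _ _).2 hv⟩
    refine ⟨hz, ?_⟩
    rintro ⟨_ | v, hv⟩
    · exact h.not_link s hv
    · exact hp ⟨.inl v, (hlink _ _ _).2 ⟨hv, hz⟩⟩
  · rintro ⟨rfl, hp⟩ ⟨v | v, hv⟩ <;> rw [hlink] at hv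
    · exact hp ⟨_, hv.1⟩
    · exact (h.legs s _).2 rfl ⟨_, hv⟩

theorem Substitutable.nLeg_eq (h : Substitutable Γ γ l) (s : Leg) :
    (insertVertex Γ γ l).nLeg s = Γ.nLeg s := by
  refine (Nat.card_congr (Equiv.ofBijective
    (fun u : {u : A ⊕ B // (insertVertex Γ γ l).Pending s u} => (⟨collapse u.1, ?_⟩ :
      {u : Option A // Γ.Pending s u})) ⟨?_, ?_⟩))
  · obtain ⟨u | u, hu⟩ := u
    · exact (h.pending_inl s u).1 hu
    · exact ((h.pending_inr s u).1 hu).2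
  · rintro ⟨u | u, hu⟩ ⟨v | v, hv⟩ he
    · simpa [collapse] using he
    · simp [collapse] at he
    · simp [collapse] at he
    · rw [h.pending_inr] at hu hv
      simp [hu.1, hv.1]
  · rintro ⟨_ | u, hu⟩
    · exact ⟨⟨.inr (l s), (h.pending_inr s _).2 ⟨rfl, hu⟩⟩, rfl⟩
    · exact ⟨⟨.inl u, (h.pending_inl s u).2 hu⟩, rfl⟩

/-- A one-particle irreducible graph stays so when a one-particle irreducible graph replaces a vertex. -/
theorem Substitutable.solid (h : Substitutable Γ γ l) (hγ : γ.Solid) (hs : Γ.Solid) :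
    (insertVertex Γ γ l).Solid := by
  have hlink := fun s u v => link_insertVertex (l := l) h.left h.right (s := s) (u := u) (v := v)
  refine ⟨hγ.1.map .inr, fun S hS hS' => ?_⟩
  by_cases hB : (Sum.inr ⁻¹' S).Nonempty ∧ Sum.inr ⁻¹' S ≠ (Set.univ : Set B)
  · obtain ⟨⟨s, u⟩, ⟨s', u'⟩, hne, ⟨hp, v, hv, hl⟩, ⟨hp', v', hv', hl'⟩⟩ := hγ.2 _ hB.1 hB.2
    exact ⟨(s, .inr u), (s', .inr u'), by simpa using hne, ⟨hp, .inr v, hv, (hlink _ _ _).2 hl⟩,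
      ⟨hp', .inr v', hv', (hlink _ _ _).2 hl'⟩⟩
  have hB' : ∀ z z' : B, Sum.inr z ∈ S → Sum.inr z' ∈ S := fun z z' hz => by
    rw [not_and_or, not_not] at hB
    rcases hB with hB | hB
    · exact absurd ⟨z, hz⟩ hB
    · exact (hB ▸ Set.mem_univ z' : z' ∈ Sum.inr ⁻¹' S)
  -- `S` does not split `B`, so that it comes from a cut of `Γ`
  obtain ⟨T, rfl⟩ : ∃ T, S = collapse ⁻¹' T := by
    refine ⟨collapse '' S, subset_antisymm (Set.subset_preimage_image _ _) ?_⟩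
    rintro (u | u) ⟨v | v, hv, he⟩
    · obtain rfl : v = u := by simpa [collapse] using he
      exact hv
    · simp [collapse] at he
    · simp [collapse] at he
    · exact hB' _ _ hv
  have hsur : Function.Surjective (collapse : A ⊕ B → Option A) := by
    rintro (_ | u)
    · exact hγ.1.elim fun z => ⟨.inr z, rfl⟩
    · exact ⟨.inl u, rfl⟩
  have hT : T.Nonempty := hS.imp' collapse fun _ hu => hu
  have hT' : T ≠ Set.univ := by
    rintro rfl
    exact hS' Set.preimage_univ
  obtain ⟨p, q, hpq, hp, hq⟩ := hs.2 T hT hT'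
  let f : Leg × Option A → Leg × (A ⊕ B) := fun p => (p.1, p.2.elim (.inr (l p.1)) .inl)
  have hf : Function.Injective f := by
    rintro ⟨s, _ | u⟩ ⟨s', _ | u'⟩ he <;> simp_all [f]
  have key : ∀ p, Γ.Cross T p → (insertVertex Γ γ l).Cross (collapse ⁻¹' T) (f p) := by
    rintro ⟨s, _ | u⟩ ⟨hu, _ | v, hv, hl⟩
    · exact absurd hu hv
    · exact ⟨hu, .inl v, hv, (hlink _ _ _).2 ⟨hl, rfl⟩⟩
    · exact ⟨hu, .inr (l s.bar), hv, (hlink _ _ _).2 ⟨hl, rfl⟩⟩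
    · exact ⟨hu, .inl v, hv, (hlink _ _ _).2 hl⟩
  exact ⟨f p, f q, hf.ne hpq, key p hp, key q hq⟩

/-- The contraction of a component to a vertex preserves one-particle irreducibility. -/
theorem Substitutable.solid_left (h : Substitutable Γ γ l)
    (hs : (insertVertex Γ γ l).Solid) : Γ.Solid := by
  have hlink := fun s u v => link_insertVertex (l := l) h.left h.right (s := s) (u := u) (v := v)
  refine ⟨⟨none⟩, fun T hT hT' => ?_⟩
  have hsur : Function.Surjective (collapse : A ⊕ B → Option A) := by
    rintro (_ | u)
    · exact ⟨.inr (l .sca), rfl⟩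
    · exact ⟨.inl u, rfl⟩
  obtain ⟨p, q, hpq, hp, hq⟩ := hs.2 (collapse ⁻¹' T) (hT.preimage hsur) (fun hu => hT' (by
    rw [← Set.image_preimage_eq T hsur, hu, Set.image_univ, hsur.range_eq]))
  have key : ∀ p, (insertVertex Γ γ l).Cross (collapse ⁻¹' T) p →
      Γ.Cross T (p.1, collapse p.2) ∧ ∀ z, p.2 = .inr z → z = l p.1 := by
    rintro ⟨s, u⟩ ⟨hu, v, hv, hl⟩
    refine ⟨⟨hu, collapse v, hv, ?_⟩, ?_⟩
    · rcases h.collapse_link hl with hl | hl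
      · exact hl
      · exact absurd (show collapse v ∈ T from hl.2 ▸ hl.1 ▸ hu) hv
    · rintro z rfl
      rw [hlink] at hl
      rcases v with v | v
      · exact hl.2
      · exact absurd hu hv
  obtain ⟨hp₁, hp₂⟩ := key p hp
  obtain ⟨hq₁, hq₂⟩ := key q hq
  refine ⟨_, _, fun he => hpq ?_, hp₁, hq₁⟩
  obtain ⟨s, u | u⟩ := p <;> obtain ⟨s', u' | u'⟩ := q <;> simp_all [collapse]

theorem Substitutable.comap_inr (h : Substitutable Γ γ l) :
    (insertVertex Γ γ l).comap .inr = γ :=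
  ext_link fun s u v => by rw [link_comap, link_insertVertex h.left h.right]; rfl

/-- A diagram on `A ⊕ B` is an insertion at a vertex if `B` has one leg of each kind. -/
theorem exists_insertVertex {Δ : Diagram (A ⊕ B)} (hΔ : Δ.IsFeynman)
    (hl : ∀ s z, (Δ.comap .inr).Pending s z ↔ z = l s) :
    ∃ Γ : Diagram (Option A), Substitutable Γ (Δ.comap .inr) l ∧
      insertVertex Γ (Δ.comap .inr) l = Δ := by
  let R : Leg → Option A → Option A → Prop := fun s u v => match u, v with
    | some u, some v => Δ.link s (.inl u) (.inl v)
    | some u, none => ∃ z, Δ.link s (.inl u) (.inr z)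
    | none, some v => ∃ z, Δ.link s (.inr z) (.inl v)
    | none, none => False
  have hR : ∀ s u v, R s u v → R s.bar v u := by
    rintro s (_ | u) (_ | v) h
    · exact h
    · exact h.imp fun z hz => hΔ.link_symm hz
    · exact h.imp fun z hz => hΔ.link_symm hz
    · exact hΔ.link_symm h
  have hlR : ∀ s u v, (ofLink R).link s u v ↔ R s u v := link_ofLink hR
  have hu := fun s u v w => hΔ.link_unique (t := s) (u := u) (v := v) (w := w)
  have hout : ∀ s z u, Δ.link s (.inr z) (.inl u) → z = l s := fun s z u h =>
    (hl s z).1 fun ⟨v, hv⟩ => Sum.inl_ne_inr (hu _ _ _ _ h (link_comap.1 hv))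
  have hF : (ofLink R).IsFeynman := by
    refine isFeynman_iff.2 ⟨fun s u v w h₁ h₂ => ?_, fun s u v h => ?_, fun v h => ?_⟩
    · rw [hlR] at h₁ h₂
      rcases u with _ | u <;> rcases v with _ | v <;> rcases w with _ | w <;>
        simp only [R] at h₁ h₂ ⊢
      · obtain ⟨z, hz⟩ := h₁
        obtain ⟨z', hz'⟩ := h₂
        obtain rfl := hout _ _ _ hz
        obtain rfl := hout _ _ _ hz'
        exact congrArg _ (Sum.inl_injective (hu _ _ _ _ hz hz'))
      · obtain ⟨z, hz⟩ := h₁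
        exact absurd (hu _ _ _ _ hz h₂) Sum.inr_ne_inl
      · obtain ⟨z, hz⟩ := h₂
        exact absurd (hu _ _ _ _ hz h₁) Sum.inr_ne_inl
      · exact congrArg _ (Sum.inl_injective (hu _ _ _ _ h₁ h₂))
    · rw [hlR] at h ⊢
      exact hR _ _ _ h
    · rw [hlR] at h
      rcases v with _ | v
      · exact h
      · exact hΔ.scal_irrefl _ h
  have hI : Substitutable (ofLink R) (Δ.comap .inr) l :=
    ⟨hF, hΔ.comap Sum.inr_injective, fun s h => (hlR _ _ _).1 h, hl⟩
  refine ⟨_, hI, ext_link fun s u v => ?_⟩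
  rw [link_insertVertex hI.left hI.right]
  rcases u with u | u <;> rcases v with v | v <;> simp only [insertVertexLink, hlR, link_comap, R]
  · constructor
    · rintro ⟨⟨z, hz⟩, rfl⟩
      rwa [← hout _ _ _ (hΔ.link_symm hz)]
    · exact fun h => ⟨⟨_, h⟩, hout _ _ _ (hΔ.link_symm h)⟩
  · constructor
    · rintro ⟨⟨z, hz⟩, rfl⟩
      rwa [← hout _ _ _ hz]
    · exact fun h => ⟨⟨_, h⟩, hout _ _ _ h⟩

theorem Substitutable.inj {Γ' : Diagram (Option A)} (h : Substitutable Γ γ l)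
    (h' : Substitutable Γ' γ l) (he : insertVertex Γ γ l = insertVertex Γ' γ l) : Γ = Γ' := by
  have hl : ∀ s u v, insertVertexLink Γ γ l s u v ↔ insertVertexLink Γ' γ l s u v :=
    fun s u v => by rw [← link_insertVertex h.left h.right, ← link_insertVertex h'.left h'.right, he]
  refine ext_link fun s u v => ?_
  rcases u with _ | u <;> rcases v with _ | v
  · exact iff_of_false (h.not_link s) (h'.not_link s)
  · simpa [insertVertexLink] using hl s (.inr (l s)) (.inl v)
  · simpa [insertVertexLink] using hl s (.inl u) (.inr (l s.bar))
  · simpa [insertVertexLink] using hl s (.inl u) (.inl v)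

end Diagram

/-! ### Subgraphs and contractions -/

namespace Diagram

variable {V W A B : Type}

/-- A propagator that leaves the block `X` by a half-edge of kind `t` and ends in the block `Y`. -/
def Step (Γ : Diagram V) (t : Leg) (X Y : Finset V) : Prop :=
  X ≠ Y ∧ ∃ a ∈ X, ∃ b ∈ Y, Γ.link t a b

theorem not_step_self (Γ : Diagram V) (t : Leg) (X : Finset V) : ¬ Γ.Step t X X := fun h => h.1 rfl

/-- Lines of blocks are preserved when the block `Z₀` is removed and the propagators on its two sides
are merged. -/
theorem line_iff {step : Finset V → Finset V → Prop} {step' : Finset W → Finset W → Prop}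
    {S : Finset V → Prop} {S' T : Finset W → Prop} {f : Finset W → Finset V} {Z₀ : Finset V}
    (hS : ∀ X, S' X ↔ S (f X)) (hT : ∀ X, S' X → T X)
    (hcov : ∀ Z, S Z → Z = Z₀ ∨ ∃ X, f X = Z)
    (hstep : ∀ X Y, T X → T Y → (step' X Y ↔ X ≠ Y ∧
      (step (f X) (f Y) ∨ step (f X) Z₀ ∧ step Z₀ (f Y))))
    (hZ : ∀ X, T X → step (f X) Z₀ → S Z₀) {X Y : Finset W} (hX : T X) (hY : T Y) (hYS : ¬ S' Y)
    (hne : X ≠ Y ∨ ∀ C, T C → ¬ step (f C) (f C) ∧ ¬ (step (f C) Z₀ ∧ step Z₀ (f C))) :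
    Line step' S' X Y ↔ Line step S (f X) (f Y) := by
  constructor
  · rintro ⟨C, hC, hCY⟩
    have key : T C ∧ Relation.ReflTransGen (fun X Y => step X Y ∧ S Y) (f X) (f C) := by
      clear hCY
      induction hC with
      | refl => exact ⟨hX, .refl⟩
      | tail _ h ih =>
        refine ⟨hT _ h.2, ?_⟩
        rcases ((hstep _ _ ih.1 (hT _ h.2)).1 h.1).2 with h' | h'
        · exact ih.2.tail ⟨h', (hS _).1 h.2⟩
        · exact (ih.2.tail ⟨h'.1, hZ _ ih.1 h'.1⟩).tail ⟨h'.2, (hS _).1 h.2⟩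
    rcases ((hstep _ _ key.1 hY).1 hCY).2 with h' | h'
    · exact ⟨_, key.2, h'⟩
    · exact ⟨_, key.2.tail ⟨h'.1, hZ _ key.1 h'.1⟩, h'.2⟩
  · rintro ⟨Z, hXZ, hZY⟩
    have key : (∃ C, Z = f C ∧ T C ∧ Relation.ReflTransGen (fun X Y => step' X Y ∧ S' Y) X C) ∨
        (Z = Z₀ ∧ ∃ C, T C ∧ Relation.ReflTransGen (fun X Y => step' X Y ∧ S' Y) X C ∧
          step (f C) Z₀) := by
      clear hZY
      induction hXZ with
      | refl => exact .inl ⟨X, rfl, hX, .refl⟩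
      | @tail Z Z' _ h ih =>
        rcases hcov _ h.2 with rfl | ⟨D, rfl⟩
        · right
          rcases ih with ⟨C, rfl, hTC, hC⟩ | ⟨rfl, C, hC⟩
          · exact ⟨rfl, C, hTC, hC, h.1⟩
          · exact ⟨rfl, C, hC⟩
        · left
          have hD := (hS _).2 h.2
          obtain ⟨C, hTC, hC, hor⟩ : ∃ C, T C ∧ Relation.ReflTransGen
              (fun X Y => step' X Y ∧ S' Y) X C ∧
              (step (f C) (f D) ∨ step (f C) Z₀ ∧ step Z₀ (f D)) := by
            rcases ih with ⟨C, rfl, hTC, hC⟩ | ⟨rfl, C, hTC, hC, h'⟩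
            · exact ⟨C, hTC, hC, .inl h.1⟩
            · exact ⟨C, hTC, hC, .inr ⟨h', h.1⟩⟩
          by_cases hCD : C = D
          · exact ⟨D, rfl, hT _ hD, hCD ▸ hC⟩
          · exact ⟨D, rfl, hT _ hD, hC.tail ⟨(hstep _ _ hTC (hT _ hD)).2 ⟨hCD, hor⟩, hD⟩⟩
    obtain ⟨C, hTC, hC, hor⟩ : ∃ C, T C ∧ Relation.ReflTransGen
        (fun X Y => step' X Y ∧ S' Y) X C ∧
        (step (f C) (f Y) ∨ step (f C) Z₀ ∧ step Z₀ (f Y)) := by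
      rcases key with ⟨C, rfl, hTC, hC⟩ | ⟨rfl, C, hTC, hC, h'⟩
      · exact ⟨C, hTC, hC, .inl hZY⟩
      · exact ⟨C, hTC, hC, .inr ⟨h', hZY⟩⟩
    refine ⟨C, hC, (hstep _ _ hTC hY).2 ⟨?_, hor⟩⟩
    rintro rfl
    rcases hne with hne | hne
    · rcases hC.cases_tail with h | ⟨D, _, h⟩
      · exact hne h.symm
      · exact hYS h.2
    · have := hne C hTC
      tauto

theorem IsContractedVertex.not_isContractedEdge {Γ : Diagram V} {P : Finset (Finset V)}
    {X : Finset V} (h : Γ.IsContractedVertex P X) : ¬ Γ.IsContractedEdge P X := by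
  rintro ⟨h₁, h₂⟩
  rcases h with h | ⟨v, rfl, hv⟩
  · exact h₂ h.2
  · exact hv _ h₁ (Finset.mem_singleton_self v)

/-- The blocks of a subgraph: its components and the vertices outside. -/
def IsBlock (Γ : Diagram V) (P : Finset (Finset V)) (X : Finset V) : Prop :=
  Γ.IsContractedVertex P X ∨ Γ.IsContractedEdge P X

theorem isBlock_iff {Γ : Diagram V} {P : Finset (Finset V)} {X : Finset V} :
    Γ.IsBlock P X ↔ X ∈ P ∨ ∃ v, X = {v} ∧ ∀ Y ∈ P, v ∉ Y := by
  simp only [IsBlock, IsContractedVertex, IsContractedEdge]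
  by_cases h : (Γ.induce X).HasResidue .psipsiphi <;> simp [h, or_comm]

/-- Comparison of two contracted graphs by means of a map `f` between the blocks; a block `Z₀` with
two legs may be missing on one side. -/
theorem contract_isomorphic {Γ : Diagram V} {Γ' : Diagram W} {P : Finset (Finset V)}
    {P' : Finset (Finset W)} {f : Finset W → Finset V} {Z₀ : Finset V}
    (hinj : Function.Injective f)
    (hv : ∀ X, Γ'.IsContractedVertex P' X ↔ Γ.IsContractedVertex P (f X))
    (hv' : ∀ Z, Γ.IsContractedVertex P Z → ∃ X, f X = Z)
    (he : ∀ X, Γ'.IsContractedEdge P' X ↔ Γ.IsContractedEdge P (f X))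
    (he' : ∀ Z, Γ.IsContractedEdge P Z → Z = Z₀ ∨ ∃ X, f X = Z)
    (hstep : ∀ t X Y, Γ'.IsBlock P' X → Γ'.IsBlock P' Y → (Γ'.Step t X Y ↔ X ≠ Y ∧
      (Γ.Step t (f X) (f Y) ∨ Γ.Step t (f X) Z₀ ∧ Γ.Step t Z₀ (f Y))))
    (hZ : ∀ t X, Γ'.IsBlock P' X → Γ.Step t (f X) Z₀ → Γ.IsContractedEdge P Z₀)
    (hback : ∀ X, Γ'.IsBlock P' X → ¬ (Γ.Step .out (f X) Z₀ ∧ Γ.Step .out Z₀ (f X))) :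
    (Γ.contract P).Isomorphic (Γ'.contract P') := by
  refine Isomorphic.symm ⟨Equiv.ofBijective (fun X => ⟨f X.1, (hv _).1 X.2⟩)
    ⟨fun X Y h => Subtype.ext (hinj (congrArg Subtype.val h)), fun ⟨Z, hZ⟩ => ?_⟩, ?_, ?_⟩
  · obtain ⟨X, rfl⟩ := hv' Z hZ
    exact ⟨⟨X, (hv X).2 hZ⟩, rfl⟩
  · rintro ⟨X, hX⟩ ⟨Y, hY⟩
    exact line_iff (T := Γ'.IsBlock P') he (fun X h => .inr h) he' (hstep .out) (hZ .out) (.inl hX)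
      (.inl hY) hY.not_isContractedEdge (.inr fun C hC => ⟨not_step_self _ .out _, hback C hC⟩)
  · rintro ⟨X, hX⟩ ⟨Y, hY⟩
    have hne : (⟨X, hX⟩ : {X // Γ'.IsContractedVertex P' X}) ≠ ⟨Y, hY⟩ ↔
        (⟨f X, (hv X).1 hX⟩ : {X // Γ.IsContractedVertex P X}) ≠ ⟨f Y, (hv Y).1 hY⟩ := by
      rw [ne_eq, ne_eq, Subtype.mk.injEq, Subtype.mk.injEq, hinj.eq_iff]
    refine (and_congr_right fun h => ?_).trans (and_congr_left' hne)
    exact line_iff (T := Γ'.IsBlock P') he (fun X h => .inr h) he' (hstep .sca) (hZ .sca)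
      (.inl hX) (.inl hY) hY.not_isContractedEdge (.inl fun he => h (Subtype.ext he))

/-! ### Induced subgraphs along embeddings -/

theorem link_induce {Γ : Diagram V} {X : Finset V} {t : Leg} {u v : {v : V // v ∈ X}} :
    (Γ.induce X).link t u v ↔ Γ.link t u v := by cases t <;> rfl

theorem induce_map_isomorphic (Γ : Diagram V) (i : A ↪ V) (X : Finset A) :
    (Γ.induce (X.map i)).Isomorphic ((Γ.comap i).induce X) := by
  refine Isomorphic.symm ⟨Equiv.ofBijective (fun u => ⟨i u.1, Finset.mem_map_of_mem i u.2⟩)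
    ⟨fun u v h => Subtype.ext (i.injective (congrArg Subtype.val h)), ?_⟩, ?_⟩
  · rintro ⟨v, hv⟩
    obtain ⟨u, hu, rfl⟩ := Finset.mem_map.1 hv
    exact ⟨⟨u, hu⟩, rfl⟩
  · exact ⟨fun _ _ => Iff.rfl, fun _ _ => Iff.rfl⟩

theorem induce_congr {Γ Γ' : Diagram V} {X : Finset V}
    (h : ∀ t, ∀ u ∈ X, ∀ v ∈ X, (Γ.link t u v ↔ Γ'.link t u v)) : Γ.induce X = Γ'.induce X :=
  ext_link fun t u v => by rw [link_induce, link_induce, h t u u.2 v v.2]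

theorem induce_univ_isomorphic [Fintype V] (Γ : Diagram V) : (Γ.induce Finset.univ).Isomorphic Γ :=
  ⟨Equiv.subtypeUnivEquiv Finset.mem_univ, fun _ _ => Iff.rfl, fun _ _ => Iff.rfl⟩

end Diagram

/-- A family of sets of vertices, seen in a larger set of vertices. -/
def liftFamily {A V : Type} (i : A ↪ V) (P : Finset (Finset A)) : Finset (Finset V) :=
  P.map (Finset.mapEmbedding i).toEmbedding

theorem mem_liftFamily {A V : Type} {i : A ↪ V} {P : Finset (Finset A)} {Z : Finset V} :
    Z ∈ liftFamily i P ↔ ∃ X ∈ P, X.map i = Z := by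
  simp only [liftFamily, Finset.mem_map]
  rfl

theorem map_mem_liftFamily {A V : Type} {i : A ↪ V} {P : Finset (Finset A)} {X : Finset A} :
    X.map i ∈ liftFamily i P ↔ X ∈ P := by
  rw [mem_liftFamily]
  exact ⟨fun ⟨Y, hY, h⟩ => Finset.map_injective i h ▸ hY, fun h => ⟨X, h, rfl⟩⟩

theorem exists_mem_map {A V : Type} {i : A ↪ V} {X : Finset A} {p : V → Prop} :
    (∃ w ∈ X.map i, p w) ↔ ∃ u ∈ X, p (i u) := by simp

theorem liftFamily_injective {A V : Type} (i : A ↪ V) : Function.Injective (liftFamily i) :=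
  Finset.map_injective _

theorem liftFamily_pairwiseDisjoint {A V : Type} {i : A ↪ V} {P : Finset (Finset A)} :
    (liftFamily i P : Set (Finset V)).PairwiseDisjoint id ↔
      (P : Set (Finset A)).PairwiseDisjoint id := by
  constructor
  · intro h X hX Y hY hne
    exact (Finset.disjoint_map i).1 (h (Finset.mem_coe.2 (map_mem_liftFamily.2 hX))
      (Finset.mem_coe.2 (map_mem_liftFamily.2 hY)) ((Finset.map_injective i).ne hne))
  · rintro h X hX Y hY hne
    obtain ⟨X, hX', rfl⟩ := mem_liftFamily.1 (Finset.mem_coe.1 hX)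
    obtain ⟨Y, hY', rfl⟩ := mem_liftFamily.1 (Finset.mem_coe.1 hY)
    exact (Finset.disjoint_map i).2 (h hX' hY' fun h => hne (h ▸ rfl))

namespace Diagram

variable {V W A B : Type}

/-! ### Contraction before and after an insertion -/

/-- Contraction of the empty subgraph. -/
theorem contract_empty_isomorphic {Γ : Diagram V} (h : ∀ t u, ¬ Γ.link t u u) :
    (Γ.contract ∅).Isomorphic Γ := by
  have hv : ∀ X, Γ.IsContractedVertex ∅ X ↔ ∃ v, X = {v} := fun X => by simp [IsContractedVertex]
  have hl : ∀ step (X Y : Finset V), Line step (Γ.IsContractedEdge ∅) X Y ↔ step X Y := by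
    refine fun step X Y => ⟨fun ⟨C, hC, hCY⟩ => ?_, fun h => ⟨X, .refl, h⟩⟩
    rcases hC.cases_tail with rfl | ⟨D, _, hD⟩
    · exact hCY
    · exact absurd hD.2.1 (Finset.notMem_empty _)
  have hs : ∀ t u v, Γ.Step t {u} {v} ↔ Γ.link t u v := by
    intro t u v
    simp only [Step, Finset.mem_singleton, exists_eq_left, ne_eq, Finset.singleton_inj]
    exact ⟨fun h => h.2, fun hl => ⟨by rintro rfl; exact h t u hl, hl⟩⟩
  refine Isomorphic.symm ⟨Equiv.ofBijective (fun u => ⟨{u}, (hv _).2 ⟨u, rfl⟩⟩)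
    ⟨fun u v h => Finset.singleton_injective (congrArg Subtype.val h), ?_⟩, ?_, ?_⟩
  · rintro ⟨X, hX⟩
    obtain ⟨v, rfl⟩ := (hv X).1 hX
    exact ⟨v, rfl⟩
  · exact fun u v => ((hl _ _ _).trans (hs .out u v)).symm
  · intro u v
    refine Iff.trans ?_ (and_congr Iff.rfl (hl _ _ _)).symm
    refine ⟨fun huv => ⟨fun he => ?_, (hs .sca u v).2 huv⟩, fun huv => (hs .sca u v).1 huv.2⟩
    obtain rfl : u = v := Finset.singleton_injective (congrArg Subtype.val he)
    exact h .sca u huv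

/-- A family of blocks in `A` together with the block `B`. -/
def withBlock [Fintype B] [DecidableEq (Finset (A ⊕ B))] (P : Finset (Finset A)) :
    Finset (Finset (A ⊕ B)) :=
  insert (Finset.univ.map .inr) (liftFamily .inl P)

theorem map_inl_ne_map_inr [Fintype B] [Nonempty B] (X : Finset A) :
    X.map (.inl : A ↪ A ⊕ B) ≠ Finset.univ.map .inr := by
  intro h
  have z : B := Classical.arbitrary B
  have : Sum.inr z ∈ X.map (.inl : A ↪ A ⊕ B) := h ▸ Finset.mem_map_of_mem .inr (Finset.mem_univ z)
  simp at this

section withBlock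

variable [Fintype B] [DecidableEq (Finset (A ⊕ B))] {P : Finset (Finset A)}

theorem mem_withBlock {Z : Finset (A ⊕ B)} :
    Z ∈ withBlock P ↔ Z = Finset.univ.map .inr ∨ ∃ X ∈ P, X.map .inl = Z := by
  rw [withBlock, Finset.mem_insert, mem_liftFamily]

theorem map_inl_mem_withBlock [Nonempty B] {X : Finset A} :
    X.map .inl ∈ withBlock (B := B) P ↔ X ∈ P := by
  rw [withBlock, Finset.mem_insert, map_mem_liftFamily]
  exact or_iff_right (map_inl_ne_map_inr X)

theorem uncovered_withBlock {w : A ⊕ B} :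
    (∀ Y ∈ withBlock P, w ∉ Y) ↔ ∃ u, w = .inl u ∧ ∀ Y ∈ P, u ∉ Y := by
  simp only [mem_withBlock]
  rcases w with u | z
  · constructor
    · exact fun h => ⟨u, rfl, fun Y hY hu => h _ (.inr ⟨Y, hY, rfl⟩) (by simpa using hu)⟩
    · rintro ⟨_, ⟨⟩, h⟩ _ (rfl | ⟨X, hX, rfl⟩)
      · simp
      · simpa using h X hX
  · refine iff_of_false (fun h => h _ (.inl rfl) (by simp)) ?_
    rintro ⟨u, hu, -⟩
    exact Sum.inr_ne_inl hu

end withBlock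

theorem relabel_comap (e : V ≃ W) (Γ : Diagram V) : (Γ.relabel e).comap e = Γ :=
  ext_link fun t u v => by rw [link_comap, ← isIso_iff.1 (isIso_relabel e Γ)]

theorem induce_relabel_isomorphic (e : V ≃ W) (Γ : Diagram V) (X : Finset V) :
    ((Γ.relabel e).induce (X.map e.toEmbedding)).Isomorphic (Γ.induce X) := by
  have h := induce_map_isomorphic (Γ.relabel e) e.toEmbedding X
  have h' := relabel_comap e Γ
  rwa [show (Γ.relabel e).comap e.toEmbedding = Γ from h'] at h

theorem contract_relabel_isomorphic (e : V ≃ W) (Γ : Diagram V) (P : Finset (Finset V)) :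
    ((Γ.relabel e).contract (liftFamily e.toEmbedding P)).Isomorphic (Γ.contract P) := by
  have hr : ∀ X, ((Γ.relabel e).induce (X.map e.toEmbedding)).HasResidue .psipsiphi ↔
      (Γ.induce X).HasResidue .psipsiphi := fun X =>
    (induce_relabel_isomorphic e Γ X).hasResidue _
  have hsing : ∀ X : Finset V, (∃ w, X.map e.toEmbedding = {w} ∧
      ∀ Y ∈ liftFamily e.toEmbedding P, w ∉ Y) ↔ ∃ v, X = {v} ∧ ∀ Y ∈ P, v ∉ Y := by
    intro X
    rw [← e.exists_congr_right]
    refine exists_congr fun v => and_congr ?_ ⟨fun h Y hY hv => ?_, fun h Z hZ hv => ?_⟩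
    · rw [← (Finset.map_injective e.toEmbedding).eq_iff, Finset.map_singleton]
      rfl
    · exact h _ (map_mem_liftFamily.2 hY) (Finset.mem_map_of_mem e.toEmbedding hv)
    · obtain ⟨Y, hY, rfl⟩ := mem_liftFamily.1 hZ
      exact h Y hY ((Finset.mem_map' e.toEmbedding).1 hv)
  have hsur : ∀ Z : Finset W, ∃ X : Finset V, X.map e.toEmbedding = Z := fun Z =>
    ⟨Z.map e.symm.toEmbedding, by simp [Finset.map_map]⟩
  refine contract_isomorphic (f := fun X => X.map e.toEmbedding) (Z₀ := ∅)
    (Finset.map_injective _) (fun X => ?_) (fun Z _ => hsur Z) (fun X => ?_)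
    (fun Z _ => .inr (hsur Z)) (fun t X Y _ _ => ?_) (fun t X _ h => ?_) (fun X _ h => ?_)
  · simp only [IsContractedVertex, map_mem_liftFamily, hr, hsing]
  · simp only [IsContractedEdge, map_mem_liftFamily, hr]
  · simp only [Step, Finset.notMem_empty, false_and, and_false, exists_false, or_false, ne_eq,
      (Finset.map_injective e.toEmbedding).eq_iff, exists_mem_map, ← and_assoc, and_self]
    refine and_congr_right fun _ => ?_
    simp only [isIso_iff.1 (isIso_relabel e Γ)]
    rfl
  · simp [Step] at h
  · simp [Step] at h

section insertTwo

variable {P : Finset (Finset A)} {Γ : Diagram A} {γ : Diagram B} {t : Leg} {a b : A} {x y : B}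

/-- The components other than the inserted one are unchanged if the propagator of the insertion is
not contained in one of them. -/
theorem Insertable.induce_isomorphic (h : Insertable Γ γ t a b x y) {X : Finset A}
    (hX : ¬ (a ∈ X ∧ b ∈ X)) :
    ((insertTwo Γ γ t a b x y).induce (X.map .inl)).Isomorphic (Γ.induce X) := by
  have h₁ := induce_map_isomorphic (insertTwo Γ γ t a b x y) .inl X
  rwa [induce_congr (Γ' := Γ)] at h₁
  intro s u hu v hv
  rw [link_comap]
  refine (link_insertTwo h.left h.right).trans ⟨fun hl => hl.1, fun hl => ⟨hl, ?_, ?_⟩⟩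
  · rintro ⟨-, rfl, rfl⟩
    exact hX ⟨hu, hv⟩
  · rintro ⟨-, rfl, rfl⟩
    exact hX ⟨hv, hu⟩

theorem Insertable.induce_map_inr_isomorphic [Fintype B] (h : Insertable Γ γ t a b x y) :
    ((insertTwo Γ γ t a b x y).induce (Finset.univ.map .inr)).Isomorphic γ := by
  have h₁ := (induce_map_isomorphic (insertTwo Γ γ t a b x y) .inr Finset.univ).trans
    (induce_univ_isomorphic _)
  rwa [show (insertTwo Γ γ t a b x y).comap (Function.Embedding.inr : B ↪ A ⊕ B) = γ from
    h.comap_inr] at h₁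

/-- Two blocks with a common vertex agree. -/
theorem IsBlock.eq_of_mem {Γ : Diagram V} {P : Finset (Finset V)}
    (hP : (P : Set (Finset V)).PairwiseDisjoint id) {X Y : Finset V} (hX : Γ.IsBlock P X)
    (hY : Γ.IsBlock P Y) {u : V} (hu : u ∈ X) (hu' : u ∈ Y) : X = Y := by
  rw [isBlock_iff] at hX hY
  rcases hX with hX | ⟨v, rfl, hv⟩ <;> rcases hY with hY | ⟨w, rfl, hw⟩
  · by_contra hne
    exact Finset.disjoint_left.1 (hP hX hY hne) hu hu'
  · obtain rfl := Finset.mem_singleton.1 hu'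
    exact absurd hu (hw _ hX)
  · obtain rfl := Finset.mem_singleton.1 hu
    exact absurd hu' (hv _ hY)
  · rw [← Finset.mem_singleton.1 hu, ← Finset.mem_singleton.1 hu']

/-- Contraction after the insertion of a component with two legs. -/
theorem Insertable.contract_isomorphic [Fintype B] [DecidableEq (Finset (A ⊕ B))]
    (h : Insertable Γ γ t a b x y)
    (hγ : ¬ γ.HasResidue .psipsiphi) (hP : (P : Set (Finset A)).PairwiseDisjoint id)
    (hab : ∀ X ∈ P, ¬ (a ∈ X ∧ b ∈ X)) (hne : a ≠ b) :
    ((insertTwo Γ γ t a b x y).contract (withBlock P)).Isomorphic (Γ.contract P) := by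
  have hlink := fun s u v => link_insertTwo (t := t) (a := a) (b := b) (x := x) (y := y) h.left
    h.right (s := s) (u := u) (v := v)
  have : Nonempty B := ⟨x⟩
  have hr : ∀ X ∈ P, ((insertTwo Γ γ t a b x y).induce (X.map .inl)).HasResidue .psipsiphi ↔
      (Γ.induce X).HasResidue .psipsiphi := fun X hX =>
    (h.induce_isomorphic (hab X hX)).hasResidue _
  have hr₀ : ¬ ((insertTwo Γ γ t a b x y).induce (Finset.univ.map .inr)).HasResidue .psipsiphi :=
    fun h' => hγ ((h.induce_map_inr_isomorphic.hasResidue _).1 h')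
  have hZ : (insertTwo Γ γ t a b x y).IsContractedEdge (withBlock P) (Finset.univ.map .inr) :=
    ⟨mem_withBlock.2 (.inl rfl), hr₀⟩
  -- the only block that contains `B` is `B`
  have hblock : ∀ X, Γ.IsBlock P X → ¬ (a ∈ X ∧ b ∈ X) := by
    rintro X hX ⟨ha, hb⟩
    rcases isBlock_iff.1 hX with hX | ⟨v, rfl, -⟩
    · exact hab X hX ⟨ha, hb⟩
    · exact hne ((Finset.mem_singleton.1 ha).trans (Finset.mem_singleton.1 hb).symm)
  have hto : ∀ s (X : Finset A), (insertTwo Γ γ t a b x y).Step s (X.map .inl)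
      (Finset.univ.map .inr) ↔ (s = t ∧ a ∈ X) ∨ (s = t.bar ∧ b ∈ X) := by
    intro s X
    simp only [Step, map_inl_ne_map_inr, ne_eq, not_false_eq_true, true_and, exists_mem_map,
      hlink]
    constructor
    · rintro ⟨u, hu, z, -, (⟨rfl, rfl, rfl⟩ | ⟨rfl, rfl, rfl⟩)⟩
      · exact .inl ⟨rfl, hu⟩
      · exact .inr ⟨rfl, hu⟩
    · rintro (⟨rfl, hu⟩ | ⟨rfl, hu⟩)
      · exact ⟨a, hu, x, Finset.mem_univ _, .inl ⟨rfl, rfl, rfl⟩⟩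
      · exact ⟨b, hu, y, Finset.mem_univ _, .inr ⟨rfl, rfl, rfl⟩⟩
  have hfrom : ∀ s (X : Finset A), (insertTwo Γ γ t a b x y).Step s (Finset.univ.map .inr)
      (X.map .inl) ↔ (s = t.bar ∧ a ∈ X) ∨ (s = t ∧ b ∈ X) := by
    intro s X
    simp only [Step, (map_inl_ne_map_inr _).symm, ne_eq, not_false_eq_true, true_and,
      exists_mem_map, hlink]
    constructor
    · rintro ⟨z, -, u, hu, (⟨rfl, rfl, rfl⟩ | ⟨rfl, rfl, rfl⟩)⟩
      · exact .inl ⟨rfl, hu⟩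
      · exact .inr ⟨rfl, hu⟩
    · rintro (⟨rfl, hu⟩ | ⟨rfl, hu⟩)
      · exact ⟨x, Finset.mem_univ _, a, hu, .inl ⟨rfl, rfl, rfl⟩⟩
      · exact ⟨y, Finset.mem_univ _, b, hu, .inr ⟨rfl, rfl, rfl⟩⟩
  refine Diagram.contract_isomorphic (f := fun X => X.map .inl) (Z₀ := Finset.univ.map .inr)
    (Finset.map_injective _) (fun X => ?_) (fun Z hZ' => ?_) (fun X => ?_) (fun Z hZ' => ?_)
    (fun s X Y hX hY => ?_) (fun s X _ _ => hZ) (fun X hX hb => ?_)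
  · simp only [IsContractedVertex, map_inl_mem_withBlock, uncovered_withBlock]
    refine or_congr (and_congr_right fun hX => (hr X hX).symm) ⟨?_, ?_⟩
    · rintro ⟨u, rfl, hu⟩
      exact ⟨.inl u, by simp, u, rfl, hu⟩
    · rintro ⟨_, hX, u, rfl, hu⟩
      refine ⟨u, Finset.map_injective (.inl : A ↪ A ⊕ B) ?_, hu⟩
      rw [hX, Finset.map_singleton]
      rfl
  · rcases hZ' with ⟨h₁, h₂⟩ | ⟨w, rfl, hw⟩
    · rcases mem_withBlock.1 h₁ with rfl | ⟨X, -, rfl⟩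
      · exact absurd h₂ hr₀
      · exact ⟨X, rfl⟩
    · obtain ⟨u, rfl, -⟩ := uncovered_withBlock.1 hw
      exact ⟨{u}, by simp⟩
  · simp only [IsContractedEdge, map_inl_mem_withBlock]
    exact and_congr_right fun hX => not_congr (hr X hX).symm
  · rcases mem_withBlock.1 hZ'.1 with rfl | ⟨X, -, rfl⟩
    · exact .inl rfl
    · exact .inr ⟨X, rfl⟩
  · rw [hto, hfrom]
    constructor
    · rintro ⟨hXY, u, hu, v, hv, hl⟩
      refine ⟨hXY, ?_⟩
      by_cases h₁ : s = t ∧ u = a ∧ v = b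
      · obtain ⟨rfl, rfl, rfl⟩ := h₁
        exact .inr ⟨.inl ⟨rfl, hu⟩, .inr ⟨rfl, hv⟩⟩
      by_cases h₂ : s = t.bar ∧ u = b ∧ v = a
      · obtain ⟨rfl, rfl, rfl⟩ := h₂
        exact .inr ⟨.inr ⟨rfl, hu⟩, .inl ⟨rfl, hv⟩⟩
      exact .inl ⟨(Finset.map_injective _).ne hXY, _, Finset.mem_map_of_mem .inl hu, _,
        Finset.mem_map_of_mem .inl hv, (hlink _ _ _).2 ⟨hl, h₁, h₂⟩⟩
    · rintro ⟨hXY, ⟨-, u, hu, v, hv, hl⟩ | ⟨h₁, h₂⟩⟩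
      · obtain ⟨u, hu', rfl⟩ := Finset.mem_map.1 hu
        obtain ⟨v, hv', rfl⟩ := Finset.mem_map.1 hv
        exact ⟨hXY, u, hu', v, hv', ((hlink _ _ _).1 hl).1⟩
      · rcases h₁ with ⟨h₁, hu⟩ | ⟨h₁, hu⟩ <;> rcases h₂ with ⟨h₂, hv⟩ | ⟨h₂, hv⟩
        · exact absurd (hX.eq_of_mem hP hY hu hv) hXY
        · exact ⟨hXY, a, hu, b, hv, h₁ ▸ h.link⟩
        · exact ⟨hXY, b, hu, a, hv, h₁ ▸ h.left.link_symm h.link⟩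
        · exact absurd (hX.eq_of_mem hP hY hu hv) hXY
  · rw [hto, hfrom] at hb
    have hX' := hblock X hX
    have ht : ∀ s : Leg, s = .out → s = s.bar → False := by
      rintro _ rfl h
      exact Leg.noConfusion h
    rcases hb with ⟨⟨h₁, hu⟩ | ⟨h₁, hu⟩, ⟨h₂, hv⟩ | ⟨h₂, hv⟩⟩
    · exact ht t h₁.symm (h₁.symm.trans h₂)
    · exact hX' ⟨hu, hv⟩
    · exact hX' ⟨hv, hu⟩
    · exact ht t h₂.symm (h₂.symm.trans h₁)

end insertTwo

section insertVertex

variable {P : Finset (Finset A)} {Γ : Diagram (Option A)} {γ : Diagram B}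
  {l : Leg → B}

theorem Substitutable.induce_isomorphic (h : Substitutable Γ γ l) (X : Finset A) :
    ((insertVertex Γ γ l).induce (X.map .inl)).Isomorphic (Γ.induce (X.map .some)) := by
  have h₁ := induce_map_isomorphic (insertVertex Γ γ l) .inl X
  have h₂ := induce_map_isomorphic Γ .some X
  rw [induce_congr (Γ' := Γ.comap some)] at h₁
  · exact h₁.trans h₂.symm
  · intro s u _ v _
    rw [link_comap, link_comap]
    exact link_insertVertex h.left h.right

theorem Substitutable.induce_map_inr_isomorphic [Fintype B] (h : Substitutable Γ γ l) :
    ((insertVertex Γ γ l).induce (Finset.univ.map .inr)).Isomorphic γ := by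
  have h₁ := (induce_map_isomorphic (insertVertex Γ γ l) .inr Finset.univ).trans
    (induce_univ_isomorphic _)
  rwa [show (insertVertex Γ γ l).comap (Function.Embedding.inr : B ↪ A ⊕ B) = γ from
    h.comap_inr] at h₁

theorem uncovered_liftFamily_some {o : Option A} :
    (∀ Y ∈ liftFamily .some P, o ∉ Y) ↔ o = none ∨ ∃ u, o = some u ∧ ∀ Y ∈ P, u ∉ Y := by
  simp only [mem_liftFamily]
  rcases o with _ | u
  · refine iff_of_true ?_ (.inl rfl)
    rintro _ ⟨X, -, rfl⟩
    simp
  · constructor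
    · exact fun h => .inr ⟨u, rfl, fun Y hY hu => h _ ⟨Y, hY, rfl⟩ (by simpa using hu)⟩
    · rintro (h | ⟨_, ⟨⟩, h⟩) _ ⟨X, hX, rfl⟩
      · simp at h
      · simpa using h X hX

/-- Contraction after the insertion of a component with three legs. -/
theorem Substitutable.contract_isomorphic [Fintype A] [Fintype B]
    [DecidableEq (Finset (A ⊕ B))] (h : Substitutable Γ γ l)
    (hγ : γ.HasResidue .psipsiphi) :
    ((insertVertex Γ γ l).contract (withBlock P)).Isomorphic
      (Γ.contract (liftFamily .some P)) := by
  classical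
  have hlink := fun s u v => link_insertVertex (l := l) h.left h.right (s := s) (u := u) (v := v)
  have : Nonempty B := ⟨l .sca⟩
  have hr : ∀ X : Finset A, ((insertVertex Γ γ l).induce (X.map .inl)).HasResidue .psipsiphi ↔
      (Γ.induce (X.map .some)).HasResidue .psipsiphi := fun X =>
    (h.induce_isomorphic X).hasResidue _
  have hr₀ : ((insertVertex Γ γ l).induce (Finset.univ.map .inr)).HasResidue .psipsiphi :=
    (h.induce_map_inr_isomorphic.hasResidue _).2 hγ
  let f : Finset (Option A) → Finset (A ⊕ B) := fun X => Finset.univ.filter fun w => collapse w ∈ X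
  have hf : ∀ X w, w ∈ f X ↔ collapse w ∈ X := fun X w => by simp [f]
  have hinj : Function.Injective f := by
    intro X Y hXY
    ext (_ | u)
    · simpa [hf, collapse] using congrArg (.inr (l .sca) ∈ ·) hXY
    · simpa [hf, collapse] using congrArg (.inl u ∈ ·) hXY
  have hf₀ : f {none} = Finset.univ.map .inr := by
    ext (w | w) <;> simp [hf, collapse]
  have hf₁ : ∀ X : Finset A, f (X.map .some) = X.map .inl := by
    intro X
    ext (w | w) <;> simp [hf, collapse]
  have hf₂ : ∀ u : A, f {some u} = {.inl u} := fun u => by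
    have h' := hf₁ {u}
    rwa [Finset.map_singleton, Finset.map_singleton] at h'
  have hmem : ∀ X, f X ∈ withBlock P ↔ X = {none} ∨ X ∈ liftFamily .some P := by
    intro X
    rw [mem_withBlock, ← hf₀, hinj.eq_iff, mem_liftFamily]
    simp only [← hf₁, hinj.eq_iff]
  have hsing : ∀ X : Finset (Option A), (∃ w, f X = {w} ∧ ∀ Y ∈ withBlock P, w ∉ Y) ↔
      ∃ u, X = {some u} ∧ ∀ Y ∈ P, u ∉ Y := by
    intro X
    simp only [uncovered_withBlock]
    constructor
    · rintro ⟨_, hX, u, rfl, hu⟩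
      exact ⟨u, hinj (hX.trans (hf₂ u).symm), hu⟩
    · rintro ⟨u, rfl, hu⟩
      exact ⟨_, hf₂ u, u, rfl, hu⟩
  have hnone : ∀ X, Γ.IsBlock (liftFamily .some P) X → none ∈ X → X = {none} := by
    intro X hX hn
    rcases isBlock_iff.1 hX with hX | ⟨v, rfl, -⟩
    · obtain ⟨Y, -, rfl⟩ := mem_liftFamily.1 hX
      simp at hn
    · rw [Finset.mem_singleton.1 hn]
  have hnone' : {none} ∉ liftFamily .some P := fun hn => by
    obtain ⟨Y, -, h⟩ := mem_liftFamily.1 hn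
    have : none ∈ Y.map .some := h ▸ Finset.mem_singleton_self none
    simp at this
  have hres : ∀ X ∈ liftFamily .some P, ((insertVertex Γ γ l).induce (f X)).HasResidue .psipsiphi ↔
      (Γ.induce X).HasResidue .psipsiphi := by
    rintro _ hX
    obtain ⟨X, -, rfl⟩ := mem_liftFamily.1 hX
    rw [hf₁, hr]
  refine Diagram.contract_isomorphic (f := f) (Z₀ := ∅) hinj (fun X => ?_) (fun Z hZ => ?_)
    (fun X => ?_) (fun Z hZ => ?_) (fun s X Y hX hY => ?_) (fun s X _ hs => ?_) (fun X _ hs => ?_)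
  · simp only [IsContractedVertex, hmem, hsing, uncovered_liftFamily_some]
    by_cases hX : X = {none}
    · subst hX
      refine iff_of_true (.inr ⟨none, rfl, .inl rfl⟩) (.inl ⟨.inl rfl, ?_⟩)
      rwa [hf₀]
    · refine or_congr ?_ ⟨?_, ?_⟩
      · rw [or_iff_right hX]
        exact and_congr_right fun hX => (hres X hX).symm
      · rintro ⟨_, rfl, rfl | ⟨u, rfl, hu⟩⟩
        · exact absurd rfl hX
        · exact ⟨u, rfl, hu⟩
      · rintro ⟨u, rfl, hu⟩
        exact ⟨_, rfl, .inr ⟨u, rfl, hu⟩⟩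
  · rcases hZ with ⟨h₁, -⟩ | ⟨w, rfl, hw⟩
    · rcases mem_withBlock.1 h₁ with rfl | ⟨X, -, rfl⟩
      · exact ⟨_, hf₀⟩
      · exact ⟨_, hf₁ X⟩
    · obtain ⟨u, rfl, -⟩ := uncovered_withBlock.1 hw
      exact ⟨_, hf₂ u⟩
  · simp only [IsContractedEdge, hmem]
    by_cases hX : X = {none}
    · subst hX
      refine iff_of_false (fun h => hnone' h.1) fun h => h.2 ?_
      rwa [hf₀]
    · rw [or_iff_right hX]
      exact and_congr_right fun hX => not_congr (hres X hX).symm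
  · rcases mem_withBlock.1 hZ.1 with rfl | ⟨X, -, rfl⟩
    · exact .inr ⟨_, hf₀⟩
    · exact .inr ⟨_, hf₁ X⟩
  · have h₀ : ∀ Z, ¬ (insertVertex Γ γ l).Step s Z ∅ := fun Z hZ => by simp [Step] at hZ
    simp only [h₀, false_and, or_false]
    constructor
    · rintro ⟨hXY, u, hu, v, hv, hl⟩
      refine ⟨hXY, hinj.ne hXY, ?_⟩
      rcases u with _ | u <;> rcases v with _ | v
      · exact absurd hl (h.not_link s)
      · exact ⟨.inr (l s), (hf _ _).2 hu, .inl v, (hf _ _).2 hv, (hlink _ _ _).2 ⟨hl, rfl⟩⟩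
      · exact ⟨.inl u, (hf _ _).2 hu, .inr (l s.bar), (hf _ _).2 hv, (hlink _ _ _).2 ⟨hl, rfl⟩⟩
      · exact ⟨.inl u, (hf _ _).2 hu, .inl v, (hf _ _).2 hv, (hlink _ _ _).2 hl⟩
    · rintro ⟨hXY, -, u, hu, v, hv, hl⟩
      rw [hf] at hu hv
      rcases h.collapse_link hl with hl | ⟨h₁, h₂⟩
      · exact ⟨hXY, _, hu, _, hv, hl⟩
      · exact absurd ((hnone X hX (h₁ ▸ hu)).trans (hnone Y hY (h₂ ▸ hv)).symm) hXY
  · simp [Step] at hs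
  · simp [Step] at hs

end insertVertex

end Diagram

/-! ### Generators with a marked subgraph -/

section


variable {V W A B : Type}

open Classical in
/-- `P` is a proper subgraph of the generator `Γ` with residue `r`; it has `ν ρ` components with
residue `ρ`, and its contraction has `N` vertices. -/
structure IsDecomposition (r : Residue) (N : ℕ) (ν : Residue → ℕ) (Γ : Diagram V)
    (P : Finset (Finset V)) : Prop where
  gen : Γ.IsGeneratorOf r
  sub : Γ.IsSubgraph P
  proper : ∀ X ∈ P, ∃ v, v ∉ X
  count : ∀ ρ, (P.filter fun X => (Γ.induce X).HasResidue ρ).card = ν ρ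
  free : Nat.card {v : V // ∀ X ∈ P, v ∉ X} + ν .psipsiphi = N

/-- The contribution of a subgraph to the coproduct. -/
noncomputable def splitTerm (K : Type*) [Field K] [Finite V] (Γ : Diagram V)
    (P : Finset (Finset V)) : H K ⊗[K] H K :=
  (∏ X ∈ P, graph K (Γ.induce X)) ⊗ₜ[K] graph K (Γ.contract P)

section Lift

theorem forall_mem_liftFamily {i : A ↪ V} {P : Finset (Finset A)} {p : Finset V → Prop} :
    (∀ X ∈ liftFamily i P, p X) ↔ ∀ X ∈ P, p (X.map i) := by
  simp only [mem_liftFamily]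
  exact ⟨fun h X hX => h _ ⟨X, hX, rfl⟩, by rintro h _ ⟨X, hX, rfl⟩; exact h X hX⟩

theorem card_filter_liftFamily {i : A ↪ V} {P : Finset (Finset A)} (p : Finset V → Prop)
    [DecidablePred p] (q : Finset A → Prop) [DecidablePred q] (h : ∀ X ∈ P, p (X.map i) ↔ q X) :
    ((liftFamily i P).filter p).card = (P.filter q).card := by
  rw [liftFamily, Finset.filter_map, Finset.card_map]
  congr 1
  exact Finset.filter_congr h

theorem prod_liftFamily {M : Type*} [CommMonoid M] {i : A ↪ V} {P : Finset (Finset A)}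
    (g : Finset V → M) : ∏ X ∈ liftFamily i P, g X = ∏ X ∈ P, g (X.map i) :=
  Finset.prod_map _ _ _

end Lift

/-- Isomorphic generators have corresponding subgraphs. -/
theorem isDecomposition_relabel [Finite V] (e : V ≃ W) {r : Residue} {N : ℕ} {ν : Residue → ℕ}
    {Γ : Diagram V} {P : Finset (Finset V)} :
    IsDecomposition r N ν (Γ.relabel e) (liftFamily e.toEmbedding P) ↔
      IsDecomposition r N ν Γ P := by
  classical
  have hi := induce_relabel_isomorphic e Γ
  have hf : Nat.card {w : W // ∀ X ∈ liftFamily e.toEmbedding P, w ∉ X} =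
      Nat.card {v : V // ∀ X ∈ P, v ∉ X} := by
    refine Nat.card_congr (e.subtypeEquiv fun v => ?_).symm
    rw [forall_mem_liftFamily]
    refine forall₂_congr fun X _ => not_congr ?_
    exact (Finset.mem_map' e.toEmbedding).symm
  have hg := ((isomorphic_relabel e Γ).isGeneratorOf r).symm
  have hs : (Γ.relabel e).IsSubgraph (liftFamily e.toEmbedding P) ↔ Γ.IsSubgraph P := by
    rw [IsSubgraph, IsSubgraph, forall_mem_liftFamily, liftFamily_pairwiseDisjoint]
    exact and_congr_left fun _ => forall₂_congr fun X _ => (hi X).symm.isGenerator.symm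
  have hp : (∀ X ∈ liftFamily e.toEmbedding P, ∃ v, v ∉ X) ↔ ∀ X ∈ P, ∃ v, v ∉ X := by
    rw [forall_mem_liftFamily]
    refine forall₂_congr fun X _ => ?_
    rw [← e.exists_congr_right]
    exact exists_congr fun v => not_congr (Finset.mem_map' e.toEmbedding)
  have hc : ∀ ρ, ((liftFamily e.toEmbedding P).filter fun X =>
      ((Γ.relabel e).induce X).HasResidue ρ).card =
      (P.filter fun X => (Γ.induce X).HasResidue ρ).card := fun ρ =>
    card_filter_liftFamily _ _ fun X _ => (hi X).hasResidue ρ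
  constructor
  · intro h
    exact ⟨hg.1 h.gen, hs.1 h.sub, hp.1 h.proper, fun ρ => (hc ρ).symm.trans (h.count ρ),
      hf ▸ h.free⟩
  · intro h
    exact ⟨hg.2 h.gen, hs.2 h.sub, hp.2 h.proper, fun ρ => (hc ρ).trans (h.count ρ),
      hf.symm ▸ h.free⟩

theorem splitTerm_relabel (K : Type*) [Field K] [Finite V] [Finite W] (e : V ≃ W) (Γ : Diagram V)
    (P : Finset (Finset V)) :
    splitTerm K (Γ.relabel e) (liftFamily e.toEmbedding P) = splitTerm K Γ P := by
  rw [splitTerm, splitTerm, (contract_relabel_isomorphic e Γ P).graph_eq K, prod_liftFamily]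
  congr 1
  exact Finset.prod_congr rfl fun X _ => (induce_relabel_isomorphic e Γ X).graph_eq K

theorem map_inr_notMem_liftFamily [Fintype B] [Nonempty B] {P : Finset (Finset A)} :
    Finset.univ.map .inr ∉ liftFamily (.inl : A ↪ A ⊕ B) P := fun h => by
  obtain ⟨X, -, hX⟩ := mem_liftFamily.1 h
  exact map_inl_ne_map_inr X hX

section WithBlock

variable [Fintype B] [DecidableEq (Finset (A ⊕ B))] {P : Finset (Finset A)}

theorem forall_mem_withBlock {p : Finset (A ⊕ B) → Prop} :
    (∀ X ∈ withBlock P, p X) ↔ p (Finset.univ.map .inr) ∧ ∀ X ∈ P, p (X.map .inl) := by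
  rw [withBlock, Finset.forall_mem_insert, forall_mem_liftFamily]

theorem withBlock_injective [Nonempty B] :
    Function.Injective (withBlock : Finset (Finset A) → Finset (Finset (A ⊕ B))) := by
  intro P Q h
  refine liftFamily_injective (.inl : A ↪ A ⊕ B) ?_
  rw [← Finset.erase_insert (map_inr_notMem_liftFamily (P := P)),
    ← Finset.erase_insert (map_inr_notMem_liftFamily (P := Q))]
  exact congrArg (Finset.erase · _) h

theorem withBlock_pairwiseDisjoint :
    ((withBlock P : Finset (Finset (A ⊕ B))) : Set (Finset (A ⊕ B))).PairwiseDisjoint id ↔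
      (P : Set (Finset A)).PairwiseDisjoint id := by
  rw [withBlock, Finset.coe_insert, Set.pairwiseDisjoint_insert, liftFamily_pairwiseDisjoint]
  refine and_iff_left_of_imp fun _ => ?_
  intro Z hZ _
  obtain ⟨X, -, rfl⟩ := mem_liftFamily.1 (Finset.mem_coe.1 hZ)
  rw [Finset.disjoint_left]
  intro w hw hw'
  simp only [id, Finset.mem_map] at hw hw'
  obtain ⟨z, -, rfl⟩ := hw
  obtain ⟨u, -, hu⟩ := hw'
  exact Sum.inl_ne_inr hu

theorem card_uncovered_withBlock :
    Nat.card {w : A ⊕ B // ∀ Y ∈ withBlock P, w ∉ Y} = Nat.card {u : A // ∀ Y ∈ P, u ∉ Y} := by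
  refine (Nat.card_congr (Equiv.ofBijective (fun u => ⟨.inl u.1,
    uncovered_withBlock.2 ⟨u.1, rfl, u.2⟩⟩) ⟨fun u v h => ?_, ?_⟩)).symm
  · exact Subtype.ext (Sum.inl_injective (congrArg Subtype.val h))
  · rintro ⟨w, hw⟩
    obtain ⟨u, rfl, hu⟩ := uncovered_withBlock.1 hw
    exact ⟨⟨u, hu⟩, rfl⟩

theorem card_filter_withBlock [Nonempty B] (p : Finset (A ⊕ B) → Prop) [DecidablePred p]
    (q : Finset A → Prop) [DecidablePred q] (h : ∀ X ∈ P, p (X.map .inl) ↔ q X) :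
    ((withBlock P).filter p).card =
      (P.filter q).card + if p (Finset.univ.map .inr) then 1 else 0 := by
  rw [withBlock, Finset.filter_insert]
  split_ifs with hp
  · rw [Finset.card_insert_of_notMem
      (fun h => map_inr_notMem_liftFamily (Finset.mem_of_mem_filter _ h)),
      card_filter_liftFamily p q h]
  · rw [card_filter_liftFamily p q h, add_zero]

theorem prod_withBlock [Nonempty B] {M : Type*} [CommMonoid M] (g : Finset (A ⊕ B) → M) :
    ∏ X ∈ withBlock P, g X = g (Finset.univ.map .inr) * ∏ X ∈ P, g (X.map .inl) := by
  rw [withBlock, Finset.prod_insert map_inr_notMem_liftFamily, prod_liftFamily]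

/-- A pairwise disjoint family that contains the block `B` has this form. -/
theorem exists_withBlock [Fintype A] {Q : Finset (Finset (A ⊕ B))}
    (hQ : (Q : Set (Finset (A ⊕ B))).PairwiseDisjoint id) (hB : Finset.univ.map .inr ∈ Q) :
    ∃ P : Finset (Finset A), withBlock P = Q := by
  classical
  refine ⟨Finset.univ.filter fun X => X.map .inl ∈ Q, ?_⟩
  ext Z
  rw [mem_withBlock]
  constructor
  · rintro (rfl | ⟨X, hX, rfl⟩)
    · exact hB
    · simpa using hX
  · intro hZ
    by_cases hZB : Z = Finset.univ.map .inr
    · exact .inl hZB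
    right
    have hd := Finset.disjoint_left.1 (hQ (Finset.mem_coe.2 hZ) (Finset.mem_coe.2 hB) hZB)
    have he : (Finset.univ.filter fun u : A => Sum.inl u ∈ Z).map (.inl : A ↪ A ⊕ B) = Z := by
      ext (u | z)
      · simp
      · have : Sum.inr z ∉ Z := fun h => hd h (by simp)
        simp [this]
    exact ⟨_, by simpa [he] using hZ, he⟩

end WithBlock

/-- The counts after adding a component with residue `ρ`. -/
noncomputable def addCount (ν : Residue → ℕ) (ρ : Residue) : Residue → ℕ := open Classical in
  fun σ => ν σ + if ρ = σ then 1 else 0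

/-! ### Removal of a component with two legs -/

/-- The legs of `γ` are a leg of kind `t.bar` at `x` and a leg of kind `t` at `y`. -/
def Diagram.HasTwoLegs (t : Leg) (γ : Diagram B) (x y : B) : Prop :=
  (t.bar, x) ≠ (t, y) ∧ ∀ s z, γ.Pending s z ↔ (s, z) = (t.bar, x) ∨ (s, z) = (t, y)

/-- Graphs with residue `ρ` can be inserted in propagators that start with a half-edge of kind `t`. -/
def Residue.IsOnLine (ρ : Residue) (t : Leg) : Prop :=
  (ρ = .psipsi ∧ t = .out) ∨ (ρ = .phiphi ∧ t = .sca)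

theorem exists_hasTwoLegs [Finite B] {ρ : Residue} {t : Leg} (hρ : ρ.IsOnLine t) {γ : Diagram B}
    (h : γ.IsGeneratorOf ρ) : ∃ x y, γ.HasTwoLegs t x y := by
  rcases hρ with ⟨rfl, rfl⟩ | ⟨rfl, rfl⟩
  · obtain ⟨x, hx⟩ := nLeg_eq_one (h.nLeg .inc)
    obtain ⟨y, hy⟩ := nLeg_eq_one (h.nLeg .out)
    refine ⟨x, y, by simp [Leg.bar], ?_⟩
    rintro (_ | _ | _) z
    · simp [hy, Leg.bar]
    · simp [hx, Leg.bar]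
    · simpa [Leg.bar] using nLeg_eq_zero (h.nLeg .sca) z
  · obtain ⟨x, y, hxy, h'⟩ := nLeg_eq_two (h.nLeg .sca)
    refine ⟨x, y, by simpa [Leg.bar] using hxy, ?_⟩
    rintro (_ | _ | _) z
    · simpa [Leg.bar] using nLeg_eq_zero (h.nLeg .out) z
    · simpa [Leg.bar] using nLeg_eq_zero (h.nLeg .inc) z
    · simp [h', Leg.bar]

theorem Diagram.HasTwoLegs.insertable {γ : Diagram B} {t : Leg} {x y : B}
    (h : γ.HasTwoLegs t x y) (hγ : γ.IsFeynman) {Γ : Diagram A} (hΓ : Γ.IsFeynman) {a b : A}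
    (hab : Γ.link t a b) : Insertable Γ γ t a b x y :=
  ⟨hΓ, hγ, hab, (h.2 _ _).2 (.inl rfl), (h.2 _ _).2 (.inr rfl), h.1⟩

theorem isGeneratorOf_insertTwo_iff [Finite A] [Finite B] {Γ : Diagram A} {γ : Diagram B}
    {t : Leg} {a b : A} {x y : B} (h : Insertable Γ γ t a b x y) (hl : γ.HasTwoLegs t x y)
    (hγ : γ.Solid) {r : Residue} :
    (insertTwo Γ γ t a b x y).IsGeneratorOf r ↔ Γ.IsGeneratorOf r := by
  have hres : (insertTwo Γ γ t a b x y).HasResidue r ↔ Γ.HasResidue r := by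
    simp only [hasResidue_iff, h.nLeg_eq _ fun z => (hl.2 _ z).1]
  rw [isGeneratorOf_iff, isGeneratorOf_iff, hres]
  constructor
  · rintro ⟨-, h₂, h₃, -⟩
    refine ⟨h.left, h.solid_left h₂, h₃, ?_⟩
    rintro rfl hc
    have : Subsingleton A := (Nat.card_eq_one_iff_unique.1 hc).1
    obtain ⟨u, hu⟩ := exists_pending_of_nLeg_pos
      (by rw [hasResidue_iff.1 h₃ t]; exact Nat.one_pos : 0 < Γ.nLeg t)
    exact hu (Subsingleton.elim a u ▸ ⟨b, h.link⟩)
  · rintro ⟨-, h₂, h₃, -⟩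
    refine ⟨h.isFeynman, h.solid hγ h₂, h₃, fun _ hc => ?_⟩
    have hA : Nonempty A := ⟨a⟩
    have hB : Nonempty B := ⟨x⟩
    have := Nat.card_pos (α := A)
    have := Nat.card_pos (α := B)
    rw [Nat.card_sum] at hc
    omega

section InsertTwo

variable [Finite A] [Fintype B] [DecidableEq (Finset (A ⊕ B))] {P : Finset (Finset A)}
  {Γ : Diagram A} {γ : Diagram B} {t : Leg} {a b : A} {x y : B}

/-- The inserted component with two legs changes only its own component count: it is no vertex of the
contracted graph. -/
theorem isDecomposition_insertTwo_iff (h : Insertable Γ γ t a b x y) (hl : γ.HasTwoLegs t x y)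
    {ρ : Residue} (hγ : γ.IsGeneratorOf ρ) (hρ : ρ ≠ .psipsiphi)
    (hab : ∀ X ∈ P, ¬ (a ∈ X ∧ b ∈ X)) {r : Residue} {N : ℕ} {ν : Residue → ℕ} :
    IsDecomposition r N (addCount ν ρ) (insertTwo Γ γ t a b x y) (withBlock P) ↔
      IsDecomposition r N ν Γ P := by
  classical
  have hB : Nonempty B := ⟨x⟩
  have hi := fun X hX => h.induce_isomorphic (hab X hX)
  have hg := isGeneratorOf_insertTwo_iff h hl hγ.solid (r := r)
  have hr₀ := h.induce_map_inr_isomorphic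
  have hs : (insertTwo Γ γ t a b x y).IsSubgraph (withBlock P) ↔ Γ.IsSubgraph P := by
    rw [IsSubgraph, IsSubgraph, forall_mem_withBlock, withBlock_pairwiseDisjoint]
    refine and_congr_left fun _ => (and_iff_right (hr₀.isGenerator.2 hγ.1)).trans ?_
    exact forall₂_congr fun X hX => (hi X hX).isGenerator
  have hp : ∀ X ∈ withBlock (B := B) P, ∃ v, v ∉ X := by
    rw [forall_mem_withBlock]
    exact ⟨⟨.inl a, by simp⟩, fun X _ => ⟨.inr x, by simp⟩⟩
  have hp' : ∀ X ∈ P, ∃ v, v ∉ X := by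
    intro X hX
    by_contra hc
    push Not at hc
    exact hab X hX ⟨hc a, hc b⟩
  have hc : ∀ σ, ((withBlock P).filter fun X =>
      ((insertTwo Γ γ t a b x y).induce X).HasResidue σ).card =
      (P.filter fun X => (Γ.induce X).HasResidue σ).card + if ρ = σ then 1 else 0 := fun σ => by
    rw [card_filter_withBlock _ (fun X => (Γ.induce X).HasResidue σ)
      fun X hX => (hi X hX).hasResidue σ, hr₀.hasResidue]
    exact congrArg _ (if_congr ⟨hγ.2.unique, fun h => h ▸ hγ.2⟩ rfl rfl)
  have hν : addCount ν ρ .psipsiphi = ν .psipsiphi := by simp [addCount, hρ]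
  constructor
  · intro h
    refine ⟨hg.1 h.gen, hs.1 h.sub, hp', fun σ => ?_, ?_⟩
    · have := (hc σ).symm.trans (h.count σ)
      simpa [addCount] using this
    · rw [← h.free, card_uncovered_withBlock, hν]
  · intro h
    refine ⟨hg.2 h.gen, hs.2 h.sub, hp, fun σ => ?_, ?_⟩
    · rw [hc σ, h.count σ, addCount]
    · rw [← h.free, card_uncovered_withBlock, hν]

theorem splitTerm_insertTwo (K : Type*) [Field K] (h : Insertable Γ γ t a b x y)
    (hγ : ¬ γ.HasResidue .psipsiphi) (hP : (P : Set (Finset A)).PairwiseDisjoint id)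
    (hab : ∀ X ∈ P, ¬ (a ∈ X ∧ b ∈ X)) (hne : a ≠ b) :
    splitTerm K (insertTwo Γ γ t a b x y) (withBlock P) =
      (graph K γ ⊗ₜ[K] 1) * splitTerm K Γ P := by
  have hB : Nonempty B := ⟨x⟩
  rw [splitTerm, splitTerm, Algebra.TensorProduct.tmul_mul_tmul, one_mul, prod_withBlock,
    (h.contract_isomorphic hγ hP hab hne).graph_eq K, h.induce_map_inr_isomorphic.graph_eq K]
  congr 2
  exact Finset.prod_congr rfl fun X hX => (h.induce_isomorphic (hab X hX)).graph_eq K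

end InsertTwo

/-- A graph with residue `ψ̄ψ`, `φφ` or `ψ̄ψφ` has at most three legs. -/
theorem Diagram.HasResidue.not_four [Finite V] {Γ : Diagram V} {r : Residue} (h : Γ.HasResidue r)
    {p : Fin 4 → Leg × V} (hp : Function.Injective p) : ∃ i, ¬ Γ.Pending (p i).1 (p i).2 := by
  by_contra hc
  push Not at hc
  have h₁ := hasResidue_iff.1 h
  let f : Fin 4 → ({u : V // Γ.Pending .out u} ⊕ {u : V // Γ.Pending .inc u}) ⊕
      {u : V // Γ.Pending .sca u} := fun i =>
    match h : p i with
    | (.out, u) => .inl (.inl ⟨u, by simpa [h] using hc i⟩)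
    | (.inc, u) => .inl (.inr ⟨u, by simpa [h] using hc i⟩)
    | (.sca, u) => .inr ⟨u, by simpa [h] using hc i⟩
  let g : ({u : V // Γ.Pending .out u} ⊕ {u : V // Γ.Pending .inc u}) ⊕
      {u : V // Γ.Pending .sca u} → Leg × V :=
    Sum.elim (Sum.elim (fun u => (.out, u.1)) fun u => (.inc, u.1)) fun u => (.sca, u.1)
  have hgf : ∀ i, g (f i) = p i := by
    intro i
    simp only [f]
    split <;> rename_i h <;> exact h.symm
  have hf : Function.Injective f := fun i j hij => hp (by rw [← hgf, ← hgf, hij])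
  have := Nat.card_le_card_of_injective f hf
  rw [Nat.card_sum, Nat.card_sum] at this
  change Nat.card (Fin 4) ≤ Γ.nLeg .out + Γ.nLeg .inc + Γ.nLeg .sca at this
  rw [h₁, h₁, h₁, Nat.card_fin] at this
  cases r <;> simp [Residue.legs] at this

section InsertTwo

variable [Fintype A] [Fintype B]

/-- In a generator, the two legs of a component are not joined to the same block: this block and the
component would have at most one leg in common. -/
theorem not_both_ends_mem {Δ : Diagram (A ⊕ B)} {r : Residue} (hΔ : Δ.IsGeneratorOf r) {t : Leg}
    {a b : A} {x y : B} (ha : Δ.link t (.inl a) (.inr x)) (hb : Δ.link t.bar (.inl b) (.inr y))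
    (hab : (t, a) ≠ (t.bar, b)) (hl : (Δ.comap .inr).HasTwoLegs t x y) {X : Finset A}
    (hX : (Δ.induce (X.map .inl)).IsGenerator) : ¬ (a ∈ X ∧ b ∈ X) := by
  rintro ⟨haX, hbX⟩
  obtain ⟨r', hr'⟩ := hX.exists_isGeneratorOf
  have hF := hΔ.isFeynman
  have ha' := hF.link_symm ha
  have hb' : Δ.link t (.inr y) (.inl b) := by simpa using hF.link_symm hb
  let S : Set (A ⊕ B) := {w | ∀ u, w = .inl u → u ∈ X}
  obtain ⟨p, q, hpq, hp, hq⟩ := hΔ.two_legs (S := S) ⟨.inl a, by rintro u ⟨⟩; exact haX⟩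
  have key : ∀ p : Leg × (A ⊕ B), (p.2 ∈ S ∧ ∀ v ∈ S, ¬ Δ.link p.1 p.2 v) →
      ∃ u ∈ X, p.2 = .inl u ∧ (p.1, u) ≠ (t, a) ∧ (p.1, u) ≠ (t.bar, b) := by
    rintro ⟨s, u | z⟩ ⟨hu, hn⟩
    · refine ⟨u, hu u rfl, rfl, ?_, ?_⟩
      · rintro ⟨⟩
        exact hn (.inr x) (by rintro _ ⟨⟩) ha
      · rintro ⟨⟩
        exact hn (.inr y) (by rintro _ ⟨⟩) hb
    · have hz : (Δ.comap .inr).Pending s z := fun ⟨v, hv⟩ =>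
        hn (.inr v) (by rintro _ ⟨⟩) (link_comap.1 hv)
      rcases (hl.2 s z).1 hz with h | h <;> obtain ⟨rfl, rfl⟩ := Prod.mk.inj h
      · exact absurd ha' (hn (.inl a) (by rintro u ⟨⟩; exact haX))
      · exact absurd hb' (hn (.inl b) (by rintro u ⟨⟩; exact hbX))
  obtain ⟨u, hu, hpu, hp₁, hp₂⟩ := key p hp
  obtain ⟨v, hv, hqv, hq₁, hq₂⟩ := key q hq
  have hmem : ∀ {u}, u ∈ X → Sum.inl u ∈ X.map (.inl : A ↪ A ⊕ B) := fun h =>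
    Finset.mem_map_of_mem .inl h
  let f : Fin 4 → Leg × {w // w ∈ X.map (.inl : A ↪ A ⊕ B)} :=
    ![(t, ⟨_, hmem haX⟩), (t.bar, ⟨_, hmem hbX⟩), (p.1, ⟨_, hmem hu⟩), (q.1, ⟨_, hmem hv⟩)]
  have hf : Function.Injective f := by
    have hpq' : (p.1, u) ≠ (q.1, v) := by
      intro h
      obtain ⟨h₁, h₂⟩ := Prod.mk.inj h
      exact hpq (Prod.ext h₁ (by rw [hpu, hqv, h₂]))
    simp only [ne_eq, Prod.mk.injEq] at hab hp₁ hp₂ hq₁ hq₂ hpq'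
    intro i j hij
    fin_cases i <;> fin_cases j <;> first | rfl | (simp [f] at hij; grind)
  obtain ⟨i, hi⟩ := hr'.2.not_four hf
  refine hi ?_
  rintro ⟨w, hw⟩
  rw [link_induce] at hw
  have hwX := w.2
  have hS : ∀ w : {w // w ∈ X.map (.inl : A ↪ A ⊕ B)}, w.1 ∈ S := by
    rintro ⟨w, hw⟩ u hwu
    obtain rfl : w = .inl u := hwu
    simpa using hw
  fin_cases i
  · rw [← hF.link_unique ha hw] at hwX
    simp at hwX
  · rw [← hF.link_unique hb hw] at hwX
    simp at hwX
  · exact hp.2 w (hS w) (by simpa [f, hpu] using hw)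
  · exact hq.2 w (hS w) (by simpa [f, hqv] using hw)

/-- Every component with two legs can be removed. -/
theorem IsDecomposition.exists_insertTwo [DecidableEq (Finset (A ⊕ B))] {Δ : Diagram (A ⊕ B)} {Q : Finset (Finset (A ⊕ B))}
    {r : Residue} {N : ℕ} {ν : Residue → ℕ} (h : IsDecomposition r N ν Δ Q) {t : Leg}
    (hB : Finset.univ.map .inr ∈ Q) {x y : B} (hl : (Δ.comap .inr).HasTwoLegs t x y) :
    ∃ (Γ : Diagram A) (P : Finset (Finset A)) (a b : A), Insertable Γ (Δ.comap .inr) t a b x y ∧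
      insertTwo Γ (Δ.comap .inr) t a b x y = Δ ∧ withBlock P = Q ∧
      ∀ X ∈ P, ¬ (a ∈ X ∧ b ∈ X) := by
  have hF := h.gen.isFeynman
  obtain ⟨v, hv⟩ := h.proper _ hB
  obtain ⟨⟨s, w⟩, ⟨s', w'⟩, hpq, hp, hq⟩ := h.gen.solid.2 (Set.range (.inr : B → A ⊕ B))
    ⟨_, x, rfl⟩ (fun hu => hv (by simpa using (hu ▸ Set.mem_univ v : v ∈ Set.range Sum.inr)))
  have key : ∀ s w, Δ.Cross (Set.range Sum.inr) (s, w) → ∃ z u, w = .inr z ∧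
      Δ.link s (.inr z) (.inl u) ∧ ((s, z) = (t.bar, x) ∨ (s, z) = (t, y)) := by
    rintro s w ⟨⟨z, rfl⟩, u | z', hu, hsu⟩
    · exact ⟨z, u, rfl, hsu, (hl.2 s z).1 fun ⟨z', hz'⟩ =>
        Sum.inl_ne_inr (hF.link_unique hsu (link_comap.1 hz'))⟩
    · exact absurd ⟨z', rfl⟩ hu
  obtain ⟨a, b, hxa, hyb⟩ : ∃ a b, Δ.link t.bar (.inr x) (.inl a) ∧
      Δ.link t (.inr y) (.inl b) := by
    obtain ⟨z, u, rfl, hu, hz⟩ := key _ _ hp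
    obtain ⟨z', u', rfl, hu', hz'⟩ := key _ _ hq
    rcases hz with hz | hz <;> rcases hz' with hz' | hz' <;>
      obtain ⟨rfl, rfl⟩ := Prod.mk.inj hz <;> obtain ⟨h₁, rfl⟩ := Prod.mk.inj hz'
    · exact absurd (by rw [h₁]) hpq
    · exact ⟨u, u', hu, h₁ ▸ hu'⟩
    · exact ⟨u', u, h₁ ▸ hu', hu⟩
    · exact absurd (by rw [h₁]) hpq
  have hax : Δ.link t (.inl a) (.inr x) := by simpa using hF.link_symm hxa
  have hby := hF.link_symm hyb
  have hab : (t, a) ≠ (t.bar, b) := by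
    intro he
    obtain ⟨h₁, rfl⟩ := Prod.mk.inj he
    exact hl.1 (Prod.ext h₁.symm (Sum.inr_injective (hF.link_unique hax (h₁.symm ▸ hby))))
  obtain ⟨Γ, hI, hΔ⟩ := Diagram.exists_insertTwo hF hxa hyb hl.1 hab fun s z u hu => (hl.2 s z).1
    fun ⟨z', hz'⟩ => Sum.inl_ne_inr (hF.link_unique hu (link_comap.1 hz'))
  obtain ⟨P, rfl⟩ := exists_withBlock h.sub.2 hB
  exact ⟨Γ, P, a, b, hI, hΔ, rfl, fun X hX => not_both_ends_mem h.gen hax hby hab hl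
    (h.sub.1 _ (mem_withBlock.2 (.inr ⟨X, hX, rfl⟩)))⟩

end InsertTwo

/-! ### Removal of a component with three legs -/

/-- Each of the legs of `γ`, one of each kind, is at the vertex given by `l`. -/
def Diagram.HasThreeLegs (γ : Diagram B) (l : Leg → B) : Prop := ∀ s z, γ.Pending s z ↔ z = l s

theorem exists_hasThreeLegs {γ : Diagram B} (h : γ.IsGeneratorOf .psipsiphi) :
    ∃ l, γ.HasThreeLegs l := by
  choose l hl using fun s => nLeg_eq_one (h.nLeg s)
  exact ⟨l, fun s z => hl s z⟩

section InsertVertex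

variable [Fintype A] {P : Finset (Finset A)} {Γ : Diagram (Option A)} {γ : Diagram B} {l : Leg → B}

theorem Diagram.Substitutable.nonempty (h : Substitutable Γ γ l) {r : Residue}
    (hΓ : Γ.IsGeneratorOf r) : Nonempty A := by
  by_contra hA
  rw [not_nonempty_iff] at hA
  have hp : ∀ s, Γ.nLeg s = 1 := fun s => by
    rw [nLeg, Nat.card_eq_one_iff_unique]
    refine ⟨⟨fun u v => Subtype.ext (Subsingleton.elim _ _)⟩, ⟨⟨none, ?_⟩⟩⟩
    rintro ⟨_ | v, hv⟩
    · exact h.not_link s hv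
    · exact hA.elim v
  have hr : Γ.HasResidue .psipsiphi := hasResidue_iff.2 fun s => hp s
  exact (isGeneratorOf_iff.1 hΓ).2.2.2 (hΓ.2.unique hr) (by simp)

theorem isGeneratorOf_insertVertex_iff [Finite B] [Nonempty A] (h : Substitutable Γ γ l) (hγ : γ.Solid)
    {r : Residue} : (insertVertex Γ γ l).IsGeneratorOf r ↔ Γ.IsGeneratorOf r := by
  have hres : (insertVertex Γ γ l).HasResidue r ↔ Γ.HasResidue r := by
    simp only [hasResidue_iff, h.nLeg_eq]
  have hB : Nonempty B := ⟨l .sca⟩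
  have hA := Nat.card_pos (α := A)
  have hB := Nat.card_pos (α := B)
  rw [isGeneratorOf_iff, isGeneratorOf_iff, hres]
  constructor
  · rintro ⟨-, h₂, h₃, -⟩
    refine ⟨h.left, h.solid_left h₂, h₃, fun _ hc => ?_⟩
    rw [Finite.card_option] at hc
    omega
  · rintro ⟨-, h₂, h₃, -⟩
    refine ⟨h.isFeynman, h.solid hγ h₂, h₃, fun _ hc => ?_⟩
    rw [Nat.card_sum] at hc
    omega

theorem card_uncovered_liftFamily_some :
    Nat.card {o : Option A // ∀ Y ∈ liftFamily .some P, o ∉ Y} =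
      Nat.card {u : A // ∀ Y ∈ P, u ∉ Y} + 1 := by
  rw [← Finite.card_option]
  refine (Nat.card_congr (Equiv.ofBijective (fun o : Option {u : A // ∀ Y ∈ P, u ∉ Y} =>
    (⟨o.map Subtype.val, uncovered_liftFamily_some.2 ?_⟩ :
      {o : Option A // ∀ Y ∈ liftFamily .some P, o ∉ Y})) ⟨fun u v h => ?_, ?_⟩)).symm
  · rcases o with _ | ⟨u, hu⟩
    · exact .inl rfl
    · exact .inr ⟨u, rfl, hu⟩
  · exact Option.map_injective Subtype.val_injective (congrArg Subtype.val h)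
  · rintro ⟨o, ho⟩
    rcases uncovered_liftFamily_some.1 ho with rfl | ⟨u, rfl, hu⟩
    · exact ⟨none, rfl⟩
    · exact ⟨some ⟨u, hu⟩, rfl⟩

/-- The inserted component with three legs takes the place of an uncovered vertex, so that the number of
vertices of the contracted graph is unchanged. -/
theorem isDecomposition_insertVertex_iff [Fintype B] [DecidableEq (Finset (A ⊕ B))]
    (h : Substitutable Γ γ l)
    (hγ : γ.IsGeneratorOf .psipsiphi) {r : Residue} {N : ℕ} {ν : Residue → ℕ} :
    IsDecomposition r N (addCount ν .psipsiphi) (insertVertex Γ γ l) (withBlock P) ↔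
      IsDecomposition r N ν Γ (liftFamily .some P) := by
  classical
  have hB : Nonempty B := ⟨l .sca⟩
  have hi := h.induce_isomorphic
  have hr₀ := h.induce_map_inr_isomorphic
  have hg : Nonempty A → ((insertVertex Γ γ l).IsGeneratorOf r ↔ Γ.IsGeneratorOf r) :=
    fun _ => isGeneratorOf_insertVertex_iff h hγ.solid
  have hs : (insertVertex Γ γ l).IsSubgraph (withBlock P) ↔ Γ.IsSubgraph (liftFamily .some P) := by
    rw [IsSubgraph, IsSubgraph, forall_mem_withBlock, withBlock_pairwiseDisjoint,
      forall_mem_liftFamily, liftFamily_pairwiseDisjoint]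
    refine and_congr_left fun _ => (and_iff_right (hr₀.isGenerator.2 hγ.1)).trans ?_
    exact forall₂_congr fun X hX => (hi X).isGenerator
  have hp' : ∀ X ∈ liftFamily .some P, ∃ v : Option A, v ∉ X := by
    rw [forall_mem_liftFamily]
    exact fun X hX => ⟨none, by simp⟩
  have hc : ∀ σ, ((withBlock P).filter fun X =>
      ((insertVertex Γ γ l).induce X).HasResidue σ).card =
      ((liftFamily .some P).filter fun X => (Γ.induce X).HasResidue σ).card +
        if .psipsiphi = σ then 1 else 0 := fun σ => by
    rw [card_filter_withBlock _ (fun X => (Γ.induce (X.map .some)).HasResidue σ)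
      fun X hX => (hi X).hasResidue σ, hr₀.hasResidue,
      card_filter_liftFamily (i := .some) _ (fun X => (Γ.induce (X.map .some)).HasResidue σ)
        fun X _ => Iff.rfl]
    exact congrArg _ (if_congr ⟨hγ.2.unique, fun h => h ▸ hγ.2⟩ rfl rfl)
  have hν : addCount ν .psipsiphi .psipsiphi = ν .psipsiphi + 1 := by simp [addCount]
  constructor
  · intro h'
    have hA : Nonempty A := by
      obtain ⟨u | z, hu⟩ := h'.proper _ (mem_withBlock.2 (.inl rfl))
      · exact ⟨u⟩
      · simp at hu
    refine ⟨(hg hA).1 h'.gen, hs.1 h'.sub, hp', fun σ => ?_, ?_⟩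
    · have := (hc σ).symm.trans (h'.count σ)
      simpa [addCount] using this
    · rw [← h'.free, card_uncovered_withBlock, hν, card_uncovered_liftFamily_some]
      ring
  · intro h'
    have hA : Nonempty A := h.nonempty h'.gen
    refine ⟨(hg hA).2 h'.gen, hs.2 h'.sub, ?_, fun σ => ?_, ?_⟩
    · rw [forall_mem_withBlock]
      exact ⟨hA.elim fun a => ⟨.inl a, by simp⟩, fun X _ => ⟨.inr (l .sca), by simp⟩⟩
    · rw [hc σ, h'.count σ, addCount]
    · rw [← h'.free, card_uncovered_withBlock, hν, card_uncovered_liftFamily_some]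
      ring

theorem splitTerm_insertVertex (K : Type*) [Field K] [Fintype B]
    [DecidableEq (Finset (A ⊕ B))] (h : Substitutable Γ γ l)
    (hγ : γ.HasResidue .psipsiphi) :
    splitTerm K (insertVertex Γ γ l) (withBlock P) =
      (graph K γ ⊗ₜ[K] 1) * splitTerm K Γ (liftFamily .some P) := by
  have hB : Nonempty B := ⟨l .sca⟩
  rw [splitTerm, splitTerm, Algebra.TensorProduct.tmul_mul_tmul, one_mul, prod_withBlock,
    (h.contract_isomorphic hγ).graph_eq K, h.induce_map_inr_isomorphic.graph_eq K, prod_liftFamily]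
  congr 2
  exact Finset.prod_congr rfl fun X hX => (h.induce_isomorphic X).graph_eq K

end InsertVertex

/-! ### Propagators outside of a subgraph -/

/-- The number of propagators that start with a half-edge of kind `t` and do not belong to a
component of `P`. -/
noncomputable def nPlaces (Γ : Diagram V) (P : Finset (Finset V)) (t : Leg) : ℕ :=
  Nat.card {e : V × V // Γ.link t e.1 e.2 ∧ ∀ X ∈ P, ¬ (e.1 ∈ X ∧ e.2 ∈ X)}

/-- Half-edges that are not joined to another one in the same component are counted in two ways: by
the propagators outside of the subgraph and the external legs, and by the components. -/
theorem IsDecomposition.nPlaces_add [Finite V] {Γ : Diagram V} {P : Finset (Finset V)} {r : Residue}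
    {N : ℕ} {ν : Residue → ℕ} (h : IsDecomposition r N ν Γ P) (t : Leg) :
    nPlaces Γ P t + r.legs t + ν .psipsiphi = N + (ν .psipsi * Residue.legs .psipsi t +
      ν .phiphi * Residue.legs .phiphi t + ν .psipsiphi * Residue.legs .psipsiphi t) := by
  classical
  have hF := h.gen.isFeynman
  let U := {u : V // ¬ ∃ v, Γ.link t u v ∧ ∃ X ∈ P, u ∈ X ∧ v ∈ X}
  have h₁ : Nat.card U = nPlaces Γ P t + r.legs t := by
    rw [← h.gen.nLeg t, nPlaces, nLeg, ← Nat.card_sum]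
    refine (Nat.card_congr (Equiv.ofBijective (Sum.elim
      (fun e => (⟨e.1.1, ?_⟩ : U)) (fun u => ⟨u.1, ?_⟩)) ⟨?_, ?_⟩)).symm
    · rintro ⟨v, hv, X, hX, hu, hvX⟩
      obtain rfl := hF.link_unique hv e.2.1
      exact e.2.2 X hX ⟨hu, hvX⟩
    · exact fun ⟨v, hv, _⟩ => u.2 ⟨v, hv⟩
    · rintro (⟨⟨u, v⟩, he⟩ | ⟨u, hu⟩) (⟨⟨u', v'⟩, he'⟩ | ⟨u', hu'⟩) huu <;>
        obtain rfl : u = u' := congrArg Subtype.val huu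
      · obtain rfl := hF.link_unique he.1 he'.1
        rfl
      · exact absurd ⟨_, he.1⟩ hu'
      · exact absurd ⟨_, he'.1⟩ hu
      · rfl
    · rintro ⟨u, hu⟩
      by_cases hp : ∃ v, Γ.link t u v
      · obtain ⟨v, hv⟩ := hp
        exact ⟨.inl ⟨(u, v), hv, fun X hX huv => hu ⟨v, hv, X, hX, huv⟩⟩, rfl⟩
      · exact ⟨.inr ⟨u, hp⟩, rfl⟩
  have h₂ : Nat.card U = Nat.card {v : V // ∀ X ∈ P, v ∉ X} +
      ∑ X ∈ P, (Γ.induce X).nLeg t := by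
    rw [← Finset.sum_coe_sort P fun X => (Γ.induce X).nLeg t]
    simp only [nLeg]
    rw [← Nat.card_sigma, ← Nat.card_sum]
    refine (Nat.card_congr (Equiv.ofBijective (Sum.elim
      (fun u => (⟨u.1, ?_⟩ : U)) (fun u => ⟨u.2.1, ?_⟩)) ⟨?_, ?_⟩)).symm
    · exact fun ⟨v, hv, X, hX, hu, _⟩ => u.2 X hX hu
    · rintro ⟨v, hv, X, hX, hu, hvX⟩
      have hXu : X = u.1.1 := by
        by_contra hne
        exact Finset.disjoint_left.1 (h.sub.2 hX u.1.2 hne) hu u.2.1.2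
      subst hXu
      exact u.2.2 ⟨⟨v, hvX⟩, link_induce.2 hv⟩
    · rintro (⟨u, hu⟩ | ⟨⟨X, hX⟩, ⟨u, huX⟩, hu⟩) (⟨u', hu'⟩ | ⟨⟨X', hX'⟩, ⟨u', huX'⟩, hu'⟩) huu <;>
        obtain rfl : u = u' := congrArg Subtype.val huu
      · rfl
      · exact absurd huX' (hu X' hX')
      · exact absurd huX (hu' X hX)
      · have : X = X' := by
          by_contra hne
          exact Finset.disjoint_left.1 (h.sub.2 hX hX' hne) huX huX'
        subst this
        rfl
    · rintro ⟨u, hu⟩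
      by_cases hc : ∀ X ∈ P, u ∉ X
      · exact ⟨.inl ⟨u, hc⟩, rfl⟩
      · push Not at hc
        obtain ⟨X, hX, huX⟩ := hc
        refine ⟨.inr ⟨⟨X, hX⟩, ⟨u, huX⟩, ?_⟩, rfl⟩
        rintro ⟨v, hv⟩
        exact hu ⟨v, link_induce.1 hv, X, hX, huX, v.2⟩
  have h₃ : ∑ X ∈ P, (Γ.induce X).nLeg t = ν .psipsi * Residue.legs .psipsi t +
      ν .phiphi * Residue.legs .phiphi t + ν .psipsiphi * Residue.legs .psipsiphi t := by
    have : ∀ X ∈ P, (Γ.induce X).nLeg t =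
        (if (Γ.induce X).HasResidue .psipsi then Residue.legs .psipsi t else 0) +
        (if (Γ.induce X).HasResidue .phiphi then Residue.legs .phiphi t else 0) +
        (if (Γ.induce X).HasResidue .psipsiphi then Residue.legs .psipsiphi t else 0) := by
      intro X hX
      obtain ⟨ρ, hρ⟩ := (h.sub.1 X hX).exists_isGeneratorOf
      have hu : ∀ σ, (Γ.induce X).HasResidue σ ↔ ρ = σ := fun σ =>
        ⟨hρ.2.unique, fun h => h ▸ hρ.2⟩
      rw [hρ.nLeg]
      simp only [hu]
      cases ρ <;> simp
    rw [Finset.sum_congr rfl this, Finset.sum_add_distrib, Finset.sum_add_distrib,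
      ← Finset.sum_filter, ← Finset.sum_filter, ← Finset.sum_filter, Finset.sum_const,
      Finset.sum_const, Finset.sum_const, smul_eq_mul, smul_eq_mul, smul_eq_mul]
    rw [← h.count .psipsi, ← h.count .phiphi, ← h.count .psipsiphi]
  rw [← h₁, h₂, h₃, ← h.free]
  ring

end

/-! ### Recursions for the sums over subgraphs -/

section


variable {V W A B : Type}

noncomputable instance [Finite V] (p : Diagram V × Finset (Finset V) → Prop) :
    Fintype {x : Diagram V × Finset (Finset V) // p x} := by
  have := Fintype.ofFinite V
  exact Fintype.ofFinite _

/-- Generators on the vertex set `V` with a marked subgraph. -/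
abbrev Decomposition (r : Residue) (N : ℕ) (ν : Residue → ℕ) (V : Type) : Type :=
  {x : Diagram V × Finset (Finset V) // IsDecomposition r N ν x.1 x.2}

/-- Transport of decompositions along a bijection. -/
noncomputable def decompositionEquiv [Finite V] (e : V ≃ W) (r : Residue) (N : ℕ)
    (ν : Residue → ℕ) : Decomposition r N ν V ≃ Decomposition r N ν W :=
  Equiv.ofBijective (fun x => ⟨(x.1.1.relabel e, liftFamily e.toEmbedding x.1.2),
    (isDecomposition_relabel e).2 x.2⟩) (by
    constructor
    · rintro ⟨⟨Γ, P⟩, h⟩ ⟨⟨Γ', P'⟩, h'⟩ he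
      obtain ⟨h₁, h₂⟩ := Prod.mk.inj (congrArg Subtype.val he)
      obtain rfl := (relabelEquiv e).injective h₁
      obtain rfl := liftFamily_injective _ h₂
      rfl
    · rintro ⟨⟨Γ, P⟩, h⟩
      obtain ⟨Γ, rfl⟩ := (relabelEquiv e).surjective Γ
      have hP : liftFamily e.toEmbedding (liftFamily e.symm.toEmbedding P) = P := by
        ext Z
        simp only [mem_liftFamily]
        constructor
        · rintro ⟨_, ⟨Y, hY, rfl⟩, rfl⟩
          simpa [Finset.map_map] using hY
        · exact fun hZ => ⟨_, ⟨Z, hZ, rfl⟩, by simp [Finset.map_map]⟩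
      refine ⟨⟨(Γ, liftFamily e.symm.toEmbedding P), (isDecomposition_relabel e).1 ?_⟩, ?_⟩
      · rw [hP]
        exact h
      · exact Subtype.ext (Prod.ext rfl hP))

theorem coe_decompositionEquiv [Finite V] (e : V ≃ W) {r : Residue} {N : ℕ} {ν : Residue → ℕ}
    (x : Decomposition r N ν V) : (decompositionEquiv e r N ν x).1 =
      (x.1.1.relabel e, liftFamily e.toEmbedding x.1.2) := rfl

section

variable (K : Type*) [Field K] (r : Residue) (N : ℕ) (ν : Residue → ℕ)

/-- The sum of the contributions of all decompositions. -/
noncomputable def splitSum (V : Type) [Finite V] : H K ⊗[K] H K :=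
  ∑ x : Decomposition r N ν V, splitTerm K x.1.1 x.1.2

theorem splitSum_congr [Finite V] [Finite W] (e : V ≃ W) :
    splitSum K r N ν V = splitSum K r N ν W :=
  Fintype.sum_equiv (decompositionEquiv e r N ν) _ _ fun x =>
    (splitTerm_relabel K e x.1.1 x.1.2).symm

open Classical in
/-- The sum over the decompositions of which `B` is a component with residue `ρ`. -/
noncomputable def markedSum (ρ : Residue) (A B : Type) [Finite A] [Finite B] : H K ⊗[K] H K :=
  letI := Fintype.ofFinite B
  ∑ x : Decomposition r N ν (A ⊕ B), if Finset.univ.map .inr ∈ x.1.2 ∧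
    (x.1.1.induce (Finset.univ.map .inr)).HasResidue ρ then splitTerm K x.1.1 x.1.2 else 0

open Classical in
theorem sum_splitTerm_marked [Fintype V] (ρ : Residue) (X : Finset V) :
    (∑ x : Decomposition r N ν V, if X ∈ x.1.2 ∧ (x.1.1.induce X).HasResidue ρ then
      splitTerm K x.1.1 x.1.2 else 0) = markedSum K r N ν ρ {v // v ∉ X} {v // v ∈ X} := by
  let _ := Fintype.ofFinite {v // v ∈ X}
  let e : V ≃ {v // v ∉ X} ⊕ {v // v ∈ X} :=
    (Equiv.sumCompl (· ∈ X)).symm.trans (Equiv.sumComm _ _)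
  have he : X.map e.toEmbedding = Finset.univ.map .inr := by
    ext w
    rw [Finset.mem_map_equiv]
    rcases w with ⟨u, hu⟩ | ⟨u, hu⟩
    · simpa [e] using hu
    · simpa [e] using hu
  refine Fintype.sum_equiv (decompositionEquiv e r N ν) _ _ fun x => ?_
  rw [coe_decompositionEquiv, splitTerm_relabel]
  have hiff : (X ∈ x.1.2 ∧ (x.1.1.induce X).HasResidue ρ) ↔
      Finset.univ.map .inr ∈ liftFamily e.toEmbedding x.1.2 ∧
        ((x.1.1.relabel e).induce (Finset.univ.map .inr)).HasResidue ρ := by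
    rw [← he, map_mem_liftFamily, (induce_relabel_isomorphic e x.1.1 X).hasResidue]
  by_cases h : X ∈ x.1.2 ∧ (x.1.1.induce X).HasResidue ρ
  · rw [if_pos h, if_pos (hiff.1 h)]
  · rw [if_neg h, if_neg (hiff.not.1 h)]

/-- Marking one of the components with residue `ρ`. -/
theorem smul_splitSum_addCount [Fintype V] (ρ : Residue) :
    ((ν ρ + 1 : ℕ) : K) • splitSum K r N (addCount ν ρ) V =
      ∑ X : Finset V, markedSum K r N (addCount ν ρ) ρ {v // v ∉ X} {v // v ∈ X} := by
  classical
  simp only [← sum_splitTerm_marked]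
  rw [splitSum, Finset.smul_sum, Finset.sum_comm]
  refine Finset.sum_congr rfl fun x _ => ?_
  have h := x.2.count ρ
  rw [← Finset.sum_filter, Finset.sum_const, Nat.cast_smul_eq_nsmul]
  congr 1
  simp only [addCount, if_true] at h
  rw [← h]
  congr 1
  ext X
  simp

variable {r N ν}

/-- Summation over the ways to insert a component with two legs. -/
theorem markedSum_two [Finite A] [Finite B] {ρ : Residue} {t : Leg} (hρ : ρ.IsOnLine t) :
    markedSum K r N (addCount ν ρ) ρ A B =
      ((∑ γ : {γ : Diagram B // γ.IsGeneratorOf ρ}, graph K γ.1) ⊗ₜ[K] 1) *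
        (((N : K) + ρ.legs t * ν ρ - r.legs t) • splitSum K r N ν A) := by
  classical
  let _ := Fintype.ofFinite A
  let _ := Fintype.ofFinite B
  have hρ' : ρ ≠ .psipsiphi := by
    rintro rfl
    rcases hρ with ⟨h, -⟩ | ⟨h, -⟩ <;> exact Residue.noConfusion h
  have hcount : ∀ x : Decomposition r N ν A, (nPlaces x.1.1 x.1.2 t : K) =
      (N : K) + ρ.legs t * ν ρ - r.legs t := by
    intro x
    have h := congrArg (Nat.cast (R := K)) (x.2.nPlaces_add t)
    push_cast at h
    rcases hρ with ⟨rfl, rfl⟩ | ⟨rfl, rfl⟩ <;> simp only [Residue.legs] at h ⊢ <;>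
      push_cast at h ⊢ <;> linear_combination h
  choose x y hl using fun γ : {γ : Diagram B // γ.IsGeneratorOf ρ} => exists_hasTwoLegs hρ γ.2
  rw [markedSum, ← Finset.sum_filter]
  have hleft : ((∑ γ : {γ : Diagram B // γ.IsGeneratorOf ρ}, graph K γ.1) ⊗ₜ[K] (1 : H K)) *
      (((N : K) + ρ.legs t * ν ρ - r.legs t) • splitSum K r N ν A) =
      ∑ q ∈ (Finset.univ : Finset {γ : Diagram B // γ.IsGeneratorOf ρ}) ×ˢ
        (Finset.univ : Finset (Decomposition r N ν A)).sigma fun d =>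
          (Finset.univ : Finset (A × A)).filter fun e => d.1.1.link t e.1 e.2 ∧
            ∀ X ∈ d.1.2, ¬ (e.1 ∈ X ∧ e.2 ∈ X),
        (graph K q.1.1 ⊗ₜ[K] 1) * splitTerm K q.2.1.1.1 q.2.1.1.2 := by
    rw [Finset.sum_product, TensorProduct.sum_tmul, Finset.sum_mul]
    refine Finset.sum_congr rfl fun γ _ => ?_
    rw [Finset.sum_sigma, splitSum, Finset.smul_sum, Finset.mul_sum]
    refine Finset.sum_congr rfl fun d _ => ?_
    dsimp only
    rw [Finset.sum_const, ← hcount d, Nat.cast_smul_eq_nsmul, nPlaces, Nat.card_eq_fintype_card,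
      Fintype.card_subtype, mul_smul_comm]
  rw [hleft]
  symm
  have hins : ∀ (γ : {γ : Diagram B // γ.IsGeneratorOf ρ}) (d : Decomposition r N ν A) (e : A × A),
      d.1.1.link t e.1 e.2 → Insertable d.1.1 γ.1 t e.1 e.2 (x γ) (y γ) := fun γ d e he =>
    (hl γ).insertable γ.2.isFeynman d.2.gen.isFeynman he
  have hmem : ∀ q : {γ : Diagram B // γ.IsGeneratorOf ρ} × Σ _ : Decomposition r N ν A, A × A,
      q ∈ (Finset.univ : Finset {γ : Diagram B // γ.IsGeneratorOf ρ}) ×ˢ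
        (Finset.univ : Finset (Decomposition r N ν A)).sigma (fun d =>
          (Finset.univ : Finset (A × A)).filter fun e => d.1.1.link t e.1 e.2 ∧
            ∀ X ∈ d.1.2, ¬ (e.1 ∈ X ∧ e.2 ∈ X)) ↔
      q.2.1.1.1.link t q.2.2.1 q.2.2.2 ∧ ∀ X ∈ q.2.1.1.2, ¬ (q.2.2.1 ∈ X ∧ q.2.2.2 ∈ X) :=
    fun q => by simp
  refine Finset.sum_bij (fun q hq => ⟨(insertTwo q.2.1.1.1 q.1.1 t q.2.2.1 q.2.2.2
    (x q.1) (y q.1), withBlock q.2.1.1.2), (isDecomposition_insertTwo_iff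
      (hins _ _ _ ((hmem q).1 hq).1) (hl q.1) q.1.2 hρ' ((hmem q).1 hq).2).2 q.2.1.2⟩)
    ?_ ?_ ?_ ?_
  · intro q hq
    rw [Finset.mem_filter]
    exact ⟨Finset.mem_univ _, mem_withBlock.2 (.inl rfl),
      ((hins _ _ _ ((hmem q).1 hq).1).induce_map_inr_isomorphic.hasResidue _).2 q.1.2.2⟩
  · rintro ⟨⟨γ, hγ⟩, ⟨⟨Γ, P⟩, hd⟩, a, b⟩ hq ⟨⟨γ', hγ'⟩, ⟨⟨Γ', P'⟩, hd'⟩, a', b'⟩ hq' he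
    have hI := hins ⟨γ, hγ⟩ _ _ ((hmem _).1 hq).1
    have hI' := hins ⟨γ', hγ'⟩ _ _ ((hmem _).1 hq').1
    obtain ⟨h₁, h₂⟩ := Prod.mk.inj (congrArg Subtype.val he)
    dsimp only at h₁ h₂ hI hI'
    have hB : Nonempty B := ⟨x ⟨γ, hγ⟩⟩
    have hγγ : γ = γ' := by rw [← hI.comap_inr, ← hI'.comap_inr, h₁]
    subst hγγ
    obtain ⟨rfl, rfl, rfl⟩ := hI.inj hI' h₁
    obtain rfl := withBlock_injective h₂
    rfl
  · rintro ⟨⟨Δ, Q⟩, hd⟩ hq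
    obtain ⟨-, hB, hres⟩ := Finset.mem_filter.1 hq
    have hiso : (Δ.induce (Finset.univ.map .inr)).Isomorphic (Δ.comap (.inr : B → A ⊕ B)) :=
      (induce_map_isomorphic Δ .inr Finset.univ).trans (induce_univ_isomorphic _)
    have hγ : (Δ.comap (.inr : B → A ⊕ B)).IsGeneratorOf ρ :=
      (hiso.isGeneratorOf ρ).1 ⟨hd.sub.1 _ hB, hres⟩
    obtain ⟨Γ, P, a, b, hI, hΔ, hP, hab⟩ := hd.exists_insertTwo hB (hl ⟨_, hγ⟩)
    dsimp only at hI hΔ hP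
    have hd' := hd
    dsimp only at hd'
    rw [← hΔ, ← hP, isDecomposition_insertTwo_iff hI (hl ⟨_, hγ⟩) hγ hρ' hab] at hd'
    refine ⟨⟨⟨_, hγ⟩, ⟨(Γ, P), hd'⟩, a, b⟩, (hmem _).2 ⟨hI.link, hab⟩, ?_⟩
    exact Subtype.ext (Prod.ext hΔ hP)
  · rintro ⟨⟨γ, hγ⟩, ⟨⟨Γ, P⟩, hd⟩, a, b⟩ hq
    have hI := hins ⟨γ, hγ⟩ _ _ ((hmem _).1 hq).1
    refine (splitTerm_insertTwo K hI (fun h => hρ' (hγ.2.unique h)) hd.sub.2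
      ((hmem _).1 hq).2 ?_).symm
    have hab := hI.link
    dsimp only at hab ⊢
    rintro rfl
    exact hd.gen.not_link_self t _ hab

open Classical in
/-- The sum over the decompositions in which the vertex `v` does not belong to a component. -/
noncomputable def freeSum (K : Type*) [Field K] (r : Residue) (N : ℕ) (ν : Residue → ℕ) {V : Type}
    [Finite V] (v : V) : H K ⊗[K] H K :=
  ∑ x : Decomposition r N ν V, if ∀ X ∈ x.1.2, v ∉ X then splitTerm K x.1.1 x.1.2 else 0

theorem freeSum_congr [Finite V] [Finite W] (e : V ≃ W) (v : V) :
    freeSum K r N ν v = freeSum K r N ν (e v) := by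
  classical
  refine Fintype.sum_equiv (decompositionEquiv e r N ν) _ _ fun x => ?_
  rw [coe_decompositionEquiv, splitTerm_relabel]
  refine if_congr ?_ rfl rfl
  rw [forall_mem_liftFamily]
  exact forall₂_congr fun X _ => not_congr (Finset.mem_map' e.toEmbedding).symm

/-- Marking one of the vertices that belong to no component. -/
theorem smul_splitSum_eq_sum_freeSum [Fintype V] :
    ((N : K) - ν .psipsiphi) • splitSum K r N ν V = ∑ v : V, freeSum K r N ν v := by
  classical
  simp only [freeSum]
  rw [Finset.sum_comm, splitSum, Finset.smul_sum]
  refine Finset.sum_congr rfl fun x _ => ?_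
  have h : ((N : K) - ν .psipsiphi) = (Nat.card {v : V // ∀ X ∈ x.1.2, v ∉ X} : K) := by
    have := congrArg (Nat.cast (R := K)) x.2.free
    push_cast at this
    linear_combination -this
  rw [h, Nat.card_eq_fintype_card, Fintype.card_subtype, Nat.cast_smul_eq_nsmul,
    ← Finset.sum_const, Finset.sum_filter]
  exact Finset.sum_congr rfl fun v _ => by split_ifs <;> rfl

theorem smul_splitSum_succ (n : ℕ) :
    ((N : K) - ν .psipsiphi) • splitSum K r N ν (Fin (n + 1)) =
      ((n + 1 : ℕ) : K) • freeSum K r N ν (none : Option (Fin n)) := by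
  rw [smul_splitSum_eq_sum_freeSum]
  have : ∀ v : Fin (n + 1), freeSum K r N ν v = freeSum K r N ν (none : Option (Fin n)) := by
    intro v
    rw [freeSum_congr K (finSuccEquiv' v), finSuccEquiv'_at]
  rw [Finset.sum_congr rfl fun v _ => this v, Finset.sum_const, Finset.card_univ,
    Fintype.card_fin, Nat.cast_smul_eq_nsmul]

/-- Summation over the ways to insert a component with three legs. -/
theorem markedSum_three [Finite A] [Finite B] :
    markedSum K r N (addCount ν .psipsiphi) .psipsiphi A B =
      ((∑ γ : {γ : Diagram B // γ.IsGeneratorOf .psipsiphi}, graph K γ.1) ⊗ₜ[K] 1) *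
        freeSum K r N ν (none : Option A) := by
  classical
  let _ := Fintype.ofFinite A
  let _ := Fintype.ofFinite B
  choose l hl using fun γ : {γ : Diagram B // γ.IsGeneratorOf .psipsiphi} =>
    exists_hasThreeLegs γ.2
  have hfree : freeSum K r N ν (none : Option A) =
      ∑ x : Decomposition r N ν (Option A) with ∀ X ∈ x.1.2, none ∉ X,
        splitTerm K x.1.1 x.1.2 := by
    rw [freeSum, Finset.sum_filter]
    exact Finset.sum_congr rfl fun x _ => by split_ifs <;> rfl
  rw [markedSum, ← Finset.sum_filter, hfree, TensorProduct.sum_tmul,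
    Finset.sum_mul_sum, ← Finset.sum_product']
  symm
  -- the family of components as a family of subsets of `A`
  have hfam : ∀ d : Decomposition r N ν (Option A), (∀ X ∈ d.1.2, none ∉ X) →
      ∃ P : Finset (Finset A), liftFamily .some P = d.1.2 := by
    intro d hd
    refine ⟨d.1.2.image Finset.eraseNone, ?_⟩
    ext Z
    simp only [mem_liftFamily, Finset.mem_image]
    constructor
    · rintro ⟨_, ⟨X, hX, rfl⟩, rfl⟩
      rwa [Finset.map_some_eraseNone, Finset.erase_eq_of_notMem (hd X hX)]
    · exact fun hZ => ⟨_, ⟨Z, hZ, rfl⟩, by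
        rw [Finset.map_some_eraseNone, Finset.erase_eq_of_notMem (hd Z hZ)]⟩
  choose! p hp using hfam
  have hsub : ∀ (γ : {γ : Diagram B // γ.IsGeneratorOf .psipsiphi})
      (d : Decomposition r N ν (Option A)), Substitutable d.1.1 γ.1 (l γ) := fun γ d =>
    ⟨d.2.gen.isFeynman, γ.2.isFeynman, fun s => d.2.gen.not_link_self s none, hl γ⟩
  have hmem : ∀ q : {γ : Diagram B // γ.IsGeneratorOf .psipsiphi} × Decomposition r N ν (Option A),
      q ∈ (Finset.univ : Finset {γ : Diagram B // γ.IsGeneratorOf .psipsiphi}) ×ˢ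
        ((Finset.univ : Finset (Decomposition r N ν (Option A))).filter
          fun d => ∀ X ∈ d.1.2, none ∉ X) ↔ ∀ X ∈ q.2.1.2, none ∉ X := fun q => by simp
  refine Finset.sum_bij (fun q hq => ⟨(insertVertex q.2.1.1 q.1.1 (l q.1), withBlock (p q.2)),
    (isDecomposition_insertVertex_iff (hsub q.1 q.2) q.1.2).2
      (by rw [hp q.2 ((hmem q).1 hq)]; exact q.2.2)⟩) ?_ ?_ ?_ ?_
  · intro q hq
    rw [Finset.mem_filter]
    exact ⟨Finset.mem_univ _, mem_withBlock.2 (.inl rfl),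
      ((hsub q.1 q.2).induce_map_inr_isomorphic.hasResidue _).2 q.1.2.2⟩
  · rintro ⟨⟨γ, hγ⟩, d⟩ hq ⟨⟨γ', hγ'⟩, d'⟩ hq' he
    have hI := hsub ⟨γ, hγ⟩ d
    have hI' := hsub ⟨γ', hγ'⟩ d'
    obtain ⟨h₁, h₂⟩ := Prod.mk.inj (congrArg Subtype.val he)
    dsimp only at h₁ h₂ hI hI'
    have hB : Nonempty B := ⟨l ⟨γ, hγ⟩ .sca⟩
    have hγγ : γ = γ' := by rw [← hI.comap_inr, ← hI'.comap_inr, h₁]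
    subst hγγ
    have hΓ := hI.inj hI' h₁
    have hP := withBlock_injective h₂
    have : d = d' := Subtype.ext (Prod.ext hΓ (by
      rw [← hp d ((hmem _).1 hq), ← hp d' ((hmem _).1 hq'), hP]))
    rw [this]
  · rintro ⟨⟨Δ, Q⟩, hd⟩ hq
    obtain ⟨-, hB, hres⟩ := Finset.mem_filter.1 hq
    have hiso : (Δ.induce (Finset.univ.map .inr)).Isomorphic (Δ.comap (.inr : B → A ⊕ B)) :=
      (induce_map_isomorphic Δ .inr Finset.univ).trans (induce_univ_isomorphic _)
    have hγ : (Δ.comap (.inr : B → A ⊕ B)).IsGeneratorOf .psipsiphi :=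
      (hiso.isGeneratorOf _).1 ⟨hd.sub.1 _ hB, hres⟩
    obtain ⟨Γ, hI, hΔ⟩ := exists_insertVertex hd.gen.isFeynman (hl ⟨_, hγ⟩)
    dsimp only at hB hI hΔ
    obtain ⟨P, hP⟩ := exists_withBlock hd.sub.2 hB
    dsimp only at hP
    have hd' := hd
    dsimp only at hd'
    rw [← hΔ, ← hP, isDecomposition_insertVertex_iff hI hγ] at hd'
    have hno : ∀ X ∈ liftFamily .some P, none ∉ X := by
      rw [forall_mem_liftFamily]
      simp
    refine ⟨⟨⟨_, hγ⟩, ⟨(Γ, liftFamily .some P), hd'⟩⟩, (hmem _).2 hno, ?_⟩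
    refine Subtype.ext (Prod.ext hΔ ?_)
    dsimp only
    rw [liftFamily_injective _ (hp ⟨(Γ, liftFamily .some P), hd'⟩ hno), hP]
  · rintro ⟨⟨γ, hγ⟩, d⟩ hq
    have h := splitTerm_insertVertex K (hsub ⟨γ, hγ⟩ d) (P := p d) hγ.2
    rw [hp d ((hmem _).1 hq)] at h
    exact h.symm

/-- A sum over subsets of a set with `n` elements. -/
theorem sum_finset_eq_antidiagonal {M : Type*} [AddCommGroup M] [Module K M] [CharZero K] (n : ℕ)
    (f : ℕ → ℕ → M) : (1 / (n.factorial : K)) • ∑ X : Finset (Fin n), f X.card (n - X.card) =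
      ∑ ij ∈ Finset.HasAntidiagonal.antidiagonal n,
        ((1 / (ij.1.factorial : K)) * (1 / (ij.2.factorial : K))) • f ij.1 ij.2 := by
  have h := Finset.sum_powerset_apply_card (fun j => f j (n - j)) (x := (Finset.univ : Finset (Fin n)))
  rw [Finset.powerset_univ, Finset.card_univ, Fintype.card_fin] at h
  rw [h, Finset.smul_sum, Finset.Nat.sum_antidiagonal_eq_sum_range_succ
    fun i j => ((1 / (i.factorial : K)) * (1 / (j.factorial : K))) • f i j]
  refine Finset.sum_congr rfl fun j hj => ?_
  have hj' : j ≤ n := Nat.lt_succ_iff.1 (Finset.mem_range.1 hj)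
  rw [← Nat.cast_smul_eq_nsmul K, smul_smul]
  congr 1
  rw [Nat.cast_choose K hj']
  have h₁ : (n.factorial : K) ≠ 0 := Nat.cast_ne_zero.2 (Nat.factorial_ne_zero _)
  have h₂ : (j.factorial : K) ≠ 0 := Nat.cast_ne_zero.2 (Nat.factorial_ne_zero _)
  have h₃ : ((n - j).factorial : K) ≠ 0 := Nat.cast_ne_zero.2 (Nat.factorial_ne_zero _)
  field_simp

variable (r N ν)

/-- The sum over the decompositions of graphs with `n` vertices, with symmetry factors. -/
noncomputable def normSplitSum (n : ℕ) : H K ⊗[K] H K :=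
  (1 / (n.factorial : K)) • splitSum K r N ν (Fin n)

variable {r N ν}

/-- Removal of a component with two legs. -/
theorem smul_normSplitSum_two [CharZero K] {ρ : Residue} {t : Leg} (hρ : ρ.IsOnLine t) (n : ℕ) :
    ((ν ρ + 1 : ℕ) : K) • normSplitSum K r N (addCount ν ρ) n =
      (((N : K) + ρ.legs t * ν ρ - r.legs t) / ((ρ.legs .sca).factorial : K)) •
      ∑ ij ∈ Finset.HasAntidiagonal.antidiagonal n,
        (labelledSum K ρ ij.1 ⊗ₜ[K] 1) * normSplitSum K r N ν ij.2 := by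
  rw [normSplitSum, smul_comm, smul_splitSum_addCount]
  let F : ℕ → ℕ → H K ⊗[K] H K := fun i j =>
    ((∑ γ : {γ : Diagram (Fin i) // γ.IsGeneratorOf ρ}, graph K γ.1) ⊗ₜ[K] 1) *
      (((N : K) + ρ.legs t * ν ρ - r.legs t) • splitSum K r N ν (Fin j))
  have h : ∀ X : Finset (Fin n), markedSum K r N (addCount ν ρ) ρ {v // v ∉ X} {v // v ∈ X} =
      F X.card (n - X.card) := by
    intro X
    have e₁ : {v // v ∈ X} ≃ Fin X.card := X.equivFin
    have e₂ : {v // v ∉ X} ≃ Fin (n - X.card) := Fintype.equivFinOfCardEq (by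
      rw [Fintype.card_subtype_compl, Fintype.card_fin, Fintype.card_coe])
    rw [markedSum_two K hρ, sum_graph_congr K e₁, splitSum_congr K r N ν e₂]
  rw [Finset.sum_congr rfl fun X _ => h X, sum_finset_eq_antidiagonal K n F, Finset.smul_sum]
  refine Finset.sum_congr rfl fun ij _ => ?_
  have h₁ : ((ρ.legs .sca).factorial : K) ≠ 0 := Nat.cast_ne_zero.2 (Nat.factorial_ne_zero _)
  dsimp only [F]
  rw [labelledSum, normSplitSum, ← TensorProduct.smul_tmul', smul_mul_smul_comm, mul_smul_comm,
    smul_smul, smul_smul]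
  congr 1
  field_simp

/-- Removal of a component with three legs. -/
theorem smul_normSplitSum_three [CharZero K] (n : ℕ) :
    ((ν .psipsiphi + 1 : ℕ) : K) • normSplitSum K r N (addCount ν .psipsiphi) n =
      ((N : K) - ν .psipsiphi) • ∑ ij ∈ Finset.HasAntidiagonal.antidiagonal n,
        (labelledSum K .psipsiphi ij.1 ⊗ₜ[K] 1) * normSplitSum K r N ν (ij.2 + 1) := by
  rw [normSplitSum, smul_comm, smul_splitSum_addCount]
  let F : ℕ → ℕ → H K ⊗[K] H K := fun i j =>
    ((∑ γ : {γ : Diagram (Fin i) // γ.IsGeneratorOf .psipsiphi}, graph K γ.1) ⊗ₜ[K] 1) *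
      freeSum K r N ν (none : Option (Fin j))
  have h : ∀ X : Finset (Fin n),
      markedSum K r N (addCount ν .psipsiphi) .psipsiphi {v // v ∉ X} {v // v ∈ X} =
      F X.card (n - X.card) := by
    intro X
    have e₁ : {v // v ∈ X} ≃ Fin X.card := X.equivFin
    have e₂ : {v // v ∉ X} ≃ Fin (n - X.card) := Fintype.equivFinOfCardEq (by
      rw [Fintype.card_subtype_compl, Fintype.card_fin, Fintype.card_coe])
    rw [markedSum_three K, sum_graph_congr K e₁, freeSum_congr K e₂.optionCongr]
    rfl
  rw [Finset.sum_congr rfl fun X _ => h X, sum_finset_eq_antidiagonal K n F, Finset.smul_sum]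
  refine Finset.sum_congr rfl fun ij _ => ?_
  have h₁ : ((ij.2 + 1 : ℕ) : K) ≠ 0 := Nat.cast_ne_zero.2 (Nat.succ_ne_zero _)
  have h₂ : (ij.2.factorial : K) ≠ 0 := Nat.cast_ne_zero.2 (Nat.factorial_ne_zero _)
  have h₃ : freeSum K r N ν (none : Option (Fin ij.2)) =
      ((1 / ((ij.2 + 1 : ℕ) : K)) * ((N : K) - ν .psipsiphi)) •
        splitSum K r N ν (Fin (ij.2 + 1)) := by
    rw [mul_smul, smul_splitSum_succ, smul_smul, one_div, inv_mul_cancel₀ h₁, one_smul]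
  dsimp only [F]
  rw [h₃, labelledSum, normSplitSum, ← TensorProduct.smul_tmul', smul_mul_smul_comm, mul_smul_comm,
    smul_smul, smul_smul]
  congr 1
  rw [Nat.factorial_succ]
  push_cast at h₁ ⊢
  simp only [Residue.legs, Nat.factorial_one, Nat.cast_one]
  field_simp

end

end

/-! ### The coproduct of the sums of all graphs -/

section


variable {V W : Type}

theorem isSubgraph_relabel [Finite V] (e : V ≃ W) {Γ : Diagram V} {P : Finset (Finset V)} :
    (Γ.relabel e).IsSubgraph (liftFamily e.toEmbedding P) ↔ Γ.IsSubgraph P := by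
  rw [IsSubgraph, IsSubgraph, forall_mem_liftFamily, liftFamily_pairwiseDisjoint]
  exact and_congr_left fun _ => forall₂_congr fun X _ =>
    (induce_relabel_isomorphic e Γ X).isGenerator

section

variable (K : Type*) [Field K]

open Classical in
/-- The terms `𝕀 ⊗ Γ` and `γ ⊗ Γ/γ` of the coproduct are the contributions of all subgraphs, the
empty one included, that do not contain all vertices in one component. -/
theorem comul_graph [Fintype V] {Γ : Diagram V} (hΓ : Γ.IsGenerator) :
    comul K (graph K Γ) = graph K Γ ⊗ₜ[K] 1 +
      ∑ P : Finset (Finset V) with Γ.IsSubgraph P ∧ Finset.univ ∉ P, splitTerm K Γ P := by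
  obtain ⟨G, hG, e, he⟩ : ∃ G : Gen, graph K Γ = MvPolynomial.X G ∧ G.rep.Isomorphic Γ :=
    ⟨toGen Γ hΓ, graph_of_isGenerator K hΓ, rep_toGen Γ hΓ⟩
  obtain rfl := isIso_iff_relabel.1 he
  obtain ⟨r, hr⟩ := hΓ.exists_isGeneratorOf
  have h₀ : splitTerm K (G.rep.relabel e) ∅ = 1 ⊗ₜ[K] graph K (G.rep.relabel e) := by
    rw [splitTerm, Finset.prod_empty, (contract_empty_isomorphic (hr.not_link_self)).graph_eq K]
  have hsum : ∑ P : Finset (Finset V) with (G.rep.relabel e).IsSubgraph P ∧ P ≠ ∅ ∧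
      Finset.univ ∉ P, splitTerm K (G.rep.relabel e) P =
      ∑ P : Finset (Finset (Fin G.1)) with G.rep.IsSubgraph P ∧ P ≠ ∅ ∧ Finset.univ ∉ P,
        splitTerm K G.rep P := by
    have hP : ∀ P, e.finsetCongr.finsetCongr P = liftFamily e.toEmbedding P := fun _ => rfl
    refine (Finset.sum_equiv e.finsetCongr.finsetCongr (fun P => ?_) fun P _ => ?_).symm
    · have hu : Finset.univ = (Finset.univ : Finset (Fin G.1)).map e.toEmbedding := by simp
      rw [hP, Finset.mem_filter_univ, Finset.mem_filter_univ, isSubgraph_relabel, hu,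
        map_mem_liftFamily]
      simp [liftFamily]
    · rw [hP, splitTerm_relabel]
  have hempty : (Finset.univ.filter fun P : Finset (Finset V) => (G.rep.relabel e).IsSubgraph P ∧
      Finset.univ ∉ P) = insert ∅ (Finset.univ.filter fun P : Finset (Finset V) =>
        (G.rep.relabel e).IsSubgraph P ∧ P ≠ ∅ ∧ Finset.univ ∉ P) := by
    ext P
    rw [Finset.mem_insert, Finset.mem_filter_univ, Finset.mem_filter_univ]
    by_cases hP : P = ∅
    · subst hP
      simp [IsSubgraph]
    · simp [hP]
  rw [hempty, Finset.sum_insert (by simp), h₀, hsum, hG, ← add_assoc, comul,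
    MvPolynomial.aeval_X, comulGen]
  rfl

/-- A component count. -/
def counts (a b d : ℕ) : Residue → ℕ
  | .psipsiphi => a
  | .psipsi => b
  | .phiphi => d

/-- The subgraphs are sorted by the number of vertices of the contracted graph and by the numbers of
components of each residue; any bound `M` that exceeds all of these numbers will do. -/
theorem comul_labelledSum (r : Residue) {n M : ℕ} (hM : n + 2 ^ n < M) :
    comul K (labelledSum K r n) = labelledSum K r n ⊗ₜ[K] 1 +
      ((r.legs .sca).factorial : K) • ∑ q ∈ Finset.range M ×ˢ Finset.range M ×ˢ Finset.range M ×ˢ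
        Finset.range M, normSplitSum K r q.1 (counts q.2.1 q.2.2.1 q.2.2.2) n := by
  classical
  let _ := Fintype.ofFinite (Diagram (Fin n))
  let s : Finset (Diagram (Fin n) × Finset (Finset (Fin n))) :=
    Finset.univ.filter fun x => x.1.IsGeneratorOf r ∧ x.1.IsSubgraph x.2 ∧ Finset.univ ∉ x.2
  let cnt : Diagram (Fin n) × Finset (Finset (Fin n)) → Residue → ℕ := fun x ρ =>
    (x.2.filter fun X => (x.1.induce X).HasResidue ρ).card
  let g : Diagram (Fin n) × Finset (Finset (Fin n)) → ℕ × ℕ × ℕ × ℕ := fun x =>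
    (Nat.card {v // ∀ X ∈ x.2, v ∉ X} + cnt x .psipsiphi, cnt x .psipsiphi, cnt x .psipsi,
      cnt x .phiphi)
  have hcnt : ∀ x ρ, cnt x ρ ≤ 2 ^ n := fun x ρ => (Finset.card_le_univ _).trans (by simp)
  have hg : ∀ x ∈ s, g x ∈ Finset.range M ×ˢ Finset.range M ×ˢ Finset.range M ×ˢ
      Finset.range M := by
    intro x _
    have h₁ : Nat.card {v : Fin n // ∀ X ∈ x.2, v ∉ X} ≤ n :=
      (Finite.card_subtype_le _).trans (by simp)
    have h₂ := hcnt x .psipsiphi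
    have h₃ := hcnt x .psipsi
    have h₄ := hcnt x .phiphi
    simp only [Finset.mem_product, Finset.mem_range, g]
    omega
  have hs : ∀ q x, x ∈ s.filter (fun x => g x = q) ↔
      IsDecomposition r q.1 (counts q.2.1 q.2.2.1 q.2.2.2) x.1 x.2 := by
    rintro q ⟨Γ, P⟩
    rw [Finset.mem_filter, Finset.mem_filter_univ]
    have hp : Finset.univ ∉ P ↔ ∀ X ∈ P, ∃ v, v ∉ X := by
      simp only [← not_forall, ← Finset.eq_univ_iff_forall]
      exact ⟨fun h X hX he => h (he ▸ hX), fun h hu => h _ hu rfl⟩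
    constructor
    · rintro ⟨⟨h₁, h₂, h₃⟩, rfl⟩
      refine ⟨h₁, h₂, hp.1 h₃, ?_, rfl⟩
      rintro (_ | _ | _) <;> exact congrArg Finset.card (Finset.filter_congr_decidable ..)
    · intro h
      refine ⟨⟨h.gen, h.sub, hp.2 h.proper⟩, ?_⟩
      have hc : ∀ ρ, cnt (Γ, P) ρ = counts q.2.1 q.2.2.1 q.2.2.2 ρ := fun ρ => by
        rw [← h.count ρ]
      have hf := h.free
      simp only [g, hc]
      exact Prod.ext hf rfl
  have hsum : ∑ q ∈ Finset.range M ×ˢ Finset.range M ×ˢ Finset.range M ×ˢ Finset.range M,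
      splitSum K r q.1 (counts q.2.1 q.2.2.1 q.2.2.2) (Fin n) =
      ∑ Γ : {Γ : Diagram (Fin n) // Γ.IsGeneratorOf r},
        ∑ P : Finset (Finset (Fin n)) with Γ.1.IsSubgraph P ∧ Finset.univ ∉ P,
          splitTerm K Γ.1 P := by
    have h₁ := Finset.sum_fiberwise_of_maps_to hg fun x => splitTerm K x.1 x.2
    rw [Finset.sum_congr rfl fun q _ => Finset.sum_subtype _ (hs q) _] at h₁
    refine h₁.trans ?_
    rw [Finset.sum_finset_product s (Finset.univ.filter fun Γ => Γ.IsGeneratorOf r)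
      (fun Γ => Finset.univ.filter fun P => Γ.IsSubgraph P ∧ Finset.univ ∉ P) (fun x => by simp [s])]
    exact Finset.sum_subtype _ (fun Γ => Finset.mem_filter_univ Γ) _
  have hc : ∀ Γ : {Γ : Diagram (Fin n) // Γ.IsGeneratorOf r}, comul K (graph K Γ.1) =
      graph K Γ.1 ⊗ₜ[K] 1 + ∑ P : Finset (Finset (Fin n)) with Γ.1.IsSubgraph P ∧
        Finset.univ ∉ P, splitTerm K Γ.1 P := fun Γ => by convert comul_graph K Γ.2.1
  rw [labelledSum, map_smul, map_sum, Finset.sum_congr rfl fun Γ _ => hc Γ,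
    Finset.sum_add_distrib, ← hsum, smul_add, ← TensorProduct.smul_tmul', TensorProduct.sum_tmul]
  congr 1
  simp only [normSplitSum]
  rw [← Finset.smul_sum, smul_smul, mul_one_div]

/-- The only decomposition without components is the empty subgraph. -/
theorem normSplitSum_zero [CharZero K] (r : Residue) (N n : ℕ) :
    normSplitSum K r N (counts 0 0 0) n = if n = N then
      (1 / ((r.legs .sca).factorial : K)) • (1 ⊗ₜ[K] labelledSum K r N) else 0 := by
  have hP : ∀ x : Decomposition r N (counts 0 0 0) (Fin n), x.1.2 = ∅ := by
    intro x
    classical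
    rw [Finset.eq_empty_iff_forall_notMem]
    intro X hX
    obtain ⟨ρ, hρ⟩ := (x.2.sub.1 X hX).exists_isGeneratorOf
    have h := x.2.count ρ
    have h' : counts 0 0 0 ρ = 0 := by cases ρ <;> rfl
    rw [h', Finset.card_eq_zero, Finset.filter_eq_empty_iff] at h
    exact h hX hρ.2
  split_ifs with h
  · subst h
    have hd : ∀ Γ : {Γ : Diagram (Fin n) // Γ.IsGeneratorOf r},
        IsDecomposition r n (counts 0 0 0) Γ.1 ∅ := fun Γ =>
      ⟨Γ.2, by simp [IsSubgraph], by simp, by rintro (_ | _ | _) <;> rfl, by simp [counts]⟩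
    have hs : splitSum K r n (counts 0 0 0) (Fin n) =
        ∑ Γ : {Γ : Diagram (Fin n) // Γ.IsGeneratorOf r}, 1 ⊗ₜ[K] graph K Γ.1 := by
      refine (Fintype.sum_bijective (fun Γ => ⟨(Γ.1, ∅), hd Γ⟩) ⟨fun Γ Γ' he => ?_, fun x => ?_⟩
        _ _ fun Γ => ?_).symm
      · exact Subtype.ext (Prod.mk.inj (congrArg Subtype.val he)).1
      · exact ⟨⟨x.1.1, x.2.gen⟩, Subtype.ext (Prod.ext rfl (hP x).symm)⟩
      · rw [splitTerm, Finset.prod_empty,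
          (contract_empty_isomorphic Γ.2.not_link_self).graph_eq K]
    have hκ : ((r.legs .sca).factorial : K) ≠ 0 := Nat.cast_ne_zero.2 (Nat.factorial_ne_zero _)
    rw [normSplitSum, hs, labelledSum, TensorProduct.tmul_smul, smul_smul, TensorProduct.tmul_sum]
    congr 1
    field_simp
  · have : IsEmpty (Decomposition r N (counts 0 0 0) (Fin n)) := ⟨fun x => h (by
      have hf := x.2.free
      rw [hP x] at hf
      simpa [counts] using hf)⟩
    rw [normSplitSum, splitSum, Fintype.sum_empty, smul_zero]

end

end

/-! ### The coproduct in terms of generating series -/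

section

variable (K : Type*) [Field K]

theorem labelledSum_zero (r : Residue) : labelledSum K r 0 = 0 := by
  have : IsEmpty {Γ : Diagram (Fin 0) // Γ.IsGeneratorOf r} := ⟨fun Γ =>
    let ⟨v⟩ := Γ.2.1.2.1.1.1; v.elim0⟩
  rw [labelledSum, Fintype.sum_empty, smul_zero]

/-- The binomial coefficient `x (x + 1) ⋯ (x + d - 1) / d!`: the number of multisets of size `d` of
a set of `x` elements. -/
noncomputable def rising (x : K) (d : ℕ) : K := ∏ i ∈ Finset.range d, (x + i) / ((i + 1 : ℕ) : K)

theorem rising_succ (x : K) (d : ℕ) :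
    rising K x (d + 1) = rising K x d * ((x + d) / ((d + 1 : ℕ) : K)) :=
  Finset.prod_range_succ _ _

variable [CharZero K]

theorem labelledSum_mem_Hgrad (r : Residue) (n : ℕ) : labelledSum K r n ∈ Hgrad K := by
  by_cases h : ∃ k, n = r.size k
  · obtain ⟨k, rfl⟩ := h
    rw [← c_eq_labelledSum]
    exact Algebra.subset_adjoin ⟨(r, k), rfl⟩
  · rw [labelledSum_eq_zero K fun k hk => h ⟨k, hk⟩]
    exact zero_mem _

/-- The sum of all graphs with residue `r` and `n` vertices, as an element of `Hgrad`. -/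
noncomputable def gradSum (r : Residue) (n : ℕ) : Hgrad K :=
  ⟨labelledSum K r n, labelledSum_mem_Hgrad K r n⟩

/-- The generating series, by the number of vertices, of the graphs with residue `r`. -/
noncomputable def graphSeries (r : Residue) : PowerSeries (Hgrad K) := PowerSeries.mk (gradSum K r)

/-- The generating series of the vertex corrections, by the number of vertices that are added when
a vertex is replaced. -/
noncomputable def vertexSeries : PowerSeries (Hgrad K) :=
  PowerSeries.mk fun n => gradSum K .psipsiphi (n + 1)

theorem X_mul_vertexSeries : PowerSeries.X * vertexSeries K = graphSeries K .psipsiphi := by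
  ext n : 1
  rcases n with _ | n
  · rw [PowerSeries.coeff_zero_X_mul, graphSeries, PowerSeries.coeff_mk]
    exact Subtype.ext (labelledSum_zero K _).symm
  · rw [PowerSeries.coeff_succ_X_mul, graphSeries, vertexSeries, PowerSeries.coeff_mk,
      PowerSeries.coeff_mk]

/-- A coefficient of a series, tensored with the sum of all graphs with `N` vertices. -/
noncomputable def coeffTensor (r : Residue) (N : ℕ) (W : PowerSeries (Hgrad K)) (n : ℕ) :
    H K ⊗[K] H K := ((PowerSeries.coeff n W : Hgrad K) : H K) ⊗ₜ[K] labelledSum K r N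

theorem sum_mul_coeffTensor (r ρ : Residue) (N : ℕ) (W : PowerSeries (Hgrad K)) (n : ℕ) :
    ∑ ij ∈ Finset.HasAntidiagonal.antidiagonal n,
      (labelledSum K ρ ij.1 ⊗ₜ[K] 1) * coeffTensor K r N W ij.2 =
      coeffTensor K r N (graphSeries K ρ * W) n := by
  simp only [coeffTensor, Algebra.TensorProduct.tmul_mul_tmul, one_mul]
  rw [← TensorProduct.sum_tmul, PowerSeries.coeff_mul]
  push_cast
  congr 1
  refine Finset.sum_congr rfl fun ij _ => ?_
  rw [graphSeries, PowerSeries.coeff_mk]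
  rfl

variable {r : Residue} {N : ℕ} {ν : Residue → ℕ} {w : K} {W : PowerSeries (Hgrad K)}

/-- One more self-energy component multiplies the series by that of the self-energies. The scalar is the
number of propagators that are available, divided by the new number of components. -/
theorem normSplitSum_addCount_two {ρ : Residue} {t : Leg} (hρ : ρ.IsOnLine t)
    (h : ∀ n, ((r.legs .sca).factorial : K) • normSplitSum K r N ν n =
      w • coeffTensor K r N W n) (n : ℕ) :
    ((r.legs .sca).factorial : K) • normSplitSum K r N (addCount ν ρ) n =
      (w * (((N : K) + ρ.legs t * ν ρ - r.legs t) / ((ρ.legs .sca).factorial : K) /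
        ((ν ρ + 1 : ℕ) : K))) • coeffTensor K r N (graphSeries K ρ * W) n := by
  have h₀ : ((ν ρ + 1 : ℕ) : K) ≠ 0 := Nat.cast_ne_zero.2 (Nat.succ_ne_zero _)
  have h₁ := smul_normSplitSum_two K (r := r) (N := N) (ν := ν) hρ n
  have h₂ : ∀ ij : ℕ × ℕ, ((r.legs .sca).factorial : K) • ((labelledSum K ρ ij.1 ⊗ₜ[K] 1) *
      normSplitSum K r N ν ij.2) = w • ((labelledSum K ρ ij.1 ⊗ₜ[K] 1) *
        coeffTensor K r N W ij.2) := fun ij => by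
    rw [← mul_smul_comm, h, mul_smul_comm]
  have h₃ : ((ν ρ + 1 : ℕ) : K) • (((r.legs .sca).factorial : K) •
      normSplitSum K r N (addCount ν ρ) n) =
      (((N : K) + ρ.legs t * ν ρ - r.legs t) / ((ρ.legs .sca).factorial : K)) • w •
        coeffTensor K r N (graphSeries K ρ * W) n := by
    rw [smul_comm, h₁, smul_comm, Finset.smul_sum, Finset.sum_congr rfl fun ij _ => h₂ ij,
      ← Finset.smul_sum, sum_mul_coeffTensor]
  rw [← inv_smul_smul₀ h₀ (((r.legs .sca).factorial : K) • _), h₃, smul_smul, smul_smul]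
  congr 1
  ring

/-- One more vertex correction multiplies the series by `vertexSeries`. The scalar is the number of
uncorrected vertices, divided by the new number of vertex corrections. -/
theorem normSplitSum_addCount_three
    (h : ∀ n, ((r.legs .sca).factorial : K) • normSplitSum K r N ν n =
      w • coeffTensor K r N (PowerSeries.X * W) n) (n : ℕ) :
    ((r.legs .sca).factorial : K) • normSplitSum K r N (addCount ν .psipsiphi) n =
      (w * (((N : K) - ν .psipsiphi) / ((ν .psipsiphi + 1 : ℕ) : K))) •
        coeffTensor K r N (PowerSeries.X * (vertexSeries K * W)) n := by
  have h₀ : ((ν .psipsiphi + 1 : ℕ) : K) ≠ 0 := Nat.cast_ne_zero.2 (Nat.succ_ne_zero _)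
  have h₁ := smul_normSplitSum_three K (r := r) (N := N) (ν := ν) n
  have h₂ : ∀ ij : ℕ × ℕ, ((r.legs .sca).factorial : K) •
      ((labelledSum K .psipsiphi ij.1 ⊗ₜ[K] 1) * normSplitSum K r N ν (ij.2 + 1)) =
      w • ((labelledSum K .psipsiphi ij.1 ⊗ₜ[K] 1) * coeffTensor K r N W ij.2) := fun ij => by
    rw [← mul_smul_comm, h, mul_smul_comm, coeffTensor, PowerSeries.coeff_succ_X_mul]
    rfl
  have h₃ : ((ν .psipsiphi + 1 : ℕ) : K) • (((r.legs .sca).factorial : K) •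
      normSplitSum K r N (addCount ν .psipsiphi) n) = ((N : K) - ν .psipsiphi) • w •
        coeffTensor K r N (PowerSeries.X * (vertexSeries K * W)) n := by
    rw [smul_comm, h₁, smul_comm, Finset.smul_sum, Finset.sum_congr rfl fun ij _ => h₂ ij,
      ← Finset.smul_sum, sum_mul_coeffTensor, ← mul_assoc, X_mul_vertexSeries]
  rw [← inv_smul_smul₀ h₀ (((r.legs .sca).factorial : K) • _), h₃, smul_smul, smul_smul]
  congr 1
  ring

/-- Pascal's rule for multisets. -/
theorem rising_add_one (x : K) (d : ℕ) :
    rising K (x + 1) (d + 1) = rising K (x + 1) d + rising K x (d + 1) := by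
  have h : ∀ d, x * rising K (x + 1) d = (x + d) * rising K x d := by
    intro d
    induction d with
    | zero => simp [rising]
    | succ d ih =>
      rw [rising_succ, rising_succ, ← mul_assoc, ih]
      push_cast
      ring
  have h₀ : ((d + 1 : ℕ) : K) ≠ 0 := Nat.cast_ne_zero.2 (Nat.succ_ne_zero _)
  have h₁ := h d
  rw [rising_succ, rising_succ]
  field_simp
  push_cast
  linear_combination h₁

/-- The number of ways to distribute `a` vertex corrections, `b` fermion and `d` scalar self-energies
over the vertices and propagators of a graph with `N` vertices and residue `r`. -/
noncomputable def insertionCount (r : Residue) (N a b d : ℕ) : K :=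
  (N.choose a : K) * (rising K ((N : K) - r.legs .out) b * rising K (((N : K) - r.legs .sca) / 2) d)

/-- The recursions solved: the subgraphs with given numbers of components contribute a product of powers
of the generating series, times the number of ways to place the components. -/
theorem normSplitSum_counts (r : Residue) (N a b d n : ℕ) :
    ((r.legs .sca).factorial : K) • normSplitSum K r N (counts a b d) n =
      insertionCount K r N a b d • coeffTensor K r N (PowerSeries.X * (vertexSeries K ^ a *
        (graphSeries K .psipsi ^ b * (graphSeries K .phiphi ^ d * PowerSeries.X ^ (N - 1))))) n := by
  have ha : ∀ a b d, addCount (counts a b d) .psipsiphi = counts (a + 1) b d := fun a b d => by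
    funext ρ; cases ρ <;> simp [addCount, counts]
  have hb : ∀ a b d, addCount (counts a b d) .psipsi = counts a (b + 1) d := fun a b d => by
    funext ρ; cases ρ <;> simp [addCount, counts]
  have hd : ∀ a b d, addCount (counts a b d) .phiphi = counts a b (d + 1) := fun a b d => by
    funext ρ; cases ρ <;> simp [addCount, counts]
  induction a generalizing n with
  | succ a ih =>
    rw [← ha, normSplitSum_addCount_three K ih n, pow_succ', mul_assoc]
    congr 1
    rw [insertionCount, insertionCount]
    have h₀ : ((a + 1 : ℕ) : K) ≠ 0 := Nat.cast_ne_zero.2 (Nat.succ_ne_zero _)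
    have h₁ : ((N.choose (a + 1) : ℕ) : K) * ((a + 1 : ℕ) : K) = N.choose a * ((N : K) - a) := by
      rcases le_or_gt a N with h | h
      · rw [← Nat.cast_sub h]
        exact_mod_cast Nat.choose_succ_right_eq N a
      · rw [Nat.choose_eq_zero_of_lt h, Nat.choose_eq_zero_of_lt (by omega)]
        simp
    simp only [counts]
    field_simp
    linear_combination (-(rising K ((N : K) - r.legs .out) b *
      rising K (((N : K) - r.legs .sca) / 2) d)) * h₁
  | zero =>
    induction b generalizing n with
    | succ b ih =>
      rw [← hb, normSplitSum_addCount_two K (.inl ⟨rfl, rfl⟩) ih n, pow_succ']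
      refine congrArg₂ (· • ·) ?_ (congrArg (coeffTensor K r N · n) ?_)
      · rw [insertionCount, insertionCount, rising_succ]
        simp only [counts, Residue.legs, Nat.factorial]
        push_cast
        ring
      · rw [mul_left_comm, mul_left_comm (graphSeries K .psipsi), ← mul_assoc (graphSeries K _)]
    | zero =>
      induction d generalizing n with
      | succ d ih =>
        rw [← hd, normSplitSum_addCount_two K (.inr ⟨rfl, rfl⟩) ih n, pow_succ']
        refine congrArg₂ (· • ·) ?_ (congrArg (coeffTensor K r N · n) ?_)
        · rw [insertionCount, insertionCount, rising_succ]
          simp only [counts, Residue.legs, Nat.factorial]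
          push_cast
          field_simp
          ring
        · rw [mul_left_comm, mul_left_comm (graphSeries K .phiphi),
            mul_left_comm (graphSeries K .phiphi), ← mul_assoc (graphSeries K .phiphi)]
      | zero =>
        have hκ : ((r.legs .sca).factorial : K) ≠ 0 :=
          Nat.cast_ne_zero.2 (Nat.factorial_ne_zero _)
        rw [normSplitSum_zero, smul_ite, smul_zero, smul_smul, mul_one_div_cancel hκ, one_smul]
        simp only [insertionCount, rising, coeffTensor, Nat.choose_zero_right, Nat.cast_one,
          Finset.range_zero, Finset.prod_empty, one_mul, one_smul, pow_zero]
        rcases Nat.eq_zero_or_pos N with rfl | hN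
        · rw [labelledSum_zero, TensorProduct.tmul_zero, TensorProduct.tmul_zero, ite_self]
        · rw [← pow_succ', Nat.sub_add_cancel hN, PowerSeries.coeff_X_pow]
          split_ifs
          · rfl
          · rw [ZeroMemClass.coe_zero, TensorProduct.zero_tmul]

/-- The generating series of the subgraphs with at most `M` components of each kind, for a given
contracted graph with `N` vertices and residue `r`. -/
noncomputable def insertionSeries (r : Residue) (N M : ℕ) : PowerSeries (Hgrad K) :=
  (∑ a ∈ Finset.range M, (N.choose a : K) • vertexSeries K ^ a) *
    ((∑ b ∈ Finset.range M, rising K ((N : K) - r.legs .out) b • graphSeries K .psipsi ^ b) *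
      ∑ d ∈ Finset.range M, rising K (((N : K) - r.legs .sca) / 2) d • graphSeries K .phiphi ^ d)

/-- The closed formula for the coproduct of the sum of all graphs. The contracted graphs enter through
the sums of all graphs with `N` vertices, the subgraphs through polynomials in the generating series. -/
theorem comul_labelledSum_eq (r : Residue) {n M : ℕ} (hM : n + 2 ^ n < M) :
    comul K (labelledSum K r n) = labelledSum K r n ⊗ₜ[K] 1 + ∑ N ∈ Finset.range M,
      coeffTensor K r N (PowerSeries.X * (PowerSeries.X ^ (N - 1) * insertionSeries K r N M)) n := by
  rw [comul_labelledSum K r hM, Finset.smul_sum]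
  congr 1
  rw [Finset.sum_product]
  refine Finset.sum_congr rfl fun N _ => ?_
  simp only [normSplitSum_counts]
  have hlin : ∀ (w : K) (W : PowerSeries (Hgrad K)),
      coeffTensor K r N (w • W) n = w • coeffTensor K r N W n := fun w W => by
    rw [coeffTensor, PowerSeries.coeff_smul, coeffTensor, TensorProduct.smul_tmul']
    rfl
  have hsum : ∀ W : ℕ × ℕ × ℕ → PowerSeries (Hgrad K),
      coeffTensor K r N (∑ q ∈ Finset.range M ×ˢ Finset.range M ×ˢ Finset.range M, W q) n =
        ∑ q ∈ Finset.range M ×ˢ Finset.range M ×ˢ Finset.range M, coeffTensor K r N (W q) n :=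
    fun W => by
      simp only [coeffTensor]
      rw [map_sum, AddSubmonoidClass.coe_finsetSum, TensorProduct.sum_tmul]
  simp only [← hlin]
  rw [← hsum]
  congr 1
  rw [insertionSeries, Finset.sum_mul_sum, ← Finset.sum_product', Finset.sum_mul_sum,
    ← Finset.sum_product', Finset.mul_sum, Finset.mul_sum]
  refine Finset.sum_congr rfl fun q _ => ?_
  rw [insertionCount]
  simp only [smul_mul_assoc, mul_smul_comm, smul_smul]
  have h : ∀ {R : Type _} [CommRing R] (x v f s y : R), x * (v * (f * (s * y))) =
      x * (y * (v * (f * s))) := fun x v f s y => by ring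
  rw [h]
  refine congrArg (· • _) ?_
  ring

end

/-! ### The ideal of the mass identity -/

section TensorSub

variable (K : Type*) [Field K] {A B C D E F : Submodule K (H K)}

theorem tensorSub_mul_mem (h₁ : ∀ a ∈ A, ∀ c ∈ C, a * c ∈ E) (h₂ : ∀ b ∈ B, ∀ d ∈ D, b * d ∈ F)
    {x y : H K ⊗[K] H K} (hx : x ∈ tensorSub K A B) (hy : y ∈ tensorSub K C D) :
    x * y ∈ tensorSub K E F := by
  have h : tensorSub K A B ≤ (tensorSub K E F).comap (LinearMap.mulRight K y) := by
    refine Submodule.map₂_le.2 fun a ha b hb => ?_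
    have h' : tensorSub K C D ≤
        (tensorSub K E F).comap (LinearMap.mulLeft K (a ⊗ₜ[K] b)) := by
      refine Submodule.map₂_le.2 fun c hc d hd => ?_
      change a ⊗ₜ[K] b * c ⊗ₜ[K] d ∈ tensorSub K E F
      rw [Algebra.TensorProduct.tmul_mul_tmul]
      exact Submodule.apply_mem_map₂ _ (h₁ a ha c hc) (h₂ b hb d hd)
    exact h' hy
  exact h hx

theorem tmul_mem_tensorSub {a b : H K} (ha : a ∈ A) (hb : b ∈ B) :
    a ⊗ₜ[K] b ∈ tensorSub K A B := Submodule.apply_mem_map₂ _ ha hb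

/-- An ideal is a co-ideal if its generators satisfy the two conditions. -/
theorem isCoidealOf_map {R : Type*} [CommRing R] [Algebra K R] (f : R →ₐ[K] H K) (S : Set R)
    (hf : ∀ x, comul K (f x) ∈
      tensorSub K (LinearMap.range f.toLinearMap) (LinearMap.range f.toLinearMap))
    (hS : ∀ s ∈ S, comul K (f s) ∈
      tensorSub K (((Ideal.span S).restrictScalars K).map f.toLinearMap)
        (LinearMap.range f.toLinearMap) ⊔
      tensorSub K (LinearMap.range f.toLinearMap)
        (((Ideal.span S).restrictScalars K).map f.toLinearMap))
    (hε : ∀ s ∈ S, counit K (f s) = 0) :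
    IsCoidealOf K (LinearMap.range f.toLinearMap)
      (((Ideal.span S).restrictScalars K).map f.toLinearMap) := by
  refine ⟨?_, ?_, ?_, ?_⟩
  · rintro _ ⟨x, -, rfl⟩
    exact ⟨x, rfl⟩
  · rintro _ ⟨x, rfl⟩
    exact hf x
  · rintro _ ⟨x, hx, rfl⟩
    have hx' : x ∈ Ideal.span S := hx
    clear hx
    have hmul : ∀ b ∈ LinearMap.range f.toLinearMap, ∀ c ∈ LinearMap.range f.toLinearMap,
        b * c ∈ LinearMap.range f.toLinearMap := by
      rintro _ ⟨b, rfl⟩ _ ⟨c, rfl⟩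
      exact ⟨b * c, map_mul f b c⟩
    have hmul' : ∀ b ∈ LinearMap.range f.toLinearMap,
        ∀ c ∈ ((Ideal.span S).restrictScalars K).map f.toLinearMap,
        b * c ∈ ((Ideal.span S).restrictScalars K).map f.toLinearMap := by
      rintro _ ⟨b, rfl⟩ _ ⟨c, hc, rfl⟩
      exact ⟨b * c, Ideal.mul_mem_left _ b hc, map_mul f b c⟩
    induction hx' using Submodule.span_induction with
    | mem s hs => exact hS s hs
    | zero =>
      rw [map_zero, map_zero]
      exact zero_mem _
    | add x y _ _ hx hy =>
      rw [map_add, map_add]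
      exact add_mem hx hy
    | smul b x _ hx =>
      have h : f.toLinearMap (b • x) = f b * f.toLinearMap x := map_mul f b x
      rw [h, map_mul]
      obtain ⟨y, hy, z, hz, hyz⟩ := Submodule.mem_sup.1 hx
      rw [← hyz, mul_add]
      exact add_mem (Submodule.mem_sup_left (tensorSub_mul_mem K hmul' hmul (hf b) hy))
        (Submodule.mem_sup_right (tensorSub_mul_mem K hmul hmul' (hf b) hz))
  · rintro _ ⟨x, hx, rfl⟩
    have h : Ideal.span S ≤ RingHom.ker ((counit K).comp f) :=
      Ideal.span_le.2 fun s hs => hε s hs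
    exact h hx

end TensorSub

section

variable (K : Type*) [Field K]

theorem sum_choose_smul_pow {R : Type*} [CommRing R] [Algebra K R] (z : R) {L M : ℕ}
    (hL : L ≤ M) : ∑ a ∈ Finset.range (M + 1), (L.choose a : K) • (-z) ^ a = (1 - z) ^ L := by
  rw [sub_eq_neg_add, add_pow]
  refine (Finset.sum_subset (Finset.range_mono (Nat.succ_le_succ hL)) fun a _ ha => ?_).symm.trans
    (Finset.sum_congr rfl fun a _ => ?_)
  · rw [Nat.choose_eq_zero_of_lt (by simpa using ha), Nat.cast_zero, zero_smul]
  · rw [one_pow, mul_one, Nat.cast_smul_eq_nsmul, nsmul_eq_mul, mul_comm]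

theorem pow_dvd_mul_neg_smul_pow {R : Type*} [CommRing R] [Algebra K R] {x z : R} (h : x ∣ z)
    (s : R) (a : K) (M : ℕ) : x ^ M ∣ s * -(a • z ^ M) := by
  rw [Algebra.smul_def, ← mul_neg, ← mul_assoc]
  exact ((pow_dvd_pow_of_dvd h M).neg_right).mul_left _

theorem counit_c (r : Residue) (k : ℕ) : counit K (c K r k) = 0 := by
  rw [c, map_sum]
  refine Finset.sum_eq_zero fun Γ _ => ?_
  rw [map_smul, counit, MvPolynomial.aeval_X, smul_zero]

theorem counit_wardElement (k : ℕ) : counit K (wardElement K k) = 0 := by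
  rw [wardElement, map_add, counit_c, counit_c, add_zero]

variable [CharZero K]

theorem coeffTensor_mem (r : Residue) (N n : ℕ) (W : PowerSeries (Hgrad K)) :
    coeffTensor K r N W n ∈ tensorSub K (Subalgebra.toSubmodule (Hgrad K))
      (Subalgebra.toSubmodule (Hgrad K)) :=
  tmul_mem_tensorSub K (Subtype.prop _) (labelledSum_mem_Hgrad K r N)

/-- `Hgrad` is closed under the coproduct. -/
theorem comul_mem_of_mem_Hgrad {x : H K} (hx : x ∈ Hgrad K) :
    comul K x ∈ tensorSub K (Subalgebra.toSubmodule (Hgrad K))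
      (Subalgebra.toSubmodule (Hgrad K)) := by
  have hone : (1 : H K ⊗[K] H K) ∈ tensorSub K (Subalgebra.toSubmodule (Hgrad K))
      (Subalgebra.toSubmodule (Hgrad K)) := by
    rw [Algebra.TensorProduct.one_def]
    exact tmul_mem_tensorSub K (one_mem (Hgrad K)) (one_mem (Hgrad K))
  induction hx using Algebra.adjoin_induction with
  | mem x hx =>
    obtain ⟨⟨r, k⟩, rfl⟩ := hx
    dsimp only
    rw [c_eq_labelledSum, comul_labelledSum_eq K r (Nat.lt_succ_self _)]
    refine add_mem (tmul_mem_tensorSub K (labelledSum_mem_Hgrad K r _) (one_mem (Hgrad K))) ?_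
    exact sum_mem fun N _ => coeffTensor_mem K r N _ _
  | algebraMap a =>
    rw [AlgHom.commutes, Algebra.algebraMap_eq_smul_one]
    exact Submodule.smul_mem _ _ hone
  | add x y _ _ hx hy =>
    rw [map_add]
    exact add_mem hx hy
  | mul x y _ _ hx hy =>
    rw [map_mul]
    exact tensorSub_mul_mem K (fun a ha c hc => (Hgrad K).mul_mem ha hc)
      (fun a ha c hc => (Hgrad K).mul_mem ha hc) hx hy

/-- The sum of the graphs with residue `ψ̄ψ` and `n` vertices and those with residue `ψ̄ψφ` and
`n + 1` vertices; both sums vanish unless `n` is even. -/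
noncomputable def wardSum (n : ℕ) : Hgrad K := gradSum K .psipsi n + gradSum K .psipsiphi (n + 1)

theorem wardSum_two_mul (k : ℕ) : (wardSum K (2 * k) : H K) = wardElement K k := by
  rw [wardElement, c_eq_labelledSum, c_eq_labelledSum]
  rfl

theorem wardSum_mem (n : ℕ) : wardSum K n ∈ wardIdealGrad K := by
  rcases Nat.even_or_odd' n with ⟨k, rfl | rfl⟩
  · exact Ideal.subset_span ⟨k, wardSum_two_mul K k⟩
  · have h : wardSum K (2 * k + 1) = 0 := Subtype.ext (by
      change labelledSum K _ _ + labelledSum K _ _ = 0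
      rw [labelledSum_eq_zero K fun j hj => ?_, labelledSum_eq_zero K fun j hj => ?_, add_zero] <;>
      · simp only [Residue.size] at hj
        omega)
    rw [h]
    exact zero_mem _

/-- Multiplication by `1 - z` lowers the argument of a truncated binomial series. -/
theorem one_sub_mul_sum_rising {R : Type*} [CommRing R] [Algebra K R] (x : K) (z : R) (M : ℕ) :
    (1 - z) * ∑ b ∈ Finset.range (M + 1), rising K (x + 1) b • z ^ b =
      ∑ b ∈ Finset.range (M + 1), rising K x b • z ^ b - rising K (x + 1) M • z ^ (M + 1) := by
  induction M with
  | zero =>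
    simp [rising]
  | succ M ih =>
    rw [Finset.sum_range_succ, mul_add, ih, Finset.sum_range_succ _ (M + 1), rising_add_one]
    simp only [Algebra.smul_def, map_add]
    ring

/-- Modulo the ideal, the series for a vertex correction with `N + 1` vertices agrees with that for
a fermion self-energy with `N` vertices. -/
theorem coeff_insertionSeries_sub_mem {N M n : ℕ} (hN : N < M) (hn : n ≤ M) :
    PowerSeries.coeff n (insertionSeries K .psipsiphi (N + 1) (M + 1) -
      insertionSeries K .psipsi N (M + 1)) ∈ wardIdealGrad K := by
  let q := PowerSeries.mapAlgHom (R := K) (Ideal.Quotient.mkₐ K (wardIdealGrad K))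
  have hq : ∀ W n, PowerSeries.coeff n (q W) =
      Ideal.Quotient.mk (wardIdealGrad K) (PowerSeries.coeff n W) := fun W n => by
    rw [PowerSeries.mapAlgHom_apply, PowerSeries.coeff_map]
    rfl
  rw [← Ideal.Quotient.eq_zero_iff_mem, ← hq, map_sub]
  have hz : q (vertexSeries K) = - q (graphSeries K .psipsi) := by
    rw [eq_neg_iff_add_eq_zero, ← map_add]
    ext n : 1
    rw [hq, map_zero, Ideal.Quotient.eq_zero_iff_mem, map_add, add_comm, vertexSeries, graphSeries,
      PowerSeries.coeff_mk, PowerSeries.coeff_mk]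
    exact wardSum_mem K n
  have hX : PowerSeries.X ∣ q (graphSeries K .psipsi) := by
    rw [PowerSeries.X_dvd_iff, ← PowerSeries.coeff_zero_eq_constantCoeff_apply, hq, graphSeries,
      PowerSeries.coeff_mk]
    have : gradSum K .psipsi 0 = 0 := Subtype.ext (labelledSum_zero K _)
    rw [this, map_zero]
  obtain ⟨z, hz'⟩ : ∃ z, q (graphSeries K .psipsi) = z := ⟨_, rfl⟩
  rw [hz'] at hz hX
  simp only [insertionSeries, map_mul, map_sum, map_smul, map_pow, hz, hz',
    sum_choose_smul_pow K z hN.le, sum_choose_smul_pow K z (Nat.succ_le_of_lt hN), Residue.legs]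
  have h₁ : ((N + 1 : ℕ) : K) - (1 : ℕ) = ((N : K) - (1 : ℕ)) + 1 := by
    push_cast
    ring
  have h₂ : (((N + 1 : ℕ) : K) - (1 : ℕ)) / 2 = ((N : K) - (0 : ℕ)) / 2 := by
    push_cast
    ring
  rw [h₂, h₁, pow_succ]
  have h₃ := one_sub_mul_sum_rising K ((N : K) - (1 : ℕ)) z M
  generalize ∑ d ∈ Finset.range (M + 1), rising K (((N : K) - (0 : ℕ)) / 2) d •
    q (graphSeries K .phiphi) ^ d = s at *
  generalize ∑ b ∈ Finset.range (M + 1), rising K ((N : K) - (1 : ℕ) + 1) b • z ^ b = u at *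
  generalize ∑ b ∈ Finset.range (M + 1), rising K ((N : K) - (1 : ℕ)) b • z ^ b = v at *
  have h₄ : (1 - z) ^ N * (1 - z) * (u * s) - (1 - z) ^ N * (v * s) =
      (1 - z) ^ N * s * -(rising K ((N : K) - (1 : ℕ) + 1) M • z ^ (M + 1)) := by
    linear_combination (1 - z) ^ N * s * h₃
  rw [h₄]
  exact PowerSeries.X_pow_dvd_iff.1 (pow_dvd_mul_neg_smul_pow K hX _ _ _) n (Nat.lt_succ_of_le hn)

/-- The coproduct of a generator of the ideal. -/
theorem comul_wardSum_mem {I B : Submodule K (H K)} (hB : ∀ x : Hgrad K, (x : H K) ∈ B)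
    (hI : ∀ x ∈ wardIdealGrad K, (x : H K) ∈ I) (n : ℕ) :
    comul K (wardSum K n : H K) ∈ tensorSub K I B ⊔ tensorSub K B I := by
  obtain ⟨M, hM⟩ : ∃ M, n + 1 + 2 ^ (n + 1) < M := ⟨_, Nat.lt_succ_self _⟩
  have hnM : n < M := (Nat.le_succ n).trans_lt ((Nat.le_add_right _ _).trans_lt hM)
  have hM' : n + 2 ^ n < M + 1 := by
    have := Nat.pow_le_pow_right (n := 2) (by norm_num) (Nat.le_succ n)
    omega
  have hshift : ∀ (r : Residue) (N m : ℕ) (W : PowerSeries (Hgrad K)), coeffTensor K r (N + 1)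
      (PowerSeries.X * (PowerSeries.X ^ (N + 1 - 1) * W)) (m + 1) =
      coeffTensor K r (N + 1) (PowerSeries.X ^ N * W) m := fun r N m W => by
    rw [coeffTensor, PowerSeries.coeff_succ_X_mul, Nat.add_sub_cancel]
    rfl
  have h₀ : ∀ r W n, coeffTensor K r 0 W n = 0 := fun r W n => by
    rw [coeffTensor, labelledSum_zero, TensorProduct.tmul_zero]
  have hψ : ∀ N ∈ Finset.range (M + 1), coeffTensor K .psipsi N
      (PowerSeries.X * (PowerSeries.X ^ (N - 1) * insertionSeries K .psipsi N (M + 1))) n =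
      coeffTensor K .psipsi N (PowerSeries.X ^ N * insertionSeries K .psipsi N (M + 1)) n := by
    intro N _
    rcases Nat.eq_zero_or_pos N with rfl | hN
    · rw [h₀, h₀]
    · rw [← mul_assoc, ← pow_succ', Nat.sub_add_cancel hN]
  have hlast : coeffTensor K .psipsi M
      (PowerSeries.X ^ M * insertionSeries K .psipsi M (M + 1)) n = 0 := by
    rw [coeffTensor, PowerSeries.X_pow_dvd_iff.1 (Dvd.intro _ rfl) n hnM,
      ZeroMemClass.coe_zero, TensorProduct.zero_tmul]
  have h₁ := comul_labelledSum_eq K .psipsi hM'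
  rw [Finset.sum_congr rfl hψ, Finset.sum_range_succ, hlast, add_zero] at h₁
  have h₂ := comul_labelledSum_eq K .psipsiphi (hM.trans (Nat.lt_succ_self M))
  rw [Finset.sum_range_succ', h₀, add_zero, Finset.sum_congr rfl fun N _ => hshift _ N n _] at h₂
  have hw : (wardSum K n : H K) = labelledSum K .psipsi n + labelledSum K .psipsiphi (n + 1) := rfl
  have hsum : comul K (wardSum K n : H K) = (wardSum K n : H K) ⊗ₜ[K] 1 +
      ∑ N ∈ Finset.range M, (((PowerSeries.coeff n (PowerSeries.X ^ N *
        insertionSeries K .psipsi N (M + 1)) : Hgrad K) : H K) ⊗ₜ[K] (wardSum K N : H K) +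
        ((PowerSeries.coeff n (PowerSeries.X ^ N * (insertionSeries K .psipsiphi (N + 1) (M + 1) -
          insertionSeries K .psipsi N (M + 1))) : Hgrad K) : H K) ⊗ₜ[K]
          labelledSum K .psipsiphi (N + 1)) := by
    rw [hw, map_add, h₁, h₂, add_add_add_comm, ← TensorProduct.add_tmul,
      ← Finset.sum_add_distrib]
    congr 1
    refine Finset.sum_congr rfl fun N _ => ?_
    have hw' : (wardSum K N : H K) =
      labelledSum K .psipsi N + labelledSum K .psipsiphi (N + 1) := rfl
    rw [hw', mul_sub, map_sub, AddSubgroupClass.coe_sub, TensorProduct.sub_tmul,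
      TensorProduct.tmul_add, coeffTensor, coeffTensor]
    abel
  rw [hsum]
  refine add_mem (Submodule.mem_sup_left (tmul_mem_tensorSub K (hI _ (wardSum_mem K n)) ?_))
    (sum_mem fun N hN => add_mem (Submodule.mem_sup_right (tmul_mem_tensorSub K (hB _)
      (hI _ (wardSum_mem K N)))) (Submodule.mem_sup_left (tmul_mem_tensorSub K (hI _ ?_)
        (hB (gradSum K .psipsiphi (N + 1))))))
  · exact hB 1
  · rw [PowerSeries.coeff_X_pow_mul']
    split_ifs
    · exact coeff_insertionSeries_sub_mem K (Finset.mem_range.1 hN) ((Nat.sub_le _ _).trans hnM.le)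
    · exact zero_mem _

theorem isCoidealOf_wardIdeal :
    IsCoidealOf K ⊤ ((wardIdeal K).restrictScalars K) := by
  have h := isCoidealOf_map K (AlgHom.id K (H K)) (Set.range (wardElement K))
  have hr : LinearMap.range (AlgHom.id K (H K)).toLinearMap = ⊤ := LinearMap.range_id
  have hm : ((Ideal.span (Set.range (wardElement K))).restrictScalars K).map
      (AlgHom.id K (H K)).toLinearMap = (wardIdeal K).restrictScalars K := Submodule.map_id _
  rw [hr, hm] at h
  refine h (fun x => ?_) ?_ ?_
  · rw [tensorSub, TensorProduct.map₂_mk_top_top_eq_top]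
    exact Submodule.mem_top
  · rintro _ ⟨k, rfl⟩
    rw [AlgHom.id_apply, ← wardSum_two_mul]
    refine comul_wardSum_mem K (fun _ => Submodule.mem_top) ?_ _
    have hle : wardIdealGrad K ≤ (wardIdeal K).comap (Hgrad K).val :=
      Ideal.span_le.2 fun x ⟨k, hk⟩ => by
        change (x : H K) ∈ wardIdeal K
        rw [hk]
        exact Ideal.subset_span ⟨k, rfl⟩
    exact fun x hx => hle hx
  · rintro _ ⟨k, rfl⟩
    exact counit_wardElement K k

theorem isCoidealOf_wardIdealGrad : IsCoidealOf K (Subalgebra.toSubmodule (Hgrad K))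
    (((wardIdealGrad K).restrictScalars K).map (Hgrad K).val.toLinearMap) := by
  have h := isCoidealOf_map K (Hgrad K).val {x | ∃ k, (x : H K) = wardElement K k}
  have hr : LinearMap.range (Hgrad K).val.toLinearMap = Subalgebra.toSubmodule (Hgrad K) :=
    Submodule.range_subtype (Subalgebra.toSubmodule (Hgrad K))
  rw [hr] at h
  refine h (fun x => comul_mem_of_mem_Hgrad K x.2) ?_ ?_
  · rintro x ⟨k, hk⟩
    have hx : (Hgrad K).val x = (wardSum K (2 * k) : H K) := hk.trans (wardSum_two_mul K k).symm
    rw [hx]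
    exact comul_wardSum_mem K (I := ((wardIdealGrad K).restrictScalars K).map _) (fun x => x.2)
      (fun x hx => Submodule.mem_map.2 ⟨x, hx, rfl⟩) _
  · rintro x ⟨k, hk⟩
    exact (congrArg (counit K) hk).trans (counit_wardElement K k)

end

/-! ### Amplitudes of graphs with arbitrary vertex sets -/

section


variable {V W : Type} {ι : Type*} {G : Type*}

section Loops

/-- The fermion lines of isomorphic graphs correspond. -/
theorem card_quot_ferm_relabel (e : V ≃ W) (Γ : Diagram V) :
    Nat.card (Quot (Γ.relabel e).ferm) = Nat.card (Quot Γ.ferm) :=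
  (Nat.card_congr (Quot.congr e fun u v => by simp [relabel])).symm

/-- A new vertex on a fermion line does not change the number of lines. -/
theorem card_quot_ferm_insertScalar {Γ : Diagram V} {a b : V} (hab : Γ.ferm a b) :
    Nat.card (Quot (Γ.insertScalar a b).ferm) = Nat.card (Quot Γ.ferm) := by
  have h₁ : Quot.mk (Γ.insertScalar a b).ferm (some a) = Quot.mk _ none := Quot.sound rfl
  have h₂ : Quot.mk (Γ.insertScalar a b).ferm none = Quot.mk _ (some b) := Quot.sound rfl
  refine Nat.card_congr
    { toFun := Quot.lift (fun o => Quot.mk Γ.ferm (o.getD a)) ?_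
      invFun := Quot.lift (fun u => Quot.mk _ (some u)) ?_
      left_inv := ?_
      right_inv := ?_ }
  · rintro (_ | u) (_ | v) h
    · rfl
    · obtain rfl : v = b := h
      exact Quot.sound hab
    · obtain rfl : u = a := h
      rfl
    · exact Quot.sound h.1
  · intro u v huv
    by_cases h : u = a ∧ v = b
    · rw [h.1, h.2]
      exact h₁.trans h₂
    · exact Quot.sound ⟨huv, h⟩
  · rintro ⟨_ | u⟩
    · exact h₁
    · rfl
  · rintro ⟨u⟩
    rfl

theorem exists_insertScalar_ferm_left {Γ : Diagram V} {a b : V} (hab : Γ.ferm a b) (o : Option V) :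
    (∃ o', (Γ.insertScalar a b).ferm o' o) ↔ ∀ v, o = some v → ∃ u, Γ.ferm u v := by
  rcases o with _ | v
  · exact ⟨fun _ => nofun, fun _ => ⟨some a, rfl⟩⟩
  · constructor
    · rintro ⟨_ | u, h⟩ _ ⟨⟩
      · obtain rfl : v = b := h
        exact ⟨a, hab⟩
      · exact ⟨u, h.1⟩
    · intro h
      obtain ⟨u, hu⟩ := h v rfl
      by_cases h : u = a ∧ v = b
      · exact ⟨none, h.2⟩
      · exact ⟨some u, hu, h⟩

theorem exists_insertScalar_ferm_right {Γ : Diagram V} {a b : V} (hab : Γ.ferm a b)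
    (o : Option V) :
    (∃ o', (Γ.insertScalar a b).ferm o o') ↔ ∀ u, o = some u → ∃ v, Γ.ferm u v := by
  rcases o with _ | u
  · exact ⟨fun _ => nofun, fun _ => ⟨some b, rfl⟩⟩
  · constructor
    · rintro ⟨_ | v, h⟩ _ ⟨⟩
      · obtain rfl : u = a := h
        exact ⟨b, hab⟩
      · exact ⟨v, h.1⟩
    · intro h
      obtain ⟨v, hv⟩ := h u rfl
      by_cases h : u = a ∧ v = b
      · exact ⟨none, h.1⟩
      · exact ⟨some v, hv, h⟩

theorem exists_insertScalar_scal {Γ : Diagram V} {a b : V} (o : Option V) :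
    (∃ o', (Γ.insertScalar a b).scal o o') ↔ ∃ u v, o = some u ∧ Γ.scal u v := by
  rcases o with _ | u
  · exact ⟨fun ⟨o', h⟩ => by cases o' <;> exact h.elim, by rintro ⟨u, v, ⟨⟩, -⟩⟩
  · constructor
    · rintro ⟨_ | v, h⟩
      · exact h.elim
      · exact ⟨u, v, rfl, h⟩
    · rintro ⟨_, v, ⟨⟩, h⟩
      exact ⟨some v, h⟩

theorem nOut_insertScalar {Γ : Diagram V} {a b : V} (hab : Γ.ferm a b) :
    (Γ.insertScalar a b).nOut = Γ.nOut := by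
  refine (Nat.card_congr (Equiv.ofBijective (fun u : {u : V // ¬ ∃ v, Γ.ferm u v} =>
    (⟨some u.1, fun h => u.2 ((exists_insertScalar_ferm_right hab _).1 h u.1 rfl)⟩ :
      {o : Option V // ¬ ∃ o', (Γ.insertScalar a b).ferm o o'})) ⟨fun u v h => ?_, ?_⟩)).symm
  · exact Subtype.ext (Option.some_injective _ (congrArg Subtype.val h))
  · rintro ⟨_ | u, hu⟩
    · exact (hu ⟨some b, rfl⟩).elim
    · exact ⟨⟨u, fun h => hu ((exists_insertScalar_ferm_right hab _).2 fun _ h' =>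
        Option.some_injective _ h' ▸ h)⟩, rfl⟩

end Loops

section Momenta

variable [AddCommGroup G]

/-- Momentum conservation, for a graph with an arbitrary vertex set. -/
structure Conserves (F : Rules G ι) (Γ : Diagram V) (p : G) (q : (V → G) × (V → G)) : Prop where
  internal : ∀ u v, Γ.ferm u v → q.2 u = q.1 v ∧ q.1 v ∈ F.cutoff
  incoming : ∀ v, (¬ ∃ u, Γ.ferm u v) → q.1 v = p
  outgoing : ∀ u, (¬ ∃ v, Γ.ferm u v) → q.2 u = p
  scalar : ∀ u v, Γ.scal u v → (q.2 u - q.1 u) + (q.2 v - q.1 v) = 0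
  scalarExt : ∀ u, (¬ ∃ v, Γ.scal u v) → q.2 u - q.1 u = 0

variable {F : Rules G ι} {Γ : Diagram V} {p : G} {q : (V → G) × (V → G)}

open Classical in
/-- The finite set of the momenta of all lines allowed by momentum conservation. -/
noncomputable def momenta [Fintype V] (F : Rules G ι) (Γ : Diagram V) (p : G) :
    Finset ((V → G) × (V → G)) :=
  (Fintype.piFinset (fun _ => insert p F.cutoff) ×ˢ
    Fintype.piFinset (fun _ => insert p F.cutoff)).filter (Conserves F Γ p)

theorem Conserves.mem_cutoff (h : Conserves F Γ p q) (v : V) :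
    (q.1 v = p ∨ q.1 v ∈ F.cutoff) ∧ (q.2 v = p ∨ q.2 v ∈ F.cutoff) := by
  constructor
  · by_cases hv : ∃ u, Γ.ferm u v
    · obtain ⟨u, hu⟩ := hv
      exact .inr (h.internal u v hu).2
    · exact .inl (h.incoming v hv)
  · by_cases hv : ∃ w, Γ.ferm v w
    · obtain ⟨w, hw⟩ := hv
      have := h.internal v w hw
      exact .inr (this.1 ▸ this.2)
    · exact .inl (h.outgoing v hv)

theorem mem_momenta [Fintype V] : q ∈ momenta F Γ p ↔ Conserves F Γ p q := by
  classical
  rw [momenta, Finset.mem_filter, Finset.mem_product, Fintype.mem_piFinset, Fintype.mem_piFinset]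
  refine and_iff_right_of_imp fun h => ⟨fun v => ?_, fun v => ?_⟩
  · exact Finset.mem_insert.2 (h.mem_cutoff v).1
  · exact Finset.mem_insert.2 (h.mem_cutoff v).2

theorem conserves_relabel (e : V ≃ W) {q : (W → G) × (W → G)} :
    Conserves F (Γ.relabel e) p q ↔ Conserves F Γ p (q.1 ∘ e, q.2 ∘ e) := by
  have h₁ : ∀ v, (∃ u, Γ.ferm u v) ↔ ∃ u, (Γ.relabel e).ferm u (e v) := fun v =>
    e.exists_congr (by simp [relabel])
  have h₂ : ∀ u, (∃ v, Γ.ferm u v) ↔ ∃ v, (Γ.relabel e).ferm (e u) v := fun v =>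
    e.exists_congr (by simp [relabel])
  have h₃ : ∀ u, (∃ v, Γ.scal u v) ↔ ∃ v, (Γ.relabel e).scal (e u) v := fun v =>
    e.exists_congr (by simp [relabel])
  constructor
  · intro h
    refine ⟨fun u v huv => h.internal _ _ (by simpa [relabel]), fun v hv => h.incoming _ ?_,
      fun u hu => h.outgoing _ ?_, fun u v huv => h.scalar _ _ (by simpa [relabel]),
      fun u hu => h.scalarExt _ ?_⟩
    · rwa [← h₁]
    · rwa [← h₂]
    · rwa [← h₃]
  · intro h
    refine ⟨fun u v huv => ?_, fun v hv => ?_, fun u hu => ?_, fun u v huv => ?_, fun u hu => ?_⟩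
    · simpa using h.internal _ _ huv
    · simpa using h.incoming (e.symm v) (by rwa [h₁, e.apply_symm_apply])
    · simpa using h.outgoing (e.symm u) (by rwa [h₂, e.apply_symm_apply])
    · simpa using h.scalar _ _ huv
    · simpa using h.scalarExt (e.symm u) (by rwa [h₃, e.apply_symm_apply])

/-- The momenta of a graph determine those of the graph with a new vertex on a fermion propagator:
no momentum enters at the new vertex. -/
theorem conserves_insertScalar {a b : V} (hab : Γ.ferm a b)
    {q : (Option V → G) × (Option V → G)} :
    Conserves F (Γ.insertScalar a b) p q ↔
      Conserves F Γ p (q.1 ∘ some, q.2 ∘ some) ∧ q.1 none = q.1 (some b) ∧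
        q.2 none = q.1 (some b) := by
  have hl := exists_insertScalar_ferm_left hab
  have hr := exists_insertScalar_ferm_right hab
  have hs := exists_insertScalar_scal (Γ := Γ) (a := a) (b := b)
  constructor
  · intro h
    have h₁ := h.internal (some a) none rfl
    have h₂ := h.internal none (some b) rfl
    have h₃ := h.scalarExt none (by simp [hs])
    have h₄ : q.1 none = q.1 (some b) := by rw [← h₂.1, sub_eq_zero.1 h₃]
    refine ⟨⟨fun u v huv => ?_, fun v hv => ?_, fun u hu => ?_, fun u v huv => ?_,
      fun u hu => ?_⟩, h₄, h₂.1⟩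
    · by_cases he : u = a ∧ v = b
      · obtain ⟨rfl, rfl⟩ := he
        exact ⟨h₁.1.trans h₄, h₂.2⟩
      · exact h.internal (some u) (some v) ⟨huv, he⟩
    · exact h.incoming (some v) (by simpa [hl] using hv)
    · exact h.outgoing (some u) (by simpa [hr] using hu)
    · exact h.scalar (some u) (some v) huv
    · exact h.scalarExt (some u) (by simpa [hs] using hu)
  · rintro ⟨h, h₁, h₂⟩
    have hb := h.internal a b hab
    refine ⟨?_, ?_, ?_, ?_, ?_⟩
    · rintro (_ | u) (_ | v) huv
      · exact huv.elim
      · obtain rfl : v = b := huv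
        exact ⟨h₂, hb.2⟩
      · obtain rfl : u = a := huv
        rw [h₁]
        exact hb
      · exact h.internal u v huv.1
    · rintro (_ | v) hv
      · exact (hv ⟨some a, rfl⟩).elim
      · exact h.incoming v (by simpa [hl] using hv)
    · rintro (_ | u) hu
      · exact (hu ⟨some b, rfl⟩).elim
      · exact h.outgoing u (by simpa [hr] using hu)
    · rintro (_ | u) (_ | v) huv
      · exact huv.elim
      · exact huv.elim
      · exact huv.elim
      · exact h.scalar u v huv
    · rintro (_ | u) hu
      · rw [h₁, h₂, sub_self]
      · exact h.scalarExt u (by simpa [hs] using hu)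

end Momenta

section Amplitude

/-- The spinor indices at the ends of the open fermion line are prescribed. -/
def HasSpinorIndices (Γ : Diagram V) (i j : ι) (s : V → ι) : Prop :=
  (∀ v, (¬ ∃ u, Γ.ferm u v) → s v = j) ∧ (∀ u, (¬ ∃ v, Γ.ferm u v) → s u = i)

theorem hasSpinorIndices_relabel (e : V ≃ W) {Γ : Diagram V} {i j : ι} {s : W → ι} :
    HasSpinorIndices (Γ.relabel e) i j s ↔ HasSpinorIndices Γ i j (s ∘ e) := by
  have h₁ : ∀ v, (∃ u, Γ.ferm u v) ↔ ∃ u, (Γ.relabel e).ferm u (e v) := fun v =>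
    e.exists_congr (by simp [relabel])
  have h₂ : ∀ u, (∃ v, Γ.ferm u v) ↔ ∃ v, (Γ.relabel e).ferm (e u) v := fun v =>
    e.exists_congr (by simp [relabel])
  rw [HasSpinorIndices, HasSpinorIndices, ← e.forall_congr_right, ← e.forall_congr_right (q := fun u =>
    (¬ ∃ v, (Γ.relabel e).ferm u v) → s u = i)]
  simp only [h₁, h₂, Function.comp_apply]

theorem hasSpinorIndices_insertScalar {Γ : Diagram V} {a b : V} (hab : Γ.ferm a b) {i j : ι}
    {s : Option V → ι} :
    HasSpinorIndices (Γ.insertScalar a b) i j s ↔ HasSpinorIndices Γ i j (s ∘ some) := by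
  simp [HasSpinorIndices, exists_insertScalar_ferm_left hab, exists_insertScalar_ferm_right hab,
    Option.forall]

variable [Fintype ι] [DecidableEq ι] [AddCommGroup G] [Fintype V] [Fintype W]

open Classical in
/-- The product of the fermion propagators. -/
noncomputable def fermionFactor (F : Rules G ι) (Γ : Diagram V) (m : ℝ) (k' : V → G)
    (s : V → ι) : ℂ :=
  ∏ u, ∏ v, if Γ.ferm u v then F.fermionProp m (k' u) (s v) (s u) else 1

open Classical in
/-- The product of the scalar propagators; the numbering `ord` of the vertices selects one of the
two orientations of each propagator. -/
noncomputable def scalarFactor (F : Rules G ι) (Γ : Diagram V) (ord : V → ℕ)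
    (q : (V → G) × (V → G)) : ℂ :=
  ∏ u, ∏ v, if ord u < ord v ∧ Γ.scal u v then F.scalarProp (q.2 u - q.1 u) else 1

open Classical in
/-- The amplitude of a graph with an arbitrary vertex set. -/
noncomputable def amplitudeOn (F : Rules G ι) (p : G) (Γ : Diagram V) (ord : V → ℕ) (m : ℝ)
    (i j : ι) : ℂ :=
  (-1) ^ (Nat.card (Quot Γ.ferm) - Γ.nOut) * ∑ q ∈ momenta F Γ p,
    (∑ s : V → ι with HasSpinorIndices Γ i j s, fermionFactor F Γ m q.2 s) *
      scalarFactor F Γ ord q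

/-- The order of the vertices only serves to choose one of the two orientations of a scalar propagator;
for `Fin n` it is the order of the labels. -/
theorem amplitude_eq_amplitudeOn {n : ℕ} (F : Rules G ι) (p : G) (Γ : Diagram (Fin n)) (m : ℝ)
    (i j : ι) : amplitude F p Γ m i j = amplitudeOn F p Γ Fin.val m i j := by
  classical
  rw [amplitude, Matrix.of_apply, amplitudeOn, closedLoops]
  congr 1
  refine Finset.sum_congr ?_ fun q _ => ?_
  · ext q
    rw [mem_momenta, Finset.mem_filter]
    have h : Conserved F Γ p q.1 q.2 ↔ Conserves F Γ p q :=
      ⟨fun h => ⟨h.1, h.2, h.3, h.4, h.5⟩, fun h => ⟨h.1, h.2, h.3, h.4, h.5⟩⟩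
    rw [h]
    refine and_iff_right_of_imp fun hq => ?_
    simp only [Finset.mem_product, Fintype.mem_piFinset, Finset.mem_insert]
    exact ⟨fun v => (hq.mem_cutoff v).1, fun v => (hq.mem_cutoff v).2⟩
  · rw [integrand, Finset.sum_mul]
    refine Finset.sum_congr ?_ fun s _ => ?_
    · ext s
      rw [Finset.mem_filter, Finset.mem_filter, HasSpinorIndices]
      -- the two sums use different decision procedures for equality of vertices
      have hu : ∀ I : Fintype (Fin n → ι), s ∈ @Finset.univ _ I := fun I => @Finset.mem_univ _ I s
      exact and_congr (iff_of_true (hu _) (hu _)) Iff.rfl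
    · rw [fermionFactor, scalarFactor]
      congr 1

theorem amplitudeOn_relabel (F : Rules G ι) (p : G) (e : V ≃ W) (Γ : Diagram V) (ord : W → ℕ)
    (m : ℝ) (i j : ι) :
    amplitudeOn F p (Γ.relabel e) ord m i j = amplitudeOn F p Γ (ord ∘ e) m i j := by
  classical
  have hO : (Γ.relabel e).nOut = Γ.nOut := ((isomorphic_relabel e Γ).nLeg .out).symm
  rw [amplitudeOn, amplitudeOn, card_quot_ferm_relabel, hO]
  congr 1
  refine Finset.sum_bij (fun q _ => (q.1 ∘ e, q.2 ∘ e)) (fun q hq => ?_) (fun q _ q' _ h => ?_)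
    (fun q hq => ?_) fun q _ => ?_
  · rw [mem_momenta] at hq ⊢
    exact (conserves_relabel e).1 hq
  · obtain ⟨h₁, h₂⟩ := Prod.mk.inj h
    exact Prod.ext (e.surjective.injective_comp_right h₁) (e.surjective.injective_comp_right h₂)
  · refine ⟨(q.1 ∘ e.symm, q.2 ∘ e.symm), ?_, ?_⟩
    · rw [mem_momenta] at hq ⊢
      rw [conserves_relabel]
      simpa [Function.comp_assoc] using hq
    · simp [Function.comp_assoc]
  · congr 1
    · refine Finset.sum_bij (fun s _ => s ∘ e) (fun s hs => ?_) (fun s _ s' _ h => ?_)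
        (fun s hs => ?_) fun s _ => ?_
      · rw [Finset.mem_filter_univ] at hs ⊢
        exact (hasSpinorIndices_relabel e).1 hs
      · exact e.surjective.injective_comp_right h
      · refine ⟨s ∘ e.symm, ?_, by simp [Function.comp_assoc]⟩
        rw [Finset.mem_filter_univ] at hs ⊢
        rw [hasSpinorIndices_relabel]
        simpa [Function.comp_assoc] using hs
      · rw [fermionFactor, fermionFactor]
        refine (Fintype.prod_equiv e _ _ fun u => Fintype.prod_equiv e _ _ fun v => ?_).symm
        simp [relabel]
    · rw [scalarFactor, scalarFactor]
      refine (Fintype.prod_equiv e _ _ fun u => Fintype.prod_equiv e _ _ fun v => ?_).symm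
      simp [relabel]

/-- The amplitude does not depend on the numbering of the vertices, as the scalar propagator is an
even function. -/
theorem amplitudeOn_ord (F : Rules G ι) (p : G) {Γ : Diagram V} (hΓ : Γ.IsFeynman)
    {ord ord' : V → ℕ} (h : ∀ u v, Γ.scal u v → ord u ≠ ord v)
    (h' : ∀ u v, Γ.scal u v → ord' u ≠ ord' v) (m : ℝ) (i j : ι) :
    amplitudeOn F p Γ ord m i j = amplitudeOn F p Γ ord' m i j := by
  classical
  rw [amplitudeOn, amplitudeOn]
  congr 1
  refine Finset.sum_congr rfl fun q hq => ?_
  congr 1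
  rw [mem_momenta] at hq
  have hsymm : ∀ u v, Γ.scal u v → F.scalarProp (q.2 v - q.1 v) = F.scalarProp (q.2 u - q.1 u) :=
    fun u v huv => by rw [← neg_eq_of_add_eq_zero_right (hq.scalar u v huv), F.scalarProp_neg]
  have hpair : ∀ o : V → ℕ, scalarFactor F Γ o q =
      ∏ e : V × V with o e.1 < o e.2 ∧ Γ.scal e.1 e.2, F.scalarProp (q.2 e.1 - q.1 e.1) :=
    fun o => by
      rw [scalarFactor, Finset.prod_filter, Fintype.prod_prod_type]
  rw [hpair, hpair]
  have key : ∀ {o o' : V → ℕ}, (∀ u v, Γ.scal u v → o' u ≠ o' v) → ∀ e ∈ (Finset.univ.filter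
      fun e : V × V => o e.1 < o e.2 ∧ Γ.scal e.1 e.2), (if o' e.1 < o' e.2 then e else e.swap) ∈
        (Finset.univ.filter fun e : V × V => o' e.1 < o' e.2 ∧ Γ.scal e.1 e.2) := by
    intro o o' ho' e he
    rw [Finset.mem_filter_univ] at he ⊢
    split_ifs with hlt
    · exact ⟨hlt, he.2⟩
    · exact ⟨lt_of_le_of_ne (not_lt.1 hlt) (ho' _ _ he.2).symm, hΓ.scal_symm _ _ he.2⟩
  have hinv : ∀ {o o' : V → ℕ}, ∀ e ∈ (Finset.univ.filter
      fun e : V × V => o e.1 < o e.2 ∧ Γ.scal e.1 e.2),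
      (if o (if o' e.1 < o' e.2 then e else e.swap).1 < o (if o' e.1 < o' e.2 then e else e.swap).2
        then (if o' e.1 < o' e.2 then e else e.swap)
        else (if o' e.1 < o' e.2 then e else e.swap).swap) = e := by
    intro o o' e he
    rw [Finset.mem_filter_univ] at he
    split_ifs with h₁ h₂ h₂
    · rfl
    · exact (h₂ he.1).elim
    · exact (lt_asymm he.1 h₂).elim
    · rfl
  refine Finset.prod_bij' (fun e _ => if ord' e.1 < ord' e.2 then e else e.swap)
    (fun e _ => if ord e.1 < ord e.2 then e else e.swap) (key h') (key h) hinv hinv ?_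
  intro e he
  rw [Finset.mem_filter_univ] at he
  split_ifs
  · rfl
  · exact (hsymm _ _ he.2).symm

/-- Isomorphic graphs have the same amplitude. -/
theorem amplitudeOn_congr (F : Rules G ι) (p : G) {Γ : Diagram V} {Γ' : Diagram W}
    (hΓ : Γ.IsFeynman) (h : Γ.Isomorphic Γ') {ord : V → ℕ} {ord' : W → ℕ}
    (ho : ∀ u v, Γ.scal u v → ord u ≠ ord v) (ho' : ∀ u v, Γ'.scal u v → ord' u ≠ ord' v) (m : ℝ)
    (i j : ι) : amplitudeOn F p Γ ord m i j = amplitudeOn F p Γ' ord' m i j := by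
  obtain ⟨e, he⟩ := h
  rw [isIso_iff_relabel] at he
  subst he
  rw [amplitudeOn_relabel]
  refine amplitudeOn_ord F p hΓ ho (fun u v huv => ho' _ _ ?_) m i j
  simpa [relabel] using huv

end Amplitude

end

/-! ### The mass derivative of an amplitude -/

section


variable {V W : Type} {ι : Type*} {G : Type*} [AddCommGroup G]

/-- Differentiation of a free propagator inserts a unit matrix between two copies of it. -/
theorem Rules.hasDerivAt_fermionProp [Fintype ι] [DecidableEq ι] (F : Rules G ι) {m : ℝ} {k : G}
    (hk : IsUnit (F.dirac k - (m : ℂ) • (1 : Matrix ι ι ℂ)).det) (x y : ι) :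
    HasDerivAt (fun μ : ℝ => F.fermionProp μ k x y)
      ((F.fermionProp m k * F.fermionProp m k) x y) m := by
  have hcont : Continuous fun μ : ℝ => F.dirac k - (μ : ℂ) • (1 : Matrix ι ι ℂ) := by fun_prop
  have hinv : ∀ μ, F.fermionProp μ k = (F.dirac k - (μ : ℂ) • (1 : Matrix ι ι ℂ)).det⁻¹ •
      (F.dirac k - (μ : ℂ) • (1 : Matrix ι ι ℂ)).adjugate := fun μ => by
    rw [Rules.fermionProp, Matrix.inv_def, Ring.inverse_eq_inv']
  have hP : ContinuousAt (fun μ : ℝ => F.fermionProp μ k) m := by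
    simp only [hinv]
    exact (hcont.matrix_det.continuousAt.inv₀ hk.ne_zero).smul hcont.matrix_adjugate.continuousAt
  have hPP : ContinuousAt (fun μ : ℝ => (F.fermionProp μ k * F.fermionProp m k) x y) m :=
    (continuousAt_apply y _).comp ((continuousAt_apply x _).comp (hP.mul continuousAt_const))
  have hne : ∀ᶠ μ : ℝ in nhds m, (F.dirac k - (μ : ℂ) • (1 : Matrix ι ι ℂ)).det ≠ 0 :=
    hcont.matrix_det.continuousAt.eventually_ne hk.ne_zero
  rw [hasDerivAt_iff_tendsto_slope]
  refine (hPP.tendsto.mono_left nhdsWithin_le_nhds).congr' ?_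
  filter_upwards [hne.filter_mono nhdsWithin_le_nhds, self_mem_nhdsWithin] with μ hμ hμm
  -- the resolvent identity
  have h : F.fermionProp μ k - F.fermionProp m k =
      ((μ - m : ℝ) : ℂ) • (F.fermionProp μ k * F.fermionProp m k) := by
    rw [Rules.fermionProp, Rules.fermionProp, Matrix.inv_sub_inv (iff_of_true
      ((Matrix.isUnit_iff_isUnit_det _).2 hμ.isUnit) ((Matrix.isUnit_iff_isUnit_det _).2 hk)),
      sub_sub_sub_cancel_left, ← sub_smul, ← Complex.ofReal_sub, Matrix.mul_smul, Matrix.mul_one,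
      Matrix.smul_mul]
  have h' := congrFun (congrFun h x) y
  rw [Matrix.sub_apply, Matrix.smul_apply] at h'
  have hne' : μ - m ≠ 0 := sub_ne_zero.2 hμm
  rw [slope_def_module, h', smul_eq_mul, ← Complex.real_smul, smul_smul, inv_mul_cancel₀ hne',
    one_smul]

section Derivative

theorem sum_spinors_insertScalar [Fintype ι] {Γ : Diagram V} {a b : V} (hab : Γ.ferm a b) (i j : ι)
    {I : Fintype (Option V → ι)} {I' : Fintype (V → ι)}
    {d : DecidablePred (HasSpinorIndices (Γ.insertScalar a b) i j)}
    {d' : DecidablePred (HasSpinorIndices Γ i j)} (f : (Option V → ι) → ℂ) :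
    ∑ s : Option V → ι with HasSpinorIndices (Γ.insertScalar a b) i j s, f s =
      ∑ s : V → ι with HasSpinorIndices Γ i j s, ∑ x, f fun o => o.elim x s := by
  rw [Finset.sum_filter, Finset.sum_filter, Fintype.sum_equiv (Equiv.piOptionEquivProd)
    _ (fun y : ι × (V → ι) => if HasSpinorIndices Γ i j y.2 then f (fun o => o.elim y.1 y.2) else 0)
    fun s => ?_, Fintype.sum_prod_type, Finset.sum_comm]
  · refine Finset.sum_congr rfl fun s _ => ?_
    split_ifs
    · rfl
    · exact Finset.sum_const_zero
  · have h : (fun o : Option V => o.elim (s none) (s ∘ some)) = s := by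
      funext o
      cases o <;> rfl
    refine if_congr (hasSpinorIndices_insertScalar hab) (congrArg f h.symm) rfl

variable [Fintype V] {F : Rules G ι} {Γ : Diagram V}

/-- The momenta of a graph, extended to a new vertex before the vertex `b` of a fermion line. -/
def extendMomenta (b : V) (q : (V → G) × (V → G)) : (Option V → G) × (Option V → G) :=
  (fun o => o.elim (q.1 b) q.1, fun o => o.elim (q.1 b) q.2)

/-- An external scalar of momentum zero leaves the momenta of a graph unchanged. -/
theorem sum_momenta_insertScalar {p : G} {a b : V} (hab : Γ.ferm a b)
    (f : (Option V → G) × (Option V → G) → ℂ) :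
    ∑ q ∈ momenta F (Γ.insertScalar a b) p, f q = ∑ q ∈ momenta F Γ p, f (extendMomenta b q) := by
  refine Finset.sum_bij (fun q _ => (q.1 ∘ some, q.2 ∘ some)) (fun q hq => ?_)
    (fun q hq q' hq' h => ?_) (fun q hq => ?_) fun q hq => ?_
  · rw [mem_momenta] at hq ⊢
    exact ((conserves_insertScalar hab).1 hq).1
  · rw [mem_momenta, conserves_insertScalar hab] at hq hq'
    obtain ⟨h₁, h₂⟩ := Prod.mk.inj h
    have h₁' := fun v => congrFun h₁ v
    have h₂' := fun v => congrFun h₂ v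
    refine Prod.ext (funext fun o => ?_) (funext fun o => ?_) <;> rcases o with _ | v
    · rw [hq.2.1, hq'.2.1]
      exact h₁' b
    · exact h₁' v
    · rw [hq.2.2, hq'.2.2]
      exact h₁' b
    · exact h₂' v
  · refine ⟨extendMomenta b q, ?_, rfl⟩
    rw [mem_momenta] at hq ⊢
    exact (conserves_insertScalar hab).2 ⟨hq, rfl, rfl⟩
  · rw [mem_momenta, conserves_insertScalar hab] at hq
    congr 1
    refine Prod.ext (funext fun o => ?_) (funext fun o => ?_) <;> rcases o with _ | v
    · exact hq.2.1
    · rfl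
    · exact hq.2.2
    · rfl

theorem scalarFactor_insertScalar (a b : V) (ord : Option V → ℕ) (q : (V → G) × (V → G)) :
    scalarFactor F (Γ.insertScalar a b) ord (extendMomenta b q) =
      scalarFactor F Γ (ord ∘ some) q := by
  classical
  rw [scalarFactor, scalarFactor, Fintype.prod_option]
  have h₁ : ∀ o, ¬ (Γ.insertScalar a b).scal none o := fun o => by cases o <;> exact id
  have h₂ : ∀ o, ¬ (Γ.insertScalar a b).scal o none := fun o => by cases o <;> exact id
  have h₃ : ∀ u v, (Γ.insertScalar a b).scal (some u) (some v) ↔ Γ.scal u v := fun _ _ => Iff.rfl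
  simp only [h₁, and_false, if_false, Finset.prod_const_one, one_mul, Fintype.prod_option, h₂, h₃]
  rfl

variable (F Γ)

open Classical in
/-- The internal fermion propagators. -/
noncomputable def fermEdges : Finset (V × V) := Finset.univ.filter fun e => Γ.ferm e.1 e.2

variable [Fintype ι] [DecidableEq ι]

theorem mem_fermEdges {Γ : Diagram V} {e : V × V} : e ∈ fermEdges Γ ↔ Γ.ferm e.1 e.2 := by
  classical
  exact Finset.mem_filter_univ e

theorem fermionFactor_eq_prod (m : ℝ) (k' : V → G) (s : V → ι) :
    fermionFactor F Γ m k' s =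
      ∏ e ∈ fermEdges Γ, F.fermionProp m (k' e.1) (s e.2) (s e.1) := by
  classical
  rw [fermionFactor, fermEdges, Finset.prod_filter, Fintype.prod_prod_type]

open Classical in
theorem hasDerivAt_fermionFactor {m : ℝ} {k' : V → G} (s : V → ι)
    (hk : ∀ e ∈ fermEdges Γ, IsUnit (F.dirac (k' e.1) - (m : ℂ) • (1 : Matrix ι ι ℂ)).det) :
    HasDerivAt (fun μ : ℝ => fermionFactor F Γ μ k' s)
      (∑ e ∈ fermEdges Γ,
        (∏ e' ∈ (fermEdges Γ).erase e, F.fermionProp m (k' e'.1) (s e'.2) (s e'.1)) *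
          (F.fermionProp m (k' e.1) * F.fermionProp m (k' e.1)) (s e.2) (s e.1)) m := by
  simp only [fermionFactor_eq_prod]
  exact HasDerivAt.fun_finsetProd fun e he => F.hasDerivAt_fermionProp (hk e he) _ _

variable {F Γ}

open Classical in
/-- The new vertex splits one propagator in two. -/
theorem fermionFactor_insertScalar {a b : V} (m : ℝ) {q : (V → G) × (V → G)}
    (hq : q.2 a = q.1 b) (s : V → ι) (x : ι) :
    fermionFactor F (Γ.insertScalar a b) m (extendMomenta b q).2 (fun o => o.elim x s) =
      (∏ e ∈ (fermEdges Γ).erase (a, b), F.fermionProp m (q.2 e.1) (s e.2) (s e.1)) *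
        (F.fermionProp m (q.2 a) (s b) x * F.fermionProp m (q.2 a) x (s a)) := by
  have h₁ : ∀ v, (Γ.insertScalar a b).ferm none (some v) ↔ v = b := fun _ => Iff.rfl
  have h₂ : ∀ u, (Γ.insertScalar a b).ferm (some u) none ↔ u = a := fun _ => Iff.rfl
  have h₃ : ¬ (Γ.insertScalar a b).ferm none none := id
  have h₄ : (fermEdges Γ).erase (a, b) = Finset.univ.filter fun e : V × V =>
      (Γ.insertScalar a b).ferm (some e.1) (some e.2) := by
    ext ⟨u, v⟩
    rw [Finset.mem_erase, mem_fermEdges, Finset.mem_filter_univ, and_comm]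
    exact and_congr_right fun _ => not_congr Prod.mk_inj
  rw [h₄, Finset.prod_filter, Fintype.prod_prod_type, fermionFactor, Fintype.prod_option]
  simp only [Fintype.prod_option, h₁, h₂, h₃, if_false, one_mul, Finset.prod_mul_distrib,
    Finset.prod_ite_eq', Finset.mem_univ, if_true, extendMomenta, Option.elim_none,
    Option.elim_some, hq]
  ring

/-- The mass derivative of an amplitude is the sum of the amplitudes with a scalar vertex of momentum
zero inserted on a fermion propagator. -/
theorem hasDerivAt_amplitudeOn {p : G} {m : ℝ} (ord : V → ℕ) (i j : ι)
    (hF : ∀ k ∈ F.cutoff, IsUnit (F.dirac k - (m : ℂ) • (1 : Matrix ι ι ℂ)).det) :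
    HasDerivAt (fun μ : ℝ => amplitudeOn F p Γ ord μ i j)
      (∑ e ∈ fermEdges Γ, amplitudeOn F p (Γ.insertScalar e.1 e.2) (fun o => o.elim 0 ord) m i j)
      m := by
  classical
  have hval : ∑ e ∈ fermEdges Γ,
      amplitudeOn F p (Γ.insertScalar e.1 e.2) (fun o => o.elim 0 ord) m i j =
      (-1) ^ (Nat.card (Quot Γ.ferm) - Γ.nOut) * ∑ q ∈ momenta F Γ p,
        (∑ s : V → ι with HasSpinorIndices Γ i j s, ∑ e ∈ fermEdges Γ,
          (∏ e' ∈ (fermEdges Γ).erase e, F.fermionProp m (q.2 e'.1) (s e'.2) (s e'.1)) *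
            (F.fermionProp m (q.2 e.1) * F.fermionProp m (q.2 e.1)) (s e.2) (s e.1)) *
          scalarFactor F Γ ord q := by
    have h : ∀ e ∈ fermEdges Γ,
        amplitudeOn F p (Γ.insertScalar e.1 e.2) (fun o => o.elim 0 ord) m i j =
        (-1) ^ (Nat.card (Quot Γ.ferm) - Γ.nOut) * ∑ q ∈ momenta F Γ p,
          (∑ s : V → ι with HasSpinorIndices Γ i j s,
            (∏ e' ∈ (fermEdges Γ).erase e, F.fermionProp m (q.2 e'.1) (s e'.2) (s e'.1)) *
              (F.fermionProp m (q.2 e.1) * F.fermionProp m (q.2 e.1)) (s e.2) (s e.1)) *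
            scalarFactor F Γ ord q := by
      rintro ⟨a, b⟩ he
      have hab : Γ.ferm a b := mem_fermEdges.1 he
      dsimp only
      rw [amplitudeOn, card_quot_ferm_insertScalar hab, nOut_insertScalar hab,
        sum_momenta_insertScalar hab]
      congr 1
      refine Finset.sum_congr rfl fun q hq => ?_
      rw [scalarFactor_insertScalar, sum_spinors_insertScalar hab]
      congr 1
      refine Finset.sum_congr rfl fun s _ => ?_
      rw [Matrix.mul_apply, Finset.mul_sum]
      exact Finset.sum_congr rfl fun x _ =>
        fermionFactor_insertScalar m ((mem_momenta.1 hq).internal a b hab).1 s x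
    rw [Finset.sum_congr rfl h, ← Finset.mul_sum, Finset.sum_comm]
    congr 1
    refine Finset.sum_congr rfl fun q _ => ?_
    rw [← Finset.sum_mul, Finset.sum_comm]
  rw [hval]
  refine HasDerivAt.const_mul _ (HasDerivAt.fun_sum fun q hq => HasDerivAt.mul_const
    (HasDerivAt.fun_sum fun s _ => hasDerivAt_fermionFactor F Γ s fun e he => ?_) _)
  have h := (mem_momenta.1 hq).internal _ _ (mem_fermEdges.1 he)
  rw [h.1]
  exact hF _ h.2

end Derivative

section MassIdentity

variable [DecidableEq ι]

/-- The tree level parts of the two Green functions satisfy the identity. -/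
theorem hasDerivAt_greenPsiPsi_iff {A : Gen → ℝ → Matrix ι ι ℂ} {d : Matrix ι ι ℂ} {k : ℕ} {m : ℝ}
    {i j : ι} : HasDerivAt (fun μ : ℝ => greenPsiPsi A d k μ i j) (greenPsiPsiPhi A k m i j) m ↔
      HasDerivAt (fun μ : ℝ => loopSum A .psipsi k μ i j) (loopSum A .psipsiphi k m i j) m := by
  have htree : HasDerivAt (fun μ : ℝ => (if k = 0 then d - (μ : ℂ) • (1 : Matrix ι ι ℂ) else 0) i j)
      ((-(if k = 0 then (1 : Matrix ι ι ℂ) else 0)) i j) m := by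
    split_ifs
    · have h : HasDerivAt (fun μ : ℝ => (μ : ℂ)) 1 m := Complex.ofRealCLM.hasDerivAt
      simpa using (h.mul_const ((1 : Matrix ι ι ℂ) i j)).const_sub (d i j)
    · simpa using hasDerivAt_const m (0 : ℂ)
  have hval : ∀ μ, greenPsiPsi A d k μ i j =
      (if k = 0 then d - (μ : ℂ) • (1 : Matrix ι ι ℂ) else 0) i j - loopSum A .psipsi k μ i j :=
    fun μ => rfl
  have hval' : greenPsiPsiPhi A k m i j =
      (-(if k = 0 then (1 : Matrix ι ι ℂ) else 0)) i j - loopSum A .psipsiphi k m i j := by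
    rw [greenPsiPsiPhi, neg_add]
    rfl
  constructor
  · intro h
    have h' := htree.sub h
    rw [hval'] at h'
    refine (h'.congr_of_eventuallyEq (Filter.Eventually.of_forall fun μ => ?_)).congr_deriv ?_
    · simp only [Pi.sub_apply, hval, sub_sub_cancel]
    · rw [sub_sub_cancel]
  · intro h
    rw [hval']
    exact (htree.sub h).congr_of_eventuallyEq (Filter.Eventually.of_forall hval)

theorem massIdentity_amplitude [Fintype ι] (F : Rules G ι) (p : G) (m : ℝ)
    (hF : ∀ k ∈ F.cutoff, IsUnit (F.dirac k - (m : ℂ) • (1 : Matrix ι ι ℂ)).det) :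
    MassIdentity (fun Γ => amplitude F p Γ.rep) (F.dirac p) m := by
  classical
  intro k i j
  -- the linear map that sends a graph to its amplitude
  let L : H ℂ →ₗ[ℂ] ℂ := (MvPolynomial.basisMonomials Gen ℂ).constr ℂ fun d =>
    if h : ∃ Γ, d = Finsupp.single Γ 1 then amplitude F p h.choose.rep m i j else 0
  have hL : ∀ Γ : Gen, L (MvPolynomial.X Γ) = amplitude F p Γ.rep m i j := by
    intro Γ
    have h : ∃ Γ' : Gen, (Finsupp.single Γ 1 : Gen →₀ ℕ) = Finsupp.single Γ' 1 := ⟨Γ, rfl⟩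
    have hc : h.choose = Γ := ((Finsupp.single_left_inj one_ne_zero).1 h.choose_spec).symm
    have hX : (MvPolynomial.X Γ : H ℂ) = MvPolynomial.basisMonomials Gen ℂ (Finsupp.single Γ 1) := by
      rw [MvPolynomial.coe_basisMonomials]
      rfl
    rw [hX, Module.Basis.constr_basis, dif_pos h, hc]
  have hins : ∀ Γ ∈ gens .psipsi k, ∀ e ∈ fermEdges Γ.rep,
      L (graph ℂ (Γ.rep.insertScalar e.1 e.2)) =
        amplitudeOn F p (Γ.rep.insertScalar e.1 e.2) (fun o => o.elim 0 Fin.val) m i j := by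
    intro Γ hΓ e he
    have hab := mem_fermEdges.1 he
    have hg : Γ.rep.IsGeneratorOf .psipsi := ⟨Γ.rep_isGenerator, (mem_gens.1 hΓ).1⟩
    have hg' := ((isomorphic_insertScalar Γ.rep e.1 e.2).isGeneratorOf _).2
      (isGeneratorOf_insertTwo_point hg hab)
    rw [graph_of_isGenerator ℂ hg'.1, hL, amplitude_eq_amplitudeOn]
    refine amplitudeOn_congr F p (Gen.rep_isGenerator _).1 (rep_toGen _ hg'.1) (fun u v huv he => ?_)
      (fun u v huv he => ?_) m i j
    · rw [Fin.val_injective he] at huv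
      exact (Gen.rep_isGenerator _).1.scal_irrefl _ huv
    · rcases u with _ | u <;> rcases v with _ | v
      · exact huv
      · exact huv
      · exact huv
      · rw [Fin.val_injective he] at huv
        exact hg.1.1.scal_irrefl _ huv
  have hsum : loopSum (fun Γ => amplitude F p Γ.rep) .psipsiphi k m i j =
      ∑ Γ ∈ gens .psipsi k, symWeight ℂ Γ * ∑ e ∈ fermEdges Γ.rep,
        amplitudeOn F p (Γ.rep.insertScalar e.1 e.2) (fun o => o.elim 0 Fin.val) m i j := by
    have h := congrArg L (c_psipsiphi_eq_insertionSum ℂ k)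
    rw [c, insertionSum, map_sum, map_sum] at h
    rw [loopSum, Matrix.sum_apply]
    refine Eq.trans (Finset.sum_congr rfl fun Γ _ => ?_) (h.trans (Finset.sum_congr rfl fun Γ hΓ => ?_))
    · rw [map_smul, hL]
      rfl
    · rw [map_smul, map_sum, smul_eq_mul]
      congr 1
      exact Finset.sum_congr rfl fun e he => hins Γ hΓ e he
  have hder : HasDerivAt (fun μ : ℝ => loopSum (fun Γ => amplitude F p Γ.rep) .psipsi k μ i j)
      (loopSum (fun Γ => amplitude F p Γ.rep) .psipsiphi k m i j) m := by
    rw [hsum]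
    have h : (fun μ : ℝ => loopSum (fun Γ => amplitude F p Γ.rep) .psipsi k μ i j) = fun μ =>
        ∑ Γ ∈ gens .psipsi k, symWeight ℂ Γ * amplitudeOn F p Γ.rep Fin.val μ i j := by
      funext μ
      rw [loopSum, Matrix.sum_apply]
      refine Finset.sum_congr rfl fun Γ _ => ?_
      rw [← amplitude_eq_amplitudeOn]
      rfl
    rw [h]
    exact HasDerivAt.fun_sum fun Γ _ =>
      HasDerivAt.const_mul _ (hasDerivAt_amplitudeOn Fin.val i j hF)
  exact hasDerivAt_greenPsiPsi_iff.2 hder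

end MassIdentity

end

/-! ### Characters of the quotient -/

section


variable {ι : Type*}

/-- The linear forms normalized at the unit matrix separate matrices. -/
theorem eq_zero_of_normalized_forms [DecidableEq ι] {X : Matrix ι ι ℂ}
    (h : ∀ l : Matrix ι ι ℂ →ₗ[ℂ] ℂ, l 1 = 1 → l X = 0) : X = 0 := by
  ext i j
  let l₀ : Matrix ι ι ℂ →ₗ[ℂ] ℂ := Matrix.entryLinearMap ℂ ℂ i i
  let f : Matrix ι ι ℂ →ₗ[ℂ] ℂ := Matrix.entryLinearMap ℂ ℂ i j
  have h₀ : l₀ 1 = 1 := Matrix.one_apply_eq i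
  have h₁ := h (f + (1 - f 1) • l₀) (by simp [h₀])
  rw [LinearMap.add_apply, LinearMap.smul_apply, h l₀ h₀, smul_zero, add_zero] at h₁
  exact h₁

theorem exists_comp_mkₐ_iff {K R S : Type*} [CommRing K] [CommRing R] [CommRing S] [Algebra K R]
    [Algebra K S] (f : R →ₐ[K] S) {X : Type*} (w : X → R) :
    (∃ Φ : (R ⧸ Ideal.span (Set.range w)) →ₐ[K] S,
      Φ.comp (Ideal.Quotient.mkₐ K (Ideal.span (Set.range w))) = f) ↔ ∀ x, f (w x) = 0 := by
  constructor
  · rintro ⟨Φ, rfl⟩ x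
    rw [AlgHom.comp_apply, Ideal.Quotient.mkₐ_eq_mk,
      Ideal.Quotient.eq_zero_iff_mem.2 (Ideal.subset_span (Set.mem_range_self x)), map_zero]
  · intro h
    have hle : Ideal.span (Set.range w) ≤ RingHom.ker f := Ideal.span_le.2 (by
      rintro _ ⟨x, rfl⟩
      exact h x)
    exact ⟨Ideal.Quotient.liftₐ _ f fun a ha => hle ha, Ideal.Quotient.liftₐ_comp _ _ _⟩

/-- The mass derivative of the self-energies of order `k`. -/
noncomputable def loopSumDeriv (A : Gen → ℝ → Matrix ι ι ℂ) (k : ℕ) (m : ℝ) : Matrix ι ι ℂ :=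
  ∑ Γ ∈ gens .psipsi k, symWeight ℂ Γ • Matrix.of fun i j => deriv (fun μ : ℝ => A Γ μ i j) m

theorem hasDerivAt_loopSum {A : Gen → ℝ → Matrix ι ι ℂ} {m : ℝ}
    (hA : ∀ Γ : Gen, Γ.rep.HasResidue .psipsi →
      ∀ i j, DifferentiableAt ℝ (fun μ : ℝ => A Γ μ i j) m) (k : ℕ) (i j : ι) :
    HasDerivAt (fun μ : ℝ => loopSum A .psipsi k μ i j) (loopSumDeriv A k m i j) m := by
  simp only [loopSum, loopSumDeriv, Matrix.sum_apply, Matrix.smul_apply, Matrix.of_apply,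
    smul_eq_mul]
  exact HasDerivAt.fun_sum fun Γ hΓ =>
    ((hA Γ (mem_gens.1 hΓ).1 i j).hasDerivAt).const_mul _

theorem massCharacter_wardElement (A : Gen → ℝ → Matrix ι ι ℂ) (l : Matrix ι ι ℂ →ₗ[ℂ] ℂ)
    (t : Gen → ℂ) (m : ℝ) (k : ℕ) : massCharacter A l t m (wardElement ℂ k) =
      l (loopSum A .psipsiphi k m - loopSumDeriv A k m) := by
  have h₁ : massCharacter A l t m (c ℂ .psipsi k) = - l (loopSumDeriv A k m) := by
    rw [c, loopSumDeriv, map_sum, map_sum, ← Finset.sum_neg_distrib]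
    refine Finset.sum_congr rfl fun Γ hΓ => ?_
    rw [map_smul, map_smul, massCharacter, MvPolynomial.aeval_X, if_pos (mem_gens.1 hΓ).1,
      smul_neg]
  have h₂ : massCharacter A l t m (c ℂ .psipsiphi k) = l (loopSum A .psipsiphi k m) := by
    rw [c, loopSum, map_sum, map_sum]
    refine Finset.sum_congr rfl fun Γ hΓ => ?_
    have hr := (mem_gens.1 hΓ).1
    have hn : ¬ Γ.rep.HasResidue .psipsi := fun h => Residue.noConfusion (hr.unique h)
    rw [map_smul, map_smul, massCharacter, MvPolynomial.aeval_X, if_neg hn, if_pos hr]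
  rw [wardElement, map_add, h₁, h₂, map_sub]
  ring

/-- The characters kill the generator of order `k` exactly if every normalized linear form takes equal
values on the vertex graphs and on the mass derivative of the self-energies of order `k`. -/
theorem massIdentity_iff [DecidableEq ι] {A : Gen → ℝ → Matrix ι ι ℂ} {d : Matrix ι ι ℂ} (t : Gen → ℂ) {m : ℝ}
    (hA : ∀ Γ : Gen, Γ.rep.HasResidue .psipsi →
      ∀ i j, DifferentiableAt ℝ (fun μ : ℝ => A Γ μ i j) m) :
    MassIdentity A d m ↔ ∀ l : Matrix ι ι ℂ →ₗ[ℂ] ℂ, l 1 = 1 →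
      ∃ Φ : (H ℂ ⧸ wardIdeal ℂ) →ₐ[ℂ] ℂ,
        Φ.comp (Ideal.Quotient.mkₐ ℂ (wardIdeal ℂ)) = massCharacter A l t m := by
  have h₁ : MassIdentity A d m ↔ ∀ k, loopSum A .psipsiphi k m - loopSumDeriv A k m = 0 := by
    refine forall_congr' fun k => ?_
    rw [sub_eq_zero, ← Matrix.ext_iff]
    refine forall₂_congr fun i j => hasDerivAt_greenPsiPsi_iff.trans ⟨fun h => ?_, fun h => ?_⟩
    · exact h.unique (hasDerivAt_loopSum hA k i j)
    · rw [h]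
      exact hasDerivAt_loopSum hA k i j
  rw [h₁]
  refine ⟨fun h l _ => (exists_comp_mkₐ_iff _ _).2 fun k => ?_,
    fun h k => eq_zero_of_normalized_forms fun l hl => ?_⟩
  · rw [massCharacter_wardElement, h k, map_zero]
  · rw [← massCharacter_wardElement A l t]
    exact (exists_comp_mkₐ_iff _ _).1 (h l hl) k

end

end Yukawa

theorem theorem2 (K : Type*) [Field K] [CharZero K]
    {ι : Type*} [Fintype ι] [DecidableEq ι] {G : Type*} [AddCommGroup G] :
    -- the ideal generated by the `c_k^{ψ̄ψ} + c_k^{ψ̄ψφ}` is a co-ideal, in `H` and in `H_grad`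
    Yukawa.IsCoidealOf K ⊤ ((Yukawa.wardIdeal K).restrictScalars K) ∧
    Yukawa.IsCoidealOf K (Subalgebra.toSubmodule (Yukawa.Hgrad K))
      (((Yukawa.wardIdealGrad K).restrictScalars K).map (Yukawa.Hgrad K).val.toLinearMap) ∧
    -- the vertex graphs arise by inserting a scalar vertex on every internal fermion propagator
    (∀ k, Yukawa.c K .psipsiphi k = Yukawa.insertionSum K k) ∧
    -- hence the identity `∂_m G^{ψ̄ψ} = G^{ψ̄ψφ}` for (regularized) Feynman rules
    (∀ (F : Yukawa.Rules G ι) (p : G) (m : ℝ),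
      (∀ k ∈ F.cutoff, IsUnit (F.dirac k - (m : ℂ) • (1 : Matrix ι ι ℂ)).det) →
      Yukawa.MassIdentity (fun Γ => Yukawa.amplitude F p Γ.rep) (F.dirac p) m) ∧
    -- for arbitrary amplitudes, the identity says that the characters descend to the quotient
    (∀ (A : Yukawa.Gen → ℝ → Matrix ι ι ℂ) (d : Matrix ι ι ℂ) (t : Yukawa.Gen → ℂ) (m : ℝ),
      (∀ Γ : Yukawa.Gen, Γ.rep.HasResidue .psipsi →
        ∀ i j, DifferentiableAt ℝ (fun μ : ℝ => A Γ μ i j) m) →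
      (Yukawa.MassIdentity A d m ↔
        ∀ l : Matrix ι ι ℂ →ₗ[ℂ] ℂ, l 1 = 1 →
          ∃ Φ : (Yukawa.H ℂ ⧸ Yukawa.wardIdeal ℂ) →ₐ[ℂ] ℂ,
            Φ.comp (Ideal.Quotient.mkₐ ℂ (Yukawa.wardIdeal ℂ)) =
              Yukawa.massCharacter A l t m)) :=
  ⟨Yukawa.isCoidealOf_wardIdeal K, Yukawa.isCoidealOf_wardIdealGrad K,
    Yukawa.c_psipsiphi_eq_insertionSum K, Yukawa.massIdentity_amplitude,
    fun _ _ t _ hA => Yukawa.massIdentity_iff t hA⟩
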